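/- **Notation.** Let $\mathbb K=\mathbb Q(t,q)$. For $k\ge 0$ let $\mathscr P_k^+=\mathbb K[x_1,\dots,x_k]$, and let $\mathscr P_\infty^+$ be the graded inverse limit of the rings $\mathscr P_k^+$ along the evaluations $x_{k+1}\mapsto 0$, with canonical morphisms $\Pi_k:\mathscr P_\infty^+\to\mathscr P_k^+$. Let $s_i$ interchange $x_i$ and $x_{i+1}$, and let $\mathscr P_{\rm as}^+\subset\mathscr P_\infty^+$ be the subring of the elements fixed by all but finitely many $s_i$ (almost symmetric elements). *Limits.* For $R=A/B\in\mathbb K$ with $A,B\in\mathbb Q[t,q]$ let $\operatorname{ord}R$ be the difference of the orders of vanishing of $A$ and $B$ at $t=0$ (with $\operatorname{ord} 0=+\infty$); a sequence $(a_k)$ in $\mathbb K$ converges to $a$ if $\operatorname{ord}(a_k-a)\to+\infty$. A sequence $f_k\in\mathscr P_k^+$ (given for all large $k$) converges to $F\in \mathscr P_\infty^+$ if there are $h\in\mathscr P_\infty^+$, finitely many $g_1,\dots,g_N\in\mathscr P_{\rm as}^+$, and sequences $(a_{j,k})_k$ in $\mathbb K$ converging to $a_j$, such that $f_k=\Pi_k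 h+\sum_j a_{j,k}\,\Pi_k g_j$ for all large $k$ and $F=h+\sum_j a_jg_j$. Such an $F$ is unique. *Operators.* For $1\le i<k$ let $T_i$ act on $\mathscr P_k^+$ by $T_if=s_if+(1-t)x_i\frac{f-s_if}{x_i-x_{i+1}}$; it is invertible. Let $\varpi_kf={\rm pr}_1 f(x_2,\dots,x_k,qx_1)$, where ${\rm pr}_1$ is the $\mathbb K$-linear map that fixes the monomials divisible by $x_1$ and kills the other monomials. For $1\le i\le k$ let $$\widetilde Y_i^{(k)}=t^{k+1-i}\,T_{i-1}\cdots T_1\,\varpi_k\,T_{k-1}^{-1}\cdots T_i^{-1}:\mathscr P_k^+\to\mathscr P_k^+ .$$ The limit Cherednik operator is $\mathscr Y_i:\mathscr P_{\rm as}^+\to\mathscr P_{\rm as}^+$, $\mathscr Y_if=\lim_k\widetilde Y_i^{(k)}\Pi_kf$. *Bruhat order.* Let $\widetilde S_k$ be the affine symmetric group acting on $\mathbb Z^k$, generated by the simple reflections $s_1,\dots,s_{k-1}$ (adjacent transpositions of coordinates) and $s_0(x)=x-(1-x_1+x_k)(\varepsilon_k-\varepsilon_1)$, with its length function and Bruhat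 order. Each $\widetilde S_k$-orbit in $\mathbb Z^k$ contains a unique minuscule weight, i.e. an $x$ with $x_1\ge x_2\ge\dots\ge x_k\ge x_1-1$; for $\lambda\in\mathbb Z^k$ let $\tilde\lambda$ be the minuscule weight in its orbit and $w_\lambda$ the minimal length element of $\widetilde S_k$ with $w_\lambda(\tilde\lambda)=\lambda$. Put $\lambda\le\mu$ if $\lambda,\mu$ lie in the same orbit and $w_\lambda\le w_\mu$. These orders are compatible with extension by zeros $\mathbb Z_{\ge0}^k\to\mathbb Z_{\ge0}^{k+1}$ and give an order $\le$ on compositions (finite sequences of non-negative integers) up to trailing zeros. *Almost symmetric monomials.* Let $\Lambda_{\rm as}$ be the set of pairs $(\lambda|\mu)$, where $\lambda$ is a strict composition (empty, or with last part non-zero) and $\mu$ is a (possibly empty) partition. Let $\ell(\lambda)$ be the length of $\lambda$, let $m_{(\lambda|\mu)}=x^\lambda\, m_\mu[x_{\ell(\lambda)+1}+x_{\ell(\lambda)+2}+\cdots]\in\mathscr P_{\rm as}^+$, with $m_\mu$ the monomial symmetric function, and let $\lambda\mu$ denote concatenation. Define $(\lambda|\mu)\preceq(\eta|\nu)$ if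 $\ell(\lambda)\le\ell(\eta)$ and $\lambda\,0^{\ell(\eta)-\ell(\lambda)}\mu\le\eta\nu$, and $\prec$ as $\preceq$ and $\neq$. For a composition $\lambda$ (with $\lambda_j=0$ for $j>\ell(\lambda)$) and $i\ge1$, let $\operatorname{sgn}_i(\lambda)=1$ if $\lambda_i>0$ and $\operatorname{sgn}_i(\lambda)=0$ otherwise, and let $$u_\lambda(i)=\bigl|\{1\le j\le i:\lambda_j>\lambda_i\}\bigr|+\bigl|\{i\le j\le\ell(\lambda):\lambda_j\ge\lambda_i\}\bigr| .$$ **Theorem.** Let $i\ge1$. For every $f\in\mathscr P_{\rm as}^+$ the sequence $(\widetilde Y_i^{(k)}\Pi_kf)_{k\ge i}$ converges to an element of $\mathscr P_{\rm as}^+$, so that $\mathscr Y_i$ is well defined, and for every $(\lambda|\mu)\in\Lambda_{\rm as}$ $$\mathscr Y_i\, m_{(\lambda|\mu)}\in \operatorname{sgn}_i(\lambda)\,q^{\lambda_i}\,t^{u_{\lambda\mu}(i)}\,m_{(\lambda|\mu)}+\sum_{(\lambda'|\mu')\prec(\lambda|\mu)}\mathbb K\, m_{(\lambda'|\mu')}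 .$$ -/

import Mathlib

noncomputable section

namespace StableLimitDAHA

open Filter MvPolynomial

/-! ### The field of parameters and its notion of limit -/

/-- The field `ℚ(t, q)`. -/
abbrev K : Type := FractionRing (MvPolynomial (Fin 2) ℚ)

/-- The parameter `t`. -/
def tpar : K := algebraMap (MvPolynomial (Fin 2) ℚ) K (X 0)

/-- The parameter `q`. -/
def qpar : K := algebraMap (MvPolynomial (Fin 2) ℚ) K (X 1)

/-- The order of vanishing at `t = 0` of a polynomial in `ℚ[t, q]` (it is `⊤` for `0`). -/
def polyOrd (A : MvPolynomial (Fin 2) ℚ) : ℕ∞ := emultiplicity (X 0) A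

/-- `OrdGE N r` means `ord r ≥ N`, where `ord (A / B) = ord A - ord B` is the order of vanishing
at `t = 0`, and `ord 0 = +∞`. -/
def OrdGE (N : ℕ) (r : K) : Prop :=
  ∃ A B : MvPolynomial (Fin 2) ℚ, B ≠ 0 ∧
    r = algebraMap (MvPolynomial (Fin 2) ℚ) K A / algebraMap (MvPolynomial (Fin 2) ℚ) K B ∧
    N + polyOrd B ≤ polyOrd A

/-- The sequence `a` of elements of `ℚ(t, q)` converges to `l`: `ord (a n - l)` tends to `+∞`. -/
def ScalarTendsto (a : ℕ → K) (l : K) : Prop :=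
  ∀ N : ℕ, ∀ᶠ n in atTop, OrdGE N (a n - l)

/-! ### Polynomials and almost symmetric formal polynomials

The variables are `x_j = X j` with `j ≥ 1`; the variable `X 0` is never used. -/

/-- Polynomials over `ℚ(t, q)` in countably many variables. -/
abbrev Poly : Type := MvPolynomial ℕ K

/-- The subring `ℚ(t, q)[x_1, …, x_k]`. -/
def finPoly (k : ℕ) : Subalgebra K Poly := supported K (Set.Icc 1 k)

/-- The evaluation morphism `x_j ↦ 0`. -/
def dropVar (j : ℕ) : Poly →ₐ[K] Poly := aeval (fun n => if n = j then 0 else X n)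

/-- The simple transposition `s_i`, which interchanges `x_i` and `x_{i+1}`. -/
def swapVars (i : ℕ) : Poly →ₐ[K] Poly := rename (Equiv.swap i (i + 1))

/-- The graded inverse limit of the rings `ℚ(t, q)[x_1, …, x_k]` along `x_{k+1} ↦ 0`: sequences
of polynomials compatible with the evaluation morphisms and of bounded degree. The `k`-th term of
such a sequence `F` is its image under the canonical morphism `Π_k`. -/
def formalPoly : Subalgebra K (ℕ → Poly) where
  carrier := {F | (∀ k, F k ∈ finPoly k) ∧ (∀ k, dropVar (k + 1) (F (k + 1)) = F k) ∧
    ∃ d : ℕ, ∀ k, (F k).totalDegree ≤ d}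
  mul_mem' := by
    rintro F G ⟨hF, hF', d, hd⟩ ⟨hG, hG', e, he⟩
    refine ⟨fun k => mul_mem (hF k) (hG k), fun k => ?_, d + e, fun k => ?_⟩
    · simp [hF', hG']
    · exact (totalDegree_mul _ _).trans (add_le_add (hd k) (he k))
  add_mem' := by
    rintro F G ⟨hF, hF', d, hd⟩ ⟨hG, hG', e, he⟩
    refine ⟨fun k => add_mem (hF k) (hG k), fun k => ?_, max d e, fun k => ?_⟩
    · simp [hF', hG']
    · exact (totalDegree_add _ _).trans (max_le_max (hd k) (he k))
  algebraMap_mem' r := by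
    refine ⟨fun k => (finPoly k).algebraMap_mem r, fun k => ?_, 0, fun k => ?_⟩
    · simp
    · simp [Pi.algebraMap_apply, MvPolynomial.algebraMap_eq]

/-- The ring of almost symmetric formal polynomials: those fixed by all the simple transpositions
`s_i`, `i > m`, for some `m`. The action of `s_i` on the inverse limit is induced by its action on
the polynomials in `x_1, …, x_n`, for all `n ≥ i + 1`. -/
def almostSym : Subalgebra K (ℕ → Poly) where
  carrier := {F | F ∈ formalPoly ∧ ∃ m : ℕ, ∀ i, m < i → ∀ n, i + 1 ≤ n → swapVars i (F n) = F n}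
  mul_mem' := by
    rintro F G ⟨hF, m, hm⟩ ⟨hG, n, hn⟩
    refine ⟨mul_mem hF hG, max m n, fun i hi k hk => ?_⟩
    simp [hm i (lt_of_le_of_lt (le_max_left _ _) hi) k hk,
      hn i (lt_of_le_of_lt (le_max_right _ _) hi) k hk]
  add_mem' := by
    rintro F G ⟨hF, m, hm⟩ ⟨hG, n, hn⟩
    refine ⟨add_mem hF hG, max m n, fun i hi k hk => ?_⟩
    simp [hm i (lt_of_le_of_lt (le_max_left _ _) hi) k hk,
      hn i (lt_of_le_of_lt (le_max_right _ _) hi) k hk]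
  algebraMap_mem' r := ⟨formalPoly.algebraMap_mem r, 0, fun i _ k _ => by simp⟩

/-- `IsSeqLimit f F` means that the sequence of polynomials `f k` in `x_1, …, x_k` converges to the
formal polynomial `F`: one has `f k = h k + ∑ i, a i k • g i k`, where `h` is a formal polynomial,
the `g i` are finitely many almost symmetric formal polynomials, each scalar sequence `a i`
converges to some `l i`, and `F = h + ∑ i, l i • g i`. The decomposition is asked for all large `k`
only; this is the same as asking it for all `k`, since the values of `f` at finitely many `k` can
be altered at will by terms `a k • g k` with `g` a polynomial and `a` finitely supported. -/
def IsSeqLimit (f : ℕ → Poly) (F : ℕ → Poly) : Prop :=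
  ∃ (N : ℕ) (h : ℕ → Poly) (g : Fin N → ℕ → Poly) (a : Fin N → ℕ → K) (l : Fin N → K),
    h ∈ formalPoly ∧ (∀ i, g i ∈ almostSym) ∧ (∀ i, ScalarTendsto (a i) (l i)) ∧
    (∀ᶠ k in atTop, f k = h k + ∑ i, a i k • g i k) ∧
    F = h + ∑ i, l i • g i

/-! ### Uniqueness of limits -/

theorem polyOrd_mul (A B : MvPolynomial (Fin 2) ℚ) : polyOrd (A * B) = polyOrd A + polyOrd B :=
  emultiplicity_mul (X_prime)

theorem polyOrd_ne_top {A : MvPolynomial (Fin 2) ℚ} (hA : A ≠ 0) : polyOrd A ≠ ⊤ :=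
  finiteMultiplicity_iff_emultiplicity_ne_top.1
    (FiniteMultiplicity.of_prime_left (X_prime) hA)

theorem OrdGE.add {N : ℕ} {r s : K} (hr : OrdGE N r) (hs : OrdGE N s) : OrdGE N (r + s) := by
  obtain ⟨A, B, hB, rfl, h⟩ := hr
  obtain ⟨A', B', hB', rfl, h'⟩ := hs
  have hb := (FaithfulSMul.algebraMap_eq_zero_iff (MvPolynomial (Fin 2) ℚ) K).not.2 hB
  have hb' := (FaithfulSMul.algebraMap_eq_zero_iff (MvPolynomial (Fin 2) ℚ) K).not.2 hB'
  refine ⟨A * B' + B * A', B * B', mul_ne_zero hB hB', ?_, ?_⟩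
  · rw [div_add_div _ _ hb hb']; simp only [map_add, map_mul]
  · refine le_trans (le_min ?_ ?_) min_le_emultiplicity_add
    · change _ ≤ polyOrd (A * B')
      rw [polyOrd_mul, polyOrd_mul, ← add_assoc]
      exact add_le_add h le_rfl
    · change _ ≤ polyOrd (B * A')
      rw [polyOrd_mul, polyOrd_mul, add_left_comm]
      exact add_le_add le_rfl h'

theorem exists_ordGE_mul (c : K) :
    ∃ M : ℕ, ∀ (N : ℕ) (r : K), OrdGE (N + M) r → OrdGE N (r * c) := by
  obtain ⟨C', D, hD, rfl⟩ := IsFractionRing.div_surjective (A := MvPolynomial (Fin 2) ℚ) c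
  have hD0 : D ≠ 0 := nonZeroDivisors.ne_zero hD
  obtain ⟨M, hM⟩ := ENat.ne_top_iff_exists.1 (polyOrd_ne_top hD0)
  refine ⟨M, fun N r hr => ?_⟩
  obtain ⟨A, B, hB, rfl, h⟩ := hr
  refine ⟨A * C', B * D, mul_ne_zero hB hD0, ?_, ?_⟩
  · rw [div_mul_div_comm, map_mul, map_mul]
  · rw [polyOrd_mul, polyOrd_mul, ← hM]
    push_cast at h
    calc (N : ℕ∞) + (polyOrd B + M) = N + M + polyOrd B := by ring
      _ ≤ polyOrd A := h
      _ ≤ polyOrd A + polyOrd C' := le_self_add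

theorem eq_zero_of_ordGE {r : K} (h : ∀ N, OrdGE N r) : r = 0 := by
  obtain ⟨A, B, hB, rfl⟩ := IsFractionRing.div_surjective (A := MvPolynomial (Fin 2) ℚ) r
  have hB0 : B ≠ 0 := nonZeroDivisors.ne_zero hB
  by_contra hne
  have hA : A ≠ 0 := by rintro rfl; simp at hne
  obtain ⟨M, hM⟩ := ENat.ne_top_iff_exists.1 (polyOrd_ne_top hA)
  obtain ⟨A', B', hB', he, h'⟩ := h (M + 1)
  have hb := (FaithfulSMul.algebraMap_eq_zero_iff (MvPolynomial (Fin 2) ℚ) K).not.2 hB0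
  have hb' := (FaithfulSMul.algebraMap_eq_zero_iff (MvPolynomial (Fin 2) ℚ) K).not.2 hB'
  rw [div_eq_div_iff hb hb', ← map_mul, ← map_mul] at he
  have he' := congrArg polyOrd (IsFractionRing.injective (MvPolynomial (Fin 2) ℚ) K he)
  rw [polyOrd_mul, polyOrd_mul, ← hM] at he'
  obtain ⟨b', hb'⟩ := ENat.ne_top_iff_exists.1 (polyOrd_ne_top hB')
  rw [← hb'] at he' h'
  have h2 : ((M + 1 : ℕ) : ℕ∞) + b' ≤ M + b' := by
    rw [he']; exact h'.trans le_self_add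
  norm_cast at h2
  omega

theorem ScalarTendsto.add {a b : ℕ → K} {l m : K} (ha : ScalarTendsto a l)
    (hb : ScalarTendsto b m) : ScalarTendsto (fun n => a n + b n) (l + m) := by
  intro N
  filter_upwards [ha N, hb N] with n h1 h2
  rw [add_sub_add_comm]
  exact h1.add h2

theorem ScalarTendsto.mul_const {a : ℕ → K} {l : K} (ha : ScalarTendsto a l) (c : K) :
    ScalarTendsto (fun n => a n * c) (l * c) := by
  intro N
  obtain ⟨M, hM⟩ := exists_ordGE_mul c
  filter_upwards [ha (N + M)] with n h1
  rw [← sub_mul]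
  exact hM N _ h1

theorem ordGE_zero (N : ℕ) : OrdGE N 0 := ⟨0, 1, one_ne_zero, by simp, by simp [polyOrd]⟩

theorem ScalarTendsto.const (c : K) : ScalarTendsto (fun _ => c) c := fun N =>
  Eventually.of_forall fun n => by rw [sub_self]; exact ordGE_zero N

theorem ScalarTendsto.sum {ι : Type*} (s : Finset ι) {a : ι → ℕ → K} {l : ι → K}
    (h : ∀ i ∈ s, ScalarTendsto (a i) (l i)) :
    ScalarTendsto (fun n => ∑ i ∈ s, a i n) (∑ i ∈ s, l i) := by
  classical
  induction s using Finset.induction_on with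
  | empty => simpa using ScalarTendsto.const 0
  | insert j s hj ih =>
    simp only [Finset.sum_insert hj]
    exact (h j (Finset.mem_insert_self _ _)).add
      (ih fun i hi => h i (Finset.mem_insert_of_mem hi))

theorem ScalarTendsto.unique {a b : ℕ → K} {l m : K} (ha : ScalarTendsto a l)
    (hb : ScalarTendsto b m) (hab : ∀ᶠ n in atTop, a n = b n) : l = m := by
  rw [← sub_eq_zero]
  refine eq_zero_of_ordGE fun N => ?_
  have hb' := hb.mul_const (-1)
  obtain ⟨n, h1, h2, h3⟩ := ((ha N).and ((hb' N).and hab)).exists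
  have h4 : OrdGE N ((l - m) * -1) := by
    have := h1.add h2
    rwa [h3, show b n - l + (b n * -1 - m * -1) = (l - m) * -1 by ring] at this
  obtain ⟨A, B, hB, he, h⟩ := h4
  refine ⟨-A, B, hB, ?_, ?_⟩
  · rw [map_neg, neg_div, ← he]; ring
  · simpa only [polyOrd, emultiplicity_neg] using h

/-- The evaluation of all variables but `x_1, …, x_k` at `0`. -/
def truncVars (k : ℕ) : Poly →ₐ[K] Poly := aeval (fun n => if n ∈ Set.Icc 1 k then X n else 0)

theorem truncVars_formalPoly {F : ℕ → Poly} (hF : F ∈ formalPoly) {k n : ℕ} (h : k ≤ n) :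
    truncVars k (F n) = F k := by
  induction n, h using Nat.le_induction with
  | base =>
    have h : finPoly k ≤ AlgHom.equalizer (truncVars k) (AlgHom.id K Poly) := by
      refine Algebra.adjoin_le ?_
      rintro _ ⟨n, hn, rfl⟩
      simp [truncVars, hn.1, hn.2]
    exact h (hF.1 k)
  | succ n hn ih =>
    rw [← ih, ← hF.2.1 n, ← AlgHom.comp_apply]
    congr 1
    refine algHom_ext fun j => ?_
    by_cases hj : j = n + 1
    · subst hj
      simp [truncVars, dropVar]
      omega
    · simp [truncVars, dropVar, hj]

/-- The limit of a sequence of polynomials is unique. -/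
theorem IsSeqLimit.unique {f F G : ℕ → Poly} (hF : IsSeqLimit f F) (hG : IsSeqLimit f G) :
    F = G := by
  have key : ∀ {H : ℕ → Poly}, IsSeqLimit f H → ∀ (k : ℕ) (e : ℕ →₀ ℕ),
      ScalarTendsto (fun n => coeff e (truncVars k (f n))) (coeff e (H k)) := by
    rintro _ ⟨N, h, g, a, l, hh, hg, ha, hf, rfl⟩ k e
    have h1 : ScalarTendsto (fun n => coeff e (h k) + ∑ i, a i n * coeff e (g i k))
        (coeff e (h k) + ∑ i, l i * coeff e (g i k)) :=
      (ScalarTendsto.const _).add (ScalarTendsto.sum _ fun i _ => (ha i).mul_const _)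
    intro M
    filter_upwards [h1 M, hf, eventually_ge_atTop k] with n hn hfn hkn
    have e1 : coeff e (truncVars k (f n)) = coeff e (h k) + ∑ i, a i n * coeff e (g i k) := by
      rw [hfn]
      simp only [map_add, map_sum, map_smul, truncVars_formalPoly hh hkn,
        fun i => truncVars_formalPoly (hg i).1 hkn, coeff_add, coeff_sum, coeff_smul, smul_eq_mul]
    rw [e1]
    simpa [coeff_sum] using hn
  funext k
  ext e
  exact (key hF k e).unique (key hG k e) (Eventually.of_forall fun _ => rfl)

/-! ### The Demazure-Lusztig operators -/

theorem exists_dividedDifference (i : ℕ) (f : Poly) :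
    ∃ g : Poly, (X i - X (i + 1)) * g = f - swapVars i f := by
  induction f using MvPolynomial.induction_on with
  | C a => exact ⟨0, by simp [swapVars]⟩
  | add p r hp hr =>
    obtain ⟨g, hg⟩ := hp
    obtain ⟨g', hg'⟩ := hr
    exact ⟨g + g', by rw [mul_add, hg, hg', map_add]; ring⟩
  | mul_X p n hp =>
    obtain ⟨g, hg⟩ := hp
    have key : ∃ c : Poly, (X i - X (i + 1)) * c = X n - swapVars i (X n) := by
      by_cases h1 : n = i
      · subst h1; exact ⟨1, by simp [swapVars]⟩
      · by_cases h2 : n = i + 1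
        · subst h2; exact ⟨-1, by simp [swapVars]; ring⟩
        · exact ⟨0, by simp [swapVars, Equiv.swap_apply_of_ne_of_ne h1 h2]⟩
    obtain ⟨c, hc⟩ := key
    refine ⟨g * X n + swapVars i p * c, ?_⟩
    rw [map_mul]
    linear_combination X n * hg + swapVars i p * hc

theorem X_sub_X_ne_zero (i : ℕ) : (X i - X (i + 1) : Poly) ≠ 0 := by
  rw [sub_ne_zero]
  intro h
  have := X_injective h
  omega

/-- The divided difference `f ↦ (f - s_i f) / (x_i - x_{i+1})`. -/
def dividedDifference (i : ℕ) : Poly →ₗ[K] Poly where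
  toFun f := (exists_dividedDifference i f).choose
  map_add' f g := by
    apply mul_left_cancel₀ (X_sub_X_ne_zero i)
    rw [mul_add, (exists_dividedDifference i (f + g)).choose_spec,
      (exists_dividedDifference i f).choose_spec, (exists_dividedDifference i g).choose_spec,
      map_add]
    ring
  map_smul' c f := by
    apply mul_left_cancel₀ (X_sub_X_ne_zero i)
    rw [RingHom.id_apply, mul_smul_comm, (exists_dividedDifference i (c • f)).choose_spec,
      (exists_dividedDifference i f).choose_spec, map_smul, smul_sub]

theorem dividedDifference_spec (i : ℕ) (f : Poly) :
    (X i - X (i + 1)) * dividedDifference i f = f - swapVars i f :=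
  (exists_dividedDifference i f).choose_spec

/-- The Demazure-Lusztig operator
`T_i f = s_i f + (1 - t) x_i (f - s_i f) / (x_i - x_{i+1})`. -/
def demazureLusztig (i : ℕ) : Module.End K Poly :=
  (swapVars i).toLinearMap +
    (1 - tpar) • (LinearMap.mulLeft K (X i : Poly) ∘ₗ dividedDifference i)

/-- The inverse of `T_i`, namely `t⁻¹ (T_i + t - 1)`. -/
def demazureLusztigInv (i : ℕ) : Module.End K Poly :=
  tpar⁻¹ • (demazureLusztig i + (tpar - 1) • 1)

theorem tpar_ne_zero : tpar ≠ 0 := by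
  unfold tpar
  rw [Ne, FaithfulSMul.algebraMap_eq_zero_iff]
  exact X_ne_zero _

theorem swapVars_swapVars (i : ℕ) (f : Poly) : swapVars i (swapVars i f) = f := by
  simp only [swapVars, rename_rename]
  have : (Equiv.swap i (i + 1) : ℕ → ℕ) ∘ (Equiv.swap i (i + 1)) = id := by
    funext x; simp
  rw [this, rename_id_apply]

theorem swapVars_dividedDifference (i : ℕ) (f : Poly) :
    swapVars i (dividedDifference i f) = dividedDifference i f := by
  apply mul_left_cancel₀ (X_sub_X_ne_zero i)
  have h := congrArg (swapVars i) (dividedDifference_spec i f)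
  rw [map_mul, map_sub, map_sub, swapVars_swapVars] at h
  have h1 : swapVars i (X i : Poly) = X (i + 1) := by simp [swapVars]
  have h2 : swapVars i (X (i + 1) : Poly) = X i := by simp [swapVars]
  rw [h1, h2] at h
  linear_combination -h - dividedDifference_spec i f

/-- The quadratic relation `(T_i - 1)(T_i + t) = 0`. -/
theorem demazureLusztig_quadratic (i : ℕ) :
    (demazureLusztig i - 1) * (demazureLusztig i + tpar • 1) = 0 := by
  have h1 : swapVars i (X i : Poly) = X (i + 1) := by simp [swapVars]
  have hT : ∀ f, demazureLusztig i f =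
      swapVars i f + C (1 - tpar) * (X i * dividedDifference i f) := by
    intro f
    simp [demazureLusztig, smul_eq_C_mul]
  refine LinearMap.ext fun f => ?_
  have hDs : dividedDifference i (swapVars i f) = - dividedDifference i f := by
    apply mul_left_cancel₀ (X_sub_X_ne_zero i)
    have ha := dividedDifference_spec i (swapVars i f)
    rw [swapVars_swapVars] at ha
    linear_combination ha + dividedDifference_spec i f
  have hDD : dividedDifference i (X i * dividedDifference i f) = dividedDifference i f := by
    apply mul_left_cancel₀ (X_sub_X_ne_zero i)
    rw [dividedDifference_spec, map_mul, swapVars_dividedDifference, h1]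
    ring
  have hDC : dividedDifference i (C (1 - tpar) * (X i * dividedDifference i f)) =
      C (1 - tpar) * dividedDifference i f := by
    rw [← smul_eq_C_mul, map_smul, hDD, smul_eq_C_mul]
  have hTT : demazureLusztig i (demazureLusztig i f) = f +
      C (1 - tpar) * (X (i + 1) * dividedDifference i f) +
      C (1 - tpar) * (X i * (- dividedDifference i f + C (1 - tpar) * dividedDifference i f)) := by
    rw [hT (demazureLusztig i f), hT f, map_add, map_add, swapVars_swapVars, hDs, hDC, map_mul,
      map_mul, h1, swapVars_dividedDifference]
    simp [swapVars]
  simp only [Module.End.mul_apply, LinearMap.sub_apply, LinearMap.add_apply, LinearMap.smul_apply,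
    Module.End.one_apply, map_add, map_smul, LinearMap.zero_apply]
  rw [hTT, hT f]
  simp only [smul_eq_C_mul, map_sub, map_one]
  linear_combination (C tpar - 1) * dividedDifference_spec i f

theorem demazureLusztig_mul_inv (i : ℕ) : demazureLusztig i * demazureLusztigInv i = 1 := by
  have h := demazureLusztig_quadratic i
  have h2 : demazureLusztig i * (demazureLusztig i + (tpar - 1) • 1) = tpar • 1 := by
    refine LinearMap.ext fun f => ?_
    have hf := LinearMap.congr_fun h f
    simp only [Module.End.mul_apply, LinearMap.sub_apply, LinearMap.add_apply,
      LinearMap.smul_apply, Module.End.one_apply, map_add, map_smul, LinearMap.zero_apply] at hf ⊢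
    simp only [smul_eq_C_mul, map_sub, map_one] at hf ⊢
    linear_combination hf
  rw [demazureLusztigInv, mul_smul_comm, h2, smul_smul, inv_mul_cancel₀ tpar_ne_zero, one_smul]

theorem demazureLusztigInv_mul (i : ℕ) : demazureLusztigInv i * demazureLusztig i = 1 := by
  rw [← demazureLusztig_mul_inv i, demazureLusztigInv]
  simp [mul_add, add_mul]

/-! ### The deformed Cherednik operators and their limits -/

/-- The projection `pr_1 f = f - f|_{x_1 = 0}`. -/
def prOne : Module.End K Poly := 1 - (dropVar 1).toLinearMap

/-- `pr_1` is the identity on the monomials divisible by `x_1` and zero on the other ones. -/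
theorem prOne_monomial (e : ℕ →₀ ℕ) (c : K) :
    prOne (monomial e c) = if e 1 = 0 then 0 else monomial e c := by
  have h : dropVar 1 (monomial e c) = if e 1 = 0 then monomial e c else 0 := by
    unfold dropVar
    rw [aeval_monomial, Finsupp.prod]
    split_ifs with h1
    · rw [monomial_eq, Finsupp.prod, MvPolynomial.algebraMap_eq]
      congr 1
      refine Finset.prod_congr rfl fun j hj => ?_
      rw [if_neg]
      rintro rfl
      exact (Finsupp.mem_support_iff.1 hj) h1
    · rw [Finset.prod_eq_zero (Finsupp.mem_support_iff.2 h1), mul_zero]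
      simp [h1]
  simp only [prOne, LinearMap.sub_apply, Module.End.one_apply, AlgHom.toLinearMap_apply, h]
  split_ifs <;> simp

/-- The substitution `f(x_1, …, x_k) ↦ f(x_2, …, x_k, q x_1)`. -/
def omegaInv (k : ℕ) : Poly →ₐ[K] Poly :=
  aeval (fun j => if j < k then X (j + 1) else if j = k then C qpar * X 1 else X j)

/-- The operator `ϖ_k = pr_1 ω_k⁻¹`. -/
def varpi (k : ℕ) : Module.End K Poly := prOne * (omegaInv k).toLinearMap

/-- The deformed Cherednik operator
`t^{k+1-i} T_{i-1} ⋯ T_1 ϖ_k T_{k-1}⁻¹ ⋯ T_i⁻¹`, for `1 ≤ i ≤ k`. -/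
def deformedCherednik (i k : ℕ) : Module.End K Poly :=
  tpar ^ (k + 1 - i) •
    (((List.range' 1 (i - 1)).reverse.map demazureLusztig).prod * varpi k *
      ((List.range' i (k - i)).reverse.map demazureLusztigInv).prod)

open Classical in
/-- The limit Cherednik operator `f ↦ lim_k Ỹ_i^{(k)} Π_k f` on almost symmetric formal
polynomials (with value `0` where there is no such limit). -/
def limitCherednik (i : ℕ) (f : almostSym) : almostSym :=
  if h : ∃ F : almostSym,
      IsSeqLimit (fun k => deformedCherednik i k ((f : ℕ → Poly) k)) (F : ℕ → Poly)
  then h.choose else 0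

/-! ### The Bruhat order -/

/-- The reflection of `ℤ^k` attached to the affine root `n δ + ε_a - ε_b`,
that is `x ↦ x - (n + x_a - x_b) (ε_a - ε_b)`. -/
def affineReflection {k : ℕ} (a b : Fin k) (n : ℤ) : Equiv.Perm (Fin k → ℤ) :=
  Function.Involutive.toPerm
    (fun x => x - (n + x a - x b) • (Pi.single a 1 - Pi.single b 1)) (by
      intro x
      by_cases h : a = b
      · subst h; simp
      · funext j
        have h' : b ≠ a := fun e => h e.symm
        simp only [Pi.sub_apply, Pi.smul_apply, smul_eq_mul, Pi.single_eq_same,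
          Pi.single_eq_of_ne h, Pi.single_eq_of_ne h']
        ring)

/-- The triples `(a, b, n)` such that `n δ + ε_a - ε_b` is a simple affine root: the finite simple
roots `ε_i - ε_{i+1}`, and `α_0 = δ - ε_1 + ε_k`. -/
def IsSimpleRoot {k : ℕ} (a b : Fin k) (n : ℤ) : Prop :=
  (a.val + 1 = b.val ∧ n = 0) ∨ (a.val + 1 = k ∧ b.val = 0 ∧ n = 1)

/-- The simple reflections `s_0, …, s_{k-1}`. -/
def simpleReflections (k : ℕ) : Set (Equiv.Perm (Fin k → ℤ)) :=
  {s | ∃ a b n, IsSimpleRoot a b n ∧ s = affineReflection a b n}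

/-- The affine symmetric group, acting (faithfully) on `ℤ^k`. -/
def affineSymmetricGroup (k : ℕ) : Subgroup (Equiv.Perm (Fin k → ℤ)) :=
  Subgroup.closure (simpleReflections k)

/-- The length of an element of the affine symmetric group: the least number of factors in an
expression as a product of simple reflections. -/
def affineLength {k : ℕ} (w : Equiv.Perm (Fin k → ℤ)) : ℕ :=
  sInf {m | ∃ l : List (Equiv.Perm (Fin k → ℤ)),
    (∀ s ∈ l, s ∈ simpleReflections k) ∧ l.prod = w ∧ l.length = m}

/-- The generating relation of the Bruhat order on the affine symmetric group: `v = r u` with `r` a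
reflection (a conjugate of a simple reflection) and `ℓ(u) < ℓ(v)`. -/
def BruhatStep {k : ℕ} (u v : Equiv.Perm (Fin k → ℤ)) : Prop :=
  ∃ g ∈ affineSymmetricGroup k, ∃ s ∈ simpleReflections k,
    v = (g * s * g⁻¹) * u ∧ affineLength u < affineLength v

/-- The Bruhat order on the affine symmetric group. -/
def GroupBruhatLE {k : ℕ} (u v : Equiv.Perm (Fin k → ℤ)) : Prop :=
  u ∈ affineSymmetricGroup k ∧ v ∈ affineSymmetricGroup k ∧ Relation.ReflTransGen BruhatStep u v

/-- Minuscule weights: `⟨x, α_i⟩ ≥ 0` for `0 ≤ i ≤ k - 1`. -/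
def IsMinuscule {k : ℕ} (x : Fin k → ℤ) : Prop :=
  ∀ a b n, IsSimpleRoot a b n → 0 ≤ n + x a - x b

/-- `w` is an element of minimal length in the affine symmetric group such that `w x = y`. -/
def IsMinimalRep {k : ℕ} (x y : Fin k → ℤ) (w : Equiv.Perm (Fin k → ℤ)) : Prop :=
  w ∈ affineSymmetricGroup k ∧ w x = y ∧
    ∀ w' ∈ affineSymmetricGroup k, w' x = y → affineLength w ≤ affineLength w'

/-- The Bruhat order on `ℤ^k`: `x ≤ y` if `x` and `y` are in the same orbit of the affine symmetric
group and `w_x ≤ w_y`, where `w_x` and `w_y` are the minimal length elements that send the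
minuscule weight `z` of the orbit to `x` and to `y`. -/
def WeightBruhatLE {k : ℕ} (x y : Fin k → ℤ) : Prop :=
  ∃ z : Fin k → ℤ, IsMinuscule z ∧ ∃ u v : Equiv.Perm (Fin k → ℤ),
    IsMinimalRep z x u ∧ IsMinimalRep z y v ∧ GroupBruhatLE u v

/-- The composition `l`, extended by zeros, as an element of `ℤ^k`. -/
def toWeight (k : ℕ) (l : List ℕ) : Fin k → ℤ := fun j => (l.getD j 0 : ℤ)

/-- The Bruhat order on compositions, regarded as elements of the inductive limit of the
`ℤ_{≥0}^k` along extension by zero. -/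
def CompBruhatLE (l l' : List ℕ) : Prop :=
  ∃ k, l.length ≤ k ∧ l'.length ≤ k ∧ WeightBruhatLE (toWeight k l) (toWeight k l')

/-! ### Almost symmetric monomials -/

/-- The pairs `(λ | μ)` with `λ` a strict composition (its last part is non-zero) and `μ` a
partition. Both are allowed to be empty. -/
structure AsIndex where
  comp : List ℕ
  strict : ∀ h : comp ≠ [], comp.getLast h ≠ 0
  part : List ℕ
  sorted : part.Pairwise (fun a b => b ≤ a)
  pos : ∀ a ∈ part, 0 < a

/-- `(λ | μ) ⪯ (η | ν)`: `ℓ(λ) ≤ ℓ(η)` and `λ 0^{ℓ(η) - ℓ(λ)} μ ≤ η ν`. -/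
def AsIndex.Preceq (a b : AsIndex) : Prop :=
  a.comp.length ≤ b.comp.length ∧
    CompBruhatLE (a.comp ++ List.replicate (b.comp.length - a.comp.length) 0 ++ a.part)
      (b.comp ++ b.part)

/-- The strict order `≺`. -/
def AsIndex.Prec (a b : AsIndex) : Prop := a.Preceq b ∧ a ≠ b

/-- The list `μ` as a partition of the sum of its parts. -/
def AsIndex.toPartition (a : AsIndex) : Nat.Partition a.part.sum where
  parts := (a.part : Multiset ℕ)
  parts_pos := fun h => a.pos _ (by simpa using h)
  parts_sum := by simp

/-- The monomial symmetric polynomial `m_μ(x_{ℓ+1}, …, x_k)`. -/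
def symMonomial (a : AsIndex) (l k : ℕ) : Poly :=
  rename (fun j : Fin (k - l) => l + j.val + 1) (msymm (Fin (k - l)) K a.toPartition)

/-- The monomial `x^λ`. -/
def compMonomial (l : List ℕ) : Poly := ∏ j : Fin l.length, X (j.val + 1) ^ l.get j

/-- The sequence of the images of `x^λ m_μ[x_{ℓ(λ)+1} + x_{ℓ(λ)+2} + ⋯]` in the polynomial rings
`ℚ(t, q)[x_1, …, x_k]`. The image is `0` if `k < ℓ(λ)`, since then `x^λ ↦ 0`. -/
def asMonomialSeq (a : AsIndex) (k : ℕ) : Poly :=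
  if a.comp.length ≤ k then compMonomial a.comp * symMonomial a a.comp.length k else 0

theorem dropVar_of_mem {k j : ℕ} {p : Poly} (hp : p ∈ finPoly k) (hj : k < j) :
    dropVar j p = p := by
  have h : finPoly k ≤ AlgHom.equalizer (dropVar j) (AlgHom.id K Poly) := by
    refine Algebra.adjoin_le ?_
    rintro _ ⟨n, hn, rfl⟩
    have : n ≠ j := by have := hn.2; omega
    simp [dropVar, this]
  exact h hp

theorem compMonomial_mem {l : List ℕ} {k : ℕ} (h : l.length ≤ k) :
    compMonomial l ∈ finPoly k := by
  refine prod_mem fun j _ => pow_mem ?_ _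
  exact X_mem_supported.2 (Set.mem_Icc.2 ⟨by omega, by have := j.2; omega⟩)

theorem symMonomial_eq_sum (a : AsIndex) (l k : ℕ) :
    symMonomial a l k = ∑ s : {s : Sym (Fin (k - l)) a.part.sum // .ofSym s = a.toPartition},
      (s.1.1.map (fun j => (X (l + j.val + 1) : Poly))).prod := by
  rw [symMonomial, msymm, map_sum]
  refine Finset.sum_congr rfl fun s _ => ?_
  rw [map_multiset_prod, Multiset.map_map]
  simp [Function.comp_def]

theorem symMonomial_mem (a : AsIndex) (l k : ℕ) : symMonomial a l k ∈ finPoly k := by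
  rw [symMonomial_eq_sum]
  refine sum_mem fun s _ => multiset_prod_mem _ ?_
  intro p hp
  obtain ⟨j, _, rfl⟩ := Multiset.mem_map.1 hp
  exact X_mem_supported.2 ⟨by omega, by have := j.2; omega⟩

theorem dropVar_symMonomial (a : AsIndex) {l k : ℕ} (h : l ≤ k) :
    dropVar (k + 1) (symMonomial a l (k + 1)) = symMonomial a l k := by
  obtain ⟨n, rfl⟩ := Nat.exists_eq_add_of_le h
  have e1 : l + n + 1 - l = n + 1 := by omega
  have e2 : l + n - l = n := by omega
  rw [symMonomial_eq_sum, symMonomial_eq_sum, e1, e2, map_sum]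
  have hinj : Function.Injective (Fin.castSucc : Fin n → Fin (n + 1)) := Fin.castSucc_injective n
  have hof : ∀ s : Sym (Fin n) a.part.sum,
      Nat.Partition.ofSym (s.map Fin.castSucc) = Nat.Partition.ofSym s := by
    intro s
    simp only [Nat.Partition.ofSym, Sym.val_eq_coe, Sym.coe_map, Nat.Partition.mk.injEq]
    rw [Multiset.dedup_map_of_injective hinj]
    simp only [Multiset.map_map, Function.comp_apply]
    congr; funext i
    rw [← Multiset.count_map_eq_count' Fin.castSucc _ hinj]
  symm
  refine Fintype.sum_of_injective
    (fun s : {s : Sym (Fin n) a.part.sum // Nat.Partition.ofSym s = a.toPartition} =>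
      (⟨s.1.map Fin.castSucc, (hof s.1).trans s.2⟩ :
        {s : Sym (Fin (n + 1)) a.part.sum // Nat.Partition.ofSym s = a.toPartition}))
    ?_ _ _ ?_ ?_
  · intro s s' hs
    exact Subtype.ext (Sym.map_injective hinj _ (congrArg Subtype.val hs))
  · intro s hs
    have hlast : Fin.last n ∈ s.1.1 := by
      by_contra hl
      apply hs
      have hex : ∀ m : Multiset (Fin (n + 1)), Fin.last n ∉ m →
          ∃ m' : Multiset (Fin n), m'.map Fin.castSucc = m := by
        intro m
        induction m using Multiset.induction with
        | empty => exact fun _ => ⟨0, rfl⟩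
        | cons x m ih =>
          intro hx
          rw [Multiset.mem_cons, not_or] at hx
          obtain ⟨m', rfl⟩ := ih hx.2
          obtain ⟨y, rfl⟩ := Fin.exists_castSucc_eq.2 (fun e => hx.1 e.symm)
          exact ⟨y ::ₘ m', by simp⟩
      obtain ⟨m', hm'⟩ := hex _ hl
      have hc : Multiset.card m' = a.part.sum := by
        have := congrArg Multiset.card hm'
        rw [Multiset.card_map] at this
        exact this.trans s.1.2
      obtain ⟨u, hu⟩ : ∃ u : Sym (Fin n) a.part.sum, u.map Fin.castSucc = s.1 :=
        ⟨⟨m', hc⟩, Subtype.ext hm'⟩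
      exact ⟨⟨u, by rw [← hof, hu]; exact s.2⟩, Subtype.ext hu⟩
    rw [map_multiset_prod, Multiset.map_map]
    refine Multiset.prod_eq_zero (Multiset.mem_map.2 ⟨_, hlast, ?_⟩)
    simp [dropVar]
  · intro s
    rw [map_multiset_prod]
    simp only [Sym.val_eq_coe, Sym.coe_map, Multiset.map_map, Function.comp_def]
    congr 1
    refine Multiset.map_congr rfl fun j _ => ?_
    have : j.val ≠ n := by have := j.2; omega
    simp [dropVar, this]

theorem dropVar_compMonomial {l : List ℕ} (h : ∀ hl : l ≠ [], l.getLast hl ≠ 0) {k : ℕ}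
    (hk : l.length = k + 1) : dropVar (k + 1) (compMonomial l) = 0 := by
  have hl : l ≠ [] := by rintro rfl; simp at hk
  rw [compMonomial, map_prod]
  refine Finset.prod_eq_zero (i := ⟨k, by omega⟩) (Finset.mem_univ _) ?_
  have h' := h hl
  rw [List.getLast_eq_getElem] at h'
  simp only [hk, Nat.add_sub_cancel] at h'
  simp [dropVar, h']

theorem swapVars_compMonomial {l : List ℕ} {i : ℕ} (h : l.length < i) :
    swapVars i (compMonomial l) = compMonomial l := by
  rw [compMonomial, map_prod]
  refine Finset.prod_congr rfl fun j _ => ?_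
  have h1 : j.val + 1 ≠ i := by omega
  have h2 : j.val + 1 ≠ i + 1 := by omega
  rw [map_pow, swapVars, rename_X, Equiv.swap_apply_of_ne_of_ne h1 h2]

theorem swapVars_symMonomial (a : AsIndex) {l i k : ℕ} (h : l < i) (hk : i + 1 ≤ k) :
    swapVars i (symMonomial a l k) = symMonomial a l k := by
  have ha : i - l - 1 < k - l := by omega
  have hb : i - l < k - l := by omega
  rw [symMonomial, swapVars, rename_rename]
  conv_rhs => rw [← msymm_isSymmetric _ _ a.toPartition (Equiv.swap ⟨i - l - 1, ha⟩ ⟨i - l, hb⟩),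
    rename_rename]
  congr 2
  funext j
  simp only [Function.comp_apply, Equiv.swap_apply_def, Fin.ext_iff]
  split_ifs <;> (try dsimp only at *) <;> omega

theorem totalDegree_symMonomial_le (a : AsIndex) (l k : ℕ) :
    (symMonomial a l k).totalDegree ≤ a.part.sum := by
  rw [symMonomial_eq_sum]
  refine totalDegree_finsetSum_le fun s _ => ?_
  refine (totalDegree_multiset_prod _).trans ?_
  rw [Multiset.map_map]
  simp only [Function.comp_def, totalDegree_X, Multiset.map_const', Multiset.sum_replicate,
    smul_eq_mul, mul_one]
  exact s.1.2.le

theorem asMonomialSeq_mem (a : AsIndex) : asMonomialSeq a ∈ almostSym := by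
  refine ⟨⟨fun k => ?_, fun k => ?_, (compMonomial a.comp).totalDegree + a.part.sum, fun k => ?_⟩,
    a.comp.length, fun i hi n hn => ?_⟩
  · unfold asMonomialSeq
    split_ifs with h
    · exact mul_mem (compMonomial_mem h) (symMonomial_mem a _ k)
    · exact zero_mem _
  · unfold asMonomialSeq
    by_cases h : a.comp.length ≤ k
    · rw [if_pos h, if_pos (by omega), map_mul, dropVar_symMonomial a h,
        dropVar_of_mem (compMonomial_mem h) (by omega)]
    · by_cases h1 : a.comp.length = k + 1
      · rw [if_neg h, if_pos h1.le, map_mul, dropVar_compMonomial a.strict h1, zero_mul]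
      · rw [if_neg h, if_neg (by omega), map_zero]
  · unfold asMonomialSeq
    split_ifs with h
    · exact (totalDegree_mul _ _).trans
        (add_le_add le_rfl (totalDegree_symMonomial_le a _ k))
    · simp
  · unfold asMonomialSeq
    rw [if_pos (by omega), map_mul, swapVars_compMonomial hi, swapVars_symMonomial a hi hn]

/-- The almost symmetric monomial `m_{λ|μ}`. -/
def asMonomial (a : AsIndex) : almostSym := ⟨asMonomialSeq a, asMonomialSeq_mem a⟩

/-! ### The eigenvalues -/

/-- The entry `l_j`, `j ≥ 1`, of a composition extended by zeros. -/
def entry (l : List ℕ) (j : ℕ) : ℕ := l.getD (j - 1) 0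

/-- `sgn_i(λ)` is `1` if `λ_i > 0` and `0` if `λ_i = 0` or `i > ℓ(λ)`. -/
def sgn (i : ℕ) (l : List ℕ) : K := if 0 < entry l i then 1 else 0

/-- `u_λ(i) = #{1 ≤ j ≤ i : λ_j > λ_i} + #{i ≤ j ≤ ℓ(λ) : λ_j ≥ λ_i}`. -/
def uStat (l : List ℕ) (i : ℕ) : ℕ :=
  ((Finset.Icc 1 i).filter fun j => entry l i < entry l j).card +
    ((Finset.Icc i l.length).filter fun j => entry l i ≤ entry l j).card

end StableLimitDAHA

end

/-!
The operators `Ỹ_i^{(k)}` are shown to be triangular at each finite level `k`, their images of an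
almost symmetric `f` are shown to have the form `h_k + t^k g_k` with `h` and `g` almost symmetric,
and the two facts are combined by comparing coefficients for large `k`.

*Triangularity.* Write `x^e` for monomials. Conjugated by the permutations of the variables that
follow `x_i` along the factors of `Ỹ_i^{(k)}`, each `T_j` or `T_j⁻¹` becomes an operator in two
variables `x_a`, `x_b` that is triangular on monomials (`isTriangular_swap_mul`,
`isTriangular_swap_mul_inv`): besides `x^e`, it produces the exponents in which `e_a` and `e_b`
move towards each other, or are exchanged if the larger of them comes first afterwards. The
operator `ϖ_k` becomes diagonal. Hence `isTriangular_deformedCherednik`. Each such move is a step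
`x → s_β x` down the order `WeightLE` on weights that is generated by affine reflections
(`transGen_lowStep`).

*Bruhat order.* The order `WeightLE` is contained in the Bruhat order defined through minimal
length representatives (`WeightLE.weightBruhatLE`). This rests on the strong exchange property
(`strong_exchange`), proved on words in the simple reflections by following the affine root, and on
the lifting property (`lifting`, and `WeightLE.le_simple` for weights). The latter also allows the
entries beyond `ℓ(λ)` to be sorted in an upper bound (`WeightLE.trans_sortSteps`).

*Convergence.* It suffices to treat `L_k = t^{k+1-m} ϖ_k T_{k-1}⁻¹ ⋯ T_m⁻¹` on elements symmetric
in `x_{m+1}, x_{m+2}, …`. These are generated by the products `x_m^a S` with `S` symmetric in `x_m,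
x_{m+1}, …` (`orbitSum_mem_convergentFrom`). The factor `S` commutes with the `T_j`, and the image
of `x_m^a` is a coefficient of the product of the series `(1 - t x_j u) / (1 - x_j u)` with `x_k u
/ (1 - x_k u)`, if `a > 0` (`prod_inv_X_pow`); the powers of `t` cancel, and the result is stable.
For `a = 0` a factor `t^k` remains. If `f` is symmetric in `x_i, x_{i+1}, …`, only the case `a = 0`
occurs and the limit is `0`.

*Conclusion.* Let `m = ℓ(λ) ≥ i`. The limit minus its leading term is a combination of orbit sums
of exponents `e` sorted beyond `m`, each of which occurs at arbitrarily large levels `k` in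
`Ỹ_i^{(k)} f_k - κ f_k`, and so is below `λ μ`. Such an orbit sum is a combination of `m_{λ'|μ'}`
with `λ' 0⋯0 μ'` below `e` (`orbitSum_mem_span`): if `e_m = 0`, compare the sums over permutations
of the entries beyond `m` and beyond `m - 1`. Strictness is recorded by `HeadBelow`, a numerical
order on exponents that all these comparisons respect.
-/

namespace StableLimitDAHA

/-! ### Affine roots and the strong exchange property -/

section Bruhat

variable {k : ℕ}

/-- The affine root `n δ + ε_a - ε_b`, as a function on `ℤ^k`. -/
def affineRoot (a b : Fin k) (n : ℤ) (x : Fin k → ℤ) : ℤ := n + x a - x b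

/-- The triples `(a, b, n)` such that `n δ + ε_a - ε_b` is a positive affine root. -/
def IsPosTriple (a b : Fin k) (n : ℤ) : Prop := a ≠ b ∧ (0 < n ∨ n = 0 ∧ a < b)

/-- The positive affine roots, as functions on `ℤ^k`. -/
def IsPosRoot (f : (Fin k → ℤ) → ℤ) : Prop := ∃ a b n, IsPosTriple a b n ∧ f = affineRoot a b n

theorem affineReflection_apply {a b : Fin k} (h : a ≠ b) (n : ℤ) (x : Fin k → ℤ) (j : Fin k) :
    affineReflection a b n x j = if j = a then x b - n else if j = b then x a + n else x j := by
  have e : affineReflection a b n x j =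
      x j - (n + x a - x b) * ((Pi.single a 1 : Fin k → ℤ) j - (Pi.single b 1 : Fin k → ℤ) j) := rfl
  rw [e, Pi.single_apply, Pi.single_apply]
  split_ifs with h1 h2 h2
  · exact absurd (h1.symm.trans h2) h
  · subst h1; ring
  · subst h2; ring
  · ring

theorem affineReflection_self (a : Fin k) (n : ℤ) : affineReflection a a n = 1 := by
  ext x j
  change x j - (n + x a - x a) * ((Pi.single a 1 : Fin k → ℤ) j - (Pi.single a 1 : Fin k → ℤ) j) = _
  simp

theorem affineReflection_mul_self (a b : Fin k) (n : ℤ) :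
    affineReflection a b n * affineReflection a b n = 1 := by
  ext x : 1
  exact Function.Involutive.toPerm_involutive _ x

theorem affineReflection_inv (a b : Fin k) (n : ℤ) :
    (affineReflection a b n)⁻¹ = affineReflection a b n :=
  inv_eq_of_mul_eq_one_left (affineReflection_mul_self a b n)

theorem affineReflection_affineReflection (a b : Fin k) (n : ℤ) (x : Fin k → ℤ) :
    affineReflection a b n (affineReflection a b n x) = x :=
  Equiv.congr_fun (affineReflection_mul_self a b n) x

theorem affineRoot_affineReflection_self {a b : Fin k} (h : a ≠ b) (n : ℤ) (x : Fin k → ℤ) :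
    affineRoot a b n (affineReflection a b n x) = -affineRoot a b n x := by
  simp only [affineRoot, affineReflection_apply h, if_true, if_neg h.symm]
  ring

theorem affineReflection_eq_self {a b : Fin k} {n : ℤ} {x : Fin k → ℤ}
    (h : affineRoot a b n x = 0) : affineReflection a b n x = x := by
  change x - affineRoot a b n x • _ = x
  rw [h]; simp

theorem IsSimpleRoot.isPosTriple {a b : Fin k} {n : ℤ} (h : IsSimpleRoot a b n) (hab : a ≠ b) :
    IsPosTriple a b n := by
  refine ⟨hab, ?_⟩
  rcases h with ⟨h, rfl⟩ | ⟨_, _, rfl⟩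
  · exact Or.inr ⟨rfl, by rw [Fin.lt_def]; omega⟩
  · exact Or.inl one_pos

/-- A simple reflection permutes the positive roots other than its own root. Besides the root
`a' b' n'` obtained from `a b n`, the corresponding reflections are conjugate. -/
theorem exists_root_comp_simple {c d : Fin k} {m : ℤ} (hs : IsSimpleRoot c d m) (hcd : c ≠ d)
    {a b : Fin k} {n : ℤ} (hp : IsPosTriple a b n) :
    (a = c ∧ b = d ∧ n = m) ∨ ∃ a' b' n', IsPosTriple a' b' n' ∧
      affineRoot a b n ∘ affineReflection c d m = affineRoot a' b' n' ∧
      affineReflection a b n =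
        affineReflection c d m * affineReflection a' b' n' * affineReflection c d m := by
  rw [or_iff_not_imp_left]
  intro hne
  let σ : Fin k → Fin k := fun j => if j = c then d else if j = d then c else j
  let sh : Fin k → ℤ := fun j => if j = c then -m else if j = d then m else 0
  have hsx : ∀ x j, affineReflection c d m x j = x (σ j) + sh j := by
    intro x j
    rw [affineReflection_apply hcd]
    simp only [σ, sh]
    split_ifs <;> ring
  have hab := hp.1
  have hσσ : ∀ j, σ (σ j) = j := by
    intro j
    simp only [σ]
    split_ifs <;> simp_all
  have hσ : σ a ≠ σ b := fun h => hab (by rw [← hσσ a, h, hσσ])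
  have hcd' : c.val ≠ d.val := fun h => hcd (Fin.ext h)
  have hab' : a.val ≠ b.val := fun h => hab (Fin.ext h)
  refine ⟨σ a, σ b, n + sh a - sh b, ⟨hσ, ?_⟩, ?_, ?_⟩
  · have hp2 := hp.2
    have ha := a.2
    have hb := b.2
    unfold IsSimpleRoot at hs
    simp only [σ, sh, Fin.lt_def, Fin.ext_iff] at hne hp2 ⊢
    split_ifs <;> omega
  · funext x
    simp only [Function.comp_apply, affineRoot, hsx]
    ring
  · ext x j
    simp only [Equiv.Perm.mul_apply]
    rw [affineReflection_apply hab, hsx, affineReflection_apply hσ, hsx, hsx, hsx]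
    have hsh : ∀ j, sh (σ j) + sh j = 0 := by
      intro j
      simp only [σ, sh]
      split_ifs <;> simp_all
    have hinj : ∀ i j, σ i = σ j ↔ i = j := fun i j =>
      ⟨fun h => by rw [← hσσ i, h, hσσ], fun h => by rw [h]⟩
    simp only [hinj, hσσ]
    have e1 := hsh a
    have e2 := hsh b
    have e3 := hsh j
    split_ifs with h1 h2
    · subst h1; linarith
    · subst h2; linarith
    · linarith

theorem IsPosRoot.not_neg {f g : (Fin k → ℤ) → ℤ} (hf : IsPosRoot f) (hg : ∀ x, g x = -f x) :
    ¬ IsPosRoot g := by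
  rintro ⟨a', b', n', hp', rfl⟩
  obtain ⟨a, b, n, hp, rfl⟩ := hf
  have hp2 := hp.2
  have hp2' := hp'.2
  have h0 := hg 0
  simp only [affineRoot, Pi.zero_apply] at h0
  have hn : n = 0 ∧ n' = 0 := by omega
  obtain ⟨rfl, rfl⟩ := hn
  have h1 := hg (Pi.single a 1)
  have hlt : a < b := by simpa using hp2
  have hlt' : a' < b' := by simpa using hp2'
  have hab := hp.1
  have hab' := hp'.1
  simp only [affineRoot, Pi.single_apply, hab.symm, if_true, if_false] at h1
  have h2 := hg (Pi.single b 1)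
  simp only [affineRoot, Pi.single_apply, hab, if_true, if_false] at h2
  have e1 : b' = a := by
    by_contra h
    rw [if_neg h] at h1
    split_ifs at h1 <;> omega
  have e2 : a' = b := by
    by_contra h
    rw [if_neg h] at h2
    split_ifs at h2 <;> omega
  subst e1 e2
  exact absurd hlt (not_lt.2 hlt'.le)

/-- The strong exchange property: if a word in the simple reflections sends a positive root to a
root that is not positive, then multiplication by the reflection in this root deletes one of
its letters. -/
theorem strong_exchange (l : List (Equiv.Perm (Fin k → ℤ))) :
    (∀ s ∈ l, s ∈ simpleReflections k) → ∀ {a b : Fin k} {n : ℤ}, IsPosTriple a b n →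
    ¬ IsPosRoot (affineRoot a b n ∘ l.prod) →
    (∃ l' : List (Equiv.Perm (Fin k → ℤ)), (∀ s ∈ l', s ∈ simpleReflections k) ∧
      l'.length + 1 = l.length ∧ l'.prod = affineReflection a b n * l.prod) ∧
    ∃ g ∈ affineSymmetricGroup k, ∃ s ∈ simpleReflections k,
      affineReflection a b n = g * s * g⁻¹ := by
  induction l with
  | nil =>
    intro _ a b n hp hn
    exact absurd ⟨a, b, n, hp, by simp⟩ hn
  | cons s l ih =>
    intro hl a b n hp hn
    have hs := hl s (by simp)
    have hl' : ∀ s ∈ l, s ∈ simpleReflections k := fun s h => hl s (by simp [h])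
    obtain ⟨c, d, m, hcdm, rfl⟩ := hs
    by_cases hcd : c = d
    · subst hcd
      have hn' : ¬ IsPosRoot (affineRoot a b n ∘ l.prod) := by
        simpa [affineReflection_self] using hn
      obtain ⟨⟨l', h1, h2, h3⟩, h4⟩ := ih hl' hp hn'
      refine ⟨⟨affineReflection c c m :: l', ?_, by simp [h2], ?_⟩, h4⟩
      · intro s hs
        rcases List.mem_cons.1 hs with rfl | hs
        · exact ⟨c, c, m, hcdm, rfl⟩
        · exact h1 s hs
      · simp [affineReflection_self, h3]
    · rcases exists_root_comp_simple hcdm hcd hp with ⟨rfl, rfl, rfl⟩ | ⟨a', b', n', hp', h1, h2⟩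
      · refine ⟨⟨l, hl', by simp, ?_⟩, 1, one_mem _, _, ⟨a, b, n, hcdm, rfl⟩, by simp⟩
        rw [List.prod_cons, ← mul_assoc, affineReflection_mul_self, one_mul]
      · have hn' : ¬ IsPosRoot (affineRoot a' b' n' ∘ l.prod) := by
          rw [← h1, Function.comp_assoc]
          simpa using hn
        obtain ⟨⟨l', h3, h4, h5⟩, g, hg, s, hs, h6⟩ := ih hl' hp' hn'
        refine ⟨⟨affineReflection c d m :: l', ?_, by simp [h4], ?_⟩,
          affineReflection c d m * g, mul_mem (Subgroup.subset_closure ⟨c, d, m, hcdm, rfl⟩) hg,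
          s, hs, ?_⟩
        · intro s hs
          rcases List.mem_cons.1 hs with rfl | hs
          · exact ⟨c, d, m, hcdm, rfl⟩
          · exact h3 s hs
        · rw [List.prod_cons, List.prod_cons, h5, h2]
          simp only [mul_assoc]
          rw [← mul_assoc (affineReflection c d m) (affineReflection c d m),
            affineReflection_mul_self, one_mul]
        · rw [h2, h6, mul_inv_rev, affineReflection_inv]
          simp only [mul_assoc]

theorem mem_affineSymmetricGroup_iff {w : Equiv.Perm (Fin k → ℤ)} :
    w ∈ affineSymmetricGroup k ↔
      ∃ l : List (Equiv.Perm (Fin k → ℤ)), (∀ s ∈ l, s ∈ simpleReflections k) ∧ l.prod = w := by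
  constructor
  · intro h
    induction h using Subgroup.closure_induction with
    | mem x hx => exact ⟨[x], by simpa using hx, by simp⟩
    | one => exact ⟨[], by simp, rfl⟩
    | mul x y _ _ hx hy =>
      obtain ⟨l, hl, rfl⟩ := hx
      obtain ⟨l', hl', rfl⟩ := hy
      refine ⟨l ++ l', fun s hs => ?_, by simp⟩
      rcases List.mem_append.1 hs with h | h
      exacts [hl s h, hl' s h]
    | inv x _ hx =>
      obtain ⟨l, hl, rfl⟩ := hx
      refine ⟨l.reverse, fun s hs => hl s (List.mem_reverse.1 hs), ?_⟩
      rw [List.prod_inv_reverse]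
      have h : l.map (fun s => s⁻¹) = l := by
        conv_rhs => rw [← List.map_id l]
        refine List.map_congr_left fun s hs => ?_
        obtain ⟨a, b, n, _, rfl⟩ := hl s hs
        exact affineReflection_inv a b n
      rw [h]
  · rintro ⟨l, hl, rfl⟩
    exact list_prod_mem fun s hs => Subgroup.subset_closure (hl s hs)

theorem affineLength_le {l : List (Equiv.Perm (Fin k → ℤ))}
    (hl : ∀ s ∈ l, s ∈ simpleReflections k) : affineLength l.prod ≤ l.length :=
  Nat.sInf_le ⟨l, hl, rfl, rfl⟩

theorem exists_reduced_word {w : Equiv.Perm (Fin k → ℤ)} (hw : w ∈ affineSymmetricGroup k) :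
    ∃ l : List (Equiv.Perm (Fin k → ℤ)), (∀ s ∈ l, s ∈ simpleReflections k) ∧ l.prod = w ∧
      l.length = affineLength w := by
  obtain ⟨l, hl, h⟩ := mem_affineSymmetricGroup_iff.1 hw
  exact Nat.sInf_mem (s := {m | ∃ l : List (Equiv.Perm (Fin k → ℤ)),
    (∀ s ∈ l, s ∈ simpleReflections k) ∧ l.prod = w ∧ l.length = m}) ⟨_, l, hl, h, rfl⟩

theorem affineLength_reflection_mul_lt {w : Equiv.Perm (Fin k → ℤ)}
    (hw : w ∈ affineSymmetricGroup k) {a b : Fin k} {n : ℤ} (hp : IsPosTriple a b n)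
    (h : ¬ IsPosRoot (affineRoot a b n ∘ w)) :
    affineLength (affineReflection a b n * w) < affineLength w := by
  obtain ⟨l, hl, rfl, hlen⟩ := exists_reduced_word hw
  obtain ⟨⟨l', h1, h2, h3⟩, -⟩ := strong_exchange l hl hp h
  have := affineLength_le h1
  rw [h3] at this
  omega

theorem affineLength_simple_mul_le {w : Equiv.Perm (Fin k → ℤ)}
    (hw : w ∈ affineSymmetricGroup k) {s : Equiv.Perm (Fin k → ℤ)} (hs : s ∈ simpleReflections k) :
    affineLength (s * w) ≤ affineLength w + 1 := by
  obtain ⟨l, hl, rfl, hlen⟩ := exists_reduced_word hw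
  have := affineLength_le (l := s :: l) (by
    intro r hr
    rcases List.mem_cons.1 hr with rfl | hr
    exacts [hs, hl r hr])
  simp only [List.prod_cons, List.length_cons] at this
  omega

theorem IsPosRoot.nonneg_of_minuscule {z : Fin k → ℤ} (hz : IsMinuscule z)
    {f : (Fin k → ℤ) → ℤ} (hf : IsPosRoot f) : 0 ≤ f z := by
  obtain ⟨a, b, n, hp, rfl⟩ := hf
  have hle : ∀ (j : ℕ) (a : Fin k) (h : a.val + j < k), z ⟨a.val + j, h⟩ ≤ z a := by
    intro j
    induction j with
    | zero => intro a h; simp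
    | succ j ih =>
      intro a h
      refine le_trans ?_ (ih a (by omega))
      have := hz ⟨a.val + j, by omega⟩ ⟨a.val + (j + 1), h⟩ 0 (Or.inl ⟨rfl, rfl⟩)
      omega
  have hle' : ∀ a b : Fin k, a ≤ b → z b ≤ z a := by
    intro a b hab
    have := hle (b.val - a.val) a (by have := b.2; have := Fin.le_def.1 hab; omega)
    have e : (⟨a.val + (b.val - a.val), by have := b.2; have := Fin.le_def.1 hab; omega⟩ : Fin k)
      = b := Fin.ext (by have := Fin.le_def.1 hab; simp; omega)
    rwa [e] at this
  have hk : 0 < k := lt_of_le_of_lt (Nat.zero_le _) a.2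
  have hlast := hz ⟨k - 1, by omega⟩ ⟨0, hk⟩ 1 (Or.inr ⟨by simp; omega, rfl, rfl⟩)
  have h1 := hle' ⟨0, hk⟩ b (Fin.le_def.2 (Nat.zero_le _))
  have h2 := hle' a ⟨k - 1, by omega⟩ (Fin.le_def.2 (by have := a.2; simp; omega))
  rcases hp.2 with h | ⟨rfl, h⟩
  · simp only [affineRoot]; omega
  · have := hle' a b h.le
    simp only [affineRoot]; omega

/-- Every weight is in the orbit of a minuscule weight: reflecting in a simple root that is negative
at the weight brings it closer to an interior point of the fundamental alcove. -/
theorem exists_minuscule (y : Fin k → ℤ) :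
    ∃ z, IsMinuscule z ∧ ∃ w ∈ affineSymmetricGroup k, w z = y := by
  let Φ : (Fin k → ℤ) → ℤ := fun y => ∑ j : Fin k, (((k : ℤ) + 1) * y j + j.val) ^ 2
  have hΦ : ∀ y, 0 ≤ Φ y := fun y => Finset.sum_nonneg fun j _ => sq_nonneg _
  generalize hN : (Φ y).toNat = N
  induction N using Nat.strong_induction_on generalizing y with
  | _ N ih =>
    by_cases hy : IsMinuscule y
    · exact ⟨y, hy, 1, one_mem _, rfl⟩
    · simp only [IsMinuscule, not_forall, not_le] at hy
      obtain ⟨a, b, n, hs, hneg⟩ := hy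
      have hab : a ≠ b := by
        rintro rfl
        rcases hs with ⟨h, -⟩ | ⟨-, -, rfl⟩ <;> omega
      have hlt : Φ (affineReflection a b n y) < Φ y := by
        -- only the two terms at `a` and `b` change
        have hsplit : ∀ g : Fin k → ℤ, ∑ j, g j =
            g a + g b + ∑ j ∈ (Finset.univ.erase a).erase b, g j := by
          intro g
          rw [← Finset.add_sum_erase _ _ (Finset.mem_univ a),
            ← Finset.add_sum_erase (Finset.univ.erase a) g (a := b) (by simp [hab.symm]), add_assoc]
        simp only [Φ]
        rw [hsplit, hsplit]
        refine add_lt_add_of_lt_of_le ?_ (le_of_eq ?_)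
        · rw [affineReflection_apply hab, affineReflection_apply hab, if_pos rfl, if_neg hab.symm,
            if_pos rfl]
          rcases hs with ⟨h, rfl⟩ | ⟨h, h', rfl⟩
          · have : (b.val : ℤ) = a.val + 1 := by exact_mod_cast h.symm
            rw [this]
            have hk : (0 : ℤ) ≤ k := by positivity
            nlinarith
          · have : (k : ℤ) = a.val + 1 := by exact_mod_cast h.symm
            rw [h', this]
            have hk : (0 : ℤ) ≤ a.val := by positivity
            have : y b - y a ≥ 2 := by omega
            push_cast
            nlinarith
        · refine Finset.sum_congr rfl fun j hj => ?_
          simp only [Finset.mem_erase] at hj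
          rw [affineReflection_apply hab, if_neg hj.2.1, if_neg hj.1]
      obtain ⟨z, hz, w, hw, h⟩ := ih _ (by
        rw [← hN]
        exact (Int.toNat_lt_toNat (lt_of_le_of_lt (hΦ _) hlt)).2 hlt) (affineReflection a b n y) rfl
      refine ⟨z, hz, affineReflection a b n * w,
        mul_mem (Subgroup.subset_closure ⟨a, b, n, hs, rfl⟩) hw, ?_⟩
      rw [Equiv.Perm.mul_apply, h, affineReflection_affineReflection]

theorem affineReflection_conj {a b : Fin k} {n : ℤ} (hp : IsPosTriple a b n) :
    ∃ g ∈ affineSymmetricGroup k, ∃ s ∈ simpleReflections k,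
      affineReflection a b n = g * s * g⁻¹ := by
  -- the root is negative at `(n + 1) ε_b`, hence not positive after composition with `w`
  obtain ⟨z, hz, w, hw, hwz⟩ := exists_minuscule (Pi.single b (n + 1) : Fin k → ℤ)
  obtain ⟨l, hl, rfl⟩ := mem_affineSymmetricGroup_iff.1 hw
  refine (strong_exchange l hl hp fun h => ?_).2
  have := h.nonneg_of_minuscule hz
  simp only [Function.comp_apply, hwz, affineRoot, Pi.single_eq_same,
    Pi.single_eq_of_ne hp.1] at this
  omega

theorem affineReflection_mem {a b : Fin k} {n : ℤ} (hp : IsPosTriple a b n) :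
    affineReflection a b n ∈ affineSymmetricGroup k := by
  obtain ⟨g, hg, s, hs, h⟩ := affineReflection_conj hp
  rw [h]
  exact mul_mem (mul_mem hg (Subgroup.subset_closure hs)) (inv_mem hg)

/-! ### The Bruhat order on weights -/

/-- The step `u → s_β u` for a positive root `β` that stays positive along `u`. -/
def RootStep (u v : Equiv.Perm (Fin k → ℤ)) : Prop :=
  ∃ a b n, IsPosTriple a b n ∧ IsPosRoot (affineRoot a b n ∘ u) ∧ v = affineReflection a b n * u

theorem RootStep.bruhatStep {u v : Equiv.Perm (Fin k → ℤ)} (h : RootStep u v)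
    (hu : u ∈ affineSymmetricGroup k) : v ∈ affineSymmetricGroup k ∧ BruhatStep u v := by
  obtain ⟨a, b, n, hp, hpos, rfl⟩ := h
  have hv := mul_mem (affineReflection_mem hp) hu
  obtain ⟨g, hg, s, hs, he⟩ := affineReflection_conj hp
  refine ⟨hv, g, hg, s, hs, by rw [he], ?_⟩
  have := affineLength_reflection_mul_lt hv hp (hpos.not_neg fun x => by
    simp only [Function.comp_apply, Equiv.Perm.mul_apply]
    exact affineRoot_affineReflection_self hp.1 n _)
  rwa [← mul_assoc, affineReflection_mul_self, one_mul] at this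

/-- The lifting property of the Bruhat order. -/
theorem lifting {c d : Fin k} {m : ℤ} (hs : IsSimpleRoot c d m) (hcd : c ≠ d)
    {u v : Equiv.Perm (Fin k → ℤ)} (h : Relation.ReflTransGen RootStep u v) :
    Relation.ReflTransGen RootStep (affineReflection c d m * u) v ∨
      Relation.ReflTransGen RootStep (affineReflection c d m * u) (affineReflection c d m * v) := by
  induction h with
  | refl => exact Or.inr .refl
  | tail _ hstep ih =>
    rcases ih with ih | ih
    · exact Or.inl (ih.tail hstep)
    · obtain ⟨a, b, n, hp, hpos, rfl⟩ := hstep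
      rcases exists_root_comp_simple hs hcd hp with ⟨rfl, rfl, rfl⟩ | ⟨a', b', n', hp', h1, h2⟩
      · exact Or.inl ih
      · refine Or.inr (ih.tail ⟨a', b', n', hp', ?_, ?_⟩)
        · convert hpos using 1
          rw [← h1]
          funext x
          simp [affineReflection_affineReflection]
        · rw [h2]
          simp only [← mul_assoc, affineReflection_mul_self, one_mul]

/-- The relation `x → s_β x` between weights, for a positive root `β` that is positive at `x`: the
weight `s_β x` is farther from the fundamental alcove. -/
def WeightStep (x y : Fin k → ℤ) : Prop :=
  ∃ a b n, IsPosTriple a b n ∧ 0 < affineRoot a b n x ∧ y = affineReflection a b n x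

/-- The order on weights generated by `WeightStep`. -/
def WeightLE : (Fin k → ℤ) → (Fin k → ℤ) → Prop := Relation.ReflTransGen WeightStep

theorem exists_isMinimalRep {z y : Fin k → ℤ} (h : ∃ w ∈ affineSymmetricGroup k, w z = y) :
    ∃ u, IsMinimalRep z y u := by
  classical
  have hex : ∃ n, ∃ w ∈ affineSymmetricGroup k, w z = y ∧ affineLength w = n :=
    let ⟨w, hw, h⟩ := h; ⟨_, w, hw, h, rfl⟩
  obtain ⟨w, hw, h1, h2⟩ := Nat.find_spec hex
  exact ⟨w, hw, h1, fun w' hw' h' => h2.trans_le (Nat.find_min' hex ⟨w', hw', h', rfl⟩)⟩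

theorem IsMinimalRep.affineLength_eq {z x : Fin k → ℤ} {u v : Equiv.Perm (Fin k → ℤ)}
    (hu : IsMinimalRep z x u) (hv : IsMinimalRep z x v) : affineLength u = affineLength v :=
  le_antisymm (hu.2.2 v hv.1 hv.2.1) (hv.2.2 u hu.1 hu.2.1)

theorem IsMinimalRep.not_isPosRoot {z x : Fin k → ℤ} {u : Equiv.Perm (Fin k → ℤ)}
    (hz : IsMinuscule z) (hu : IsMinimalRep z x u) {a b : Fin k} {n : ℤ}
    (h : affineRoot a b n x < 0) : ¬ IsPosRoot (affineRoot a b n ∘ u) := fun hpos => by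
  have := hpos.nonneg_of_minuscule hz
  rw [Function.comp_apply, hu.2.1] at this
  omega

/-- If the simple root `α` is negative at `x`, then `s_α` makes minimal representatives of `x` and
of `s_α x` correspond, and the lengths differ by one. -/
theorem IsMinimalRep.simple_mul {z x : Fin k → ℤ} (hz : IsMinuscule z)
    {c d : Fin k} {m : ℤ} (hs : IsSimpleRoot c d m) (hcd : c ≠ d)
    (hneg : affineRoot c d m x < 0) {u : Equiv.Perm (Fin k → ℤ)} (hu : IsMinimalRep z x u) :
    IsMinimalRep z (affineReflection c d m x) (affineReflection c d m * u) ∧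
      affineLength u = affineLength (affineReflection c d m * u) + 1 := by
  have hsm : affineReflection c d m ∈ simpleReflections k := ⟨c, d, m, hs, rfl⟩
  have hsW := Subgroup.subset_closure hsm
  have hlt := affineLength_reflection_mul_lt hu.1 (hs.isPosTriple hcd) (hu.not_isPosRoot hz hneg)
  have hge := affineLength_simple_mul_le (mul_mem hsW hu.1) hsm
  rw [← mul_assoc, affineReflection_mul_self, one_mul] at hge
  refine ⟨⟨mul_mem hsW hu.1, by rw [Equiv.Perm.mul_apply, hu.2.1], fun w' hw' h' => ?_⟩, by omega⟩
  have h1 := hu.2.2 (affineReflection c d m * w') (mul_mem hsW hw') (by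
    rw [Equiv.Perm.mul_apply, h', affineReflection_affineReflection])
  have h2 := affineLength_simple_mul_le hw' hsm
  omega

/-- The converse of `IsMinimalRep.simple_mul`: a minimal representative of `s_α x` gives one of
`x`. -/
theorem IsMinimalRep.simple_mul' {z x : Fin k → ℤ} (hz : IsMinuscule z)
    {c d : Fin k} {m : ℤ} (hs : IsSimpleRoot c d m) (hcd : c ≠ d)
    (hneg : affineRoot c d m x < 0) {u : Equiv.Perm (Fin k → ℤ)}
    (hu : IsMinimalRep z (affineReflection c d m x) u) :
    IsMinimalRep z x (affineReflection c d m * u) ∧ RootStep u (affineReflection c d m * u) := by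
  have hsm : affineReflection c d m ∈ simpleReflections k := ⟨c, d, m, hs, rfl⟩
  have hsW := Subgroup.subset_closure hsm
  have hmem : affineReflection c d m * u ∈ affineSymmetricGroup k := mul_mem hsW hu.1
  have hux : (affineReflection c d m * u) z = x := by
    rw [Equiv.Perm.mul_apply, hu.2.1, affineReflection_affineReflection]
  obtain ⟨v, hv⟩ := exists_isMinimalRep ⟨_, hmem, hux⟩
  obtain ⟨h1, h2⟩ := hv.simple_mul hz hs hcd hneg
  have h3 := h1.affineLength_eq hu
  have h4 := affineLength_simple_mul_le hu.1 hsm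
  refine ⟨⟨hmem, hux, fun w' hw' h' => ?_⟩, c, d, m, hs.isPosTriple hcd, ?_, rfl⟩
  · have := hv.2.2 w' hw' h'
    omega
  · -- otherwise `s_α u` would be shorter than the minimal representative `u`
    by_contra hn
    have h5 := affineLength_reflection_mul_lt hu.1 (hs.isPosTriple hcd) hn
    have h6 := hv.2.2 _ hmem hux
    omega

/-- A step between weights lifts to the Bruhat order on minimal representatives. By induction on
the length of the minimal representative of `y`, as this weight is negative at some simple root
`α`: either the step is the one for `α`, or `s_α` carries it to a step between weights of which the
second has a shorter representative, and the lifting property applies. Minimal representatives are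
not assumed to be unique. -/
theorem exists_minimalRep_of_weightStep {z : Fin k → ℤ} (hz : IsMinuscule z) (N : ℕ) :
    ∀ {x y : Fin k → ℤ}, WeightStep x y → ∀ {u v₀}, IsMinimalRep z x u → IsMinimalRep z y v₀ →
      affineLength v₀ = N → ∃ v, IsMinimalRep z y v ∧ Relation.ReflTransGen RootStep u v := by
  induction N with
  | zero =>
    rintro x _ ⟨a, b, n, hp, hpos, rfl⟩ u v₀ hu hv₀ hN
    have := affineLength_reflection_mul_lt hv₀.1 hp (hv₀.not_isPosRoot hz (by
      rw [affineRoot_affineReflection_self hp.1]; omega))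
    omega
  | succ N ih =>
    rintro x y ⟨a, b, n, hp, hpos, rfl⟩ u v₀ hu hv₀ hN
    have hyneg : affineRoot a b n (affineReflection a b n x) < 0 := by
      rw [affineRoot_affineReflection_self hp.1]; omega
    obtain ⟨c, d, m, hs, hneg⟩ : ∃ c d m, IsSimpleRoot c d m ∧
        affineRoot c d m (affineReflection a b n x) < 0 := by
      by_contra! hcon
      have hmin : IsMinuscule (affineReflection a b n x) := fun c d m h => hcon c d m h
      have := IsPosRoot.nonneg_of_minuscule hmin ⟨a, b, n, hp, rfl⟩
      omega
    have hcd : c ≠ d := by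
      rintro rfl
      simp only [affineRoot] at hneg
      rcases hs with ⟨h, -⟩ | ⟨-, -, rfl⟩ <;> omega
    obtain ⟨hv₁, hlen⟩ := hv₀.simple_mul hz hs hcd hneg
    rcases exists_root_comp_simple hs hcd hp with ⟨rfl, rfl, rfl⟩ | ⟨a', b', n', hp', h1, h2⟩
    · have hu' : IsMinimalRep z (affineReflection a b n (affineReflection a b n x)) u := by
        rwa [affineReflection_affineReflection]
      obtain ⟨h3, h4⟩ := hu'.simple_mul' hz hs hcd hneg
      exact ⟨_, h3, .single h4⟩
    · set x' := affineReflection c d m x with hx'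
      have hstep : WeightStep x' (affineReflection c d m (affineReflection a b n x)) := by
        refine ⟨a', b', n', hp', ?_, ?_⟩
        · rw [← h1, Function.comp_apply, hx', affineReflection_affineReflection]
          exact hpos
        · rw [h2, hx']
          simp only [Equiv.Perm.mul_apply, affineReflection_affineReflection]
      have hN' : affineLength (affineReflection c d m * v₀) = N := by omega
      rcases lt_trichotomy (affineRoot c d m x) 0 with hx | hx | hx
      · obtain ⟨hu', -⟩ := hu.simple_mul hz hs hcd hx
        obtain ⟨v, hv, hle⟩ := ih hstep hu' hv₁ hN'
        obtain ⟨h3, h4⟩ := hv.simple_mul' hz hs hcd hneg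
        refine ⟨_, h3, ?_⟩
        have := lifting hs hcd hle
        rw [← mul_assoc, affineReflection_mul_self, one_mul] at this
        exact this.elim (fun h => h.tail h4) id
      · have hu' : IsMinimalRep z x' u := by rwa [hx', affineReflection_eq_self hx]
        obtain ⟨v, hv, hle⟩ := ih hstep hu' hv₁ hN'
        obtain ⟨h3, h4⟩ := hv.simple_mul' hz hs hcd hneg
        exact ⟨_, h3, hle.tail h4⟩
      · have hneg' : affineRoot c d m x' < 0 := by
          rw [hx', affineRoot_affineReflection_self hcd]; omega
        have hu₀ : IsMinimalRep z (affineReflection c d m x') u := by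
          rwa [hx', affineReflection_affineReflection]
        obtain ⟨hu', hst⟩ := hu₀.simple_mul' hz hs hcd hneg'
        obtain ⟨v, hv, hle⟩ := ih hstep hu' hv₁ hN'
        obtain ⟨h3, h4⟩ := hv.simple_mul' hz hs hcd hneg
        exact ⟨_, h3, .head hst (hle.tail h4)⟩

/-- The order generated by reflections is contained in the Bruhat order. -/
theorem WeightLE.weightBruhatLE {x y : Fin k → ℤ} (h : WeightLE x y) : WeightBruhatLE x y := by
  obtain ⟨z, hz, w, hw, hwz⟩ := exists_minuscule x
  obtain ⟨u, hu⟩ := exists_isMinimalRep ⟨w, hw, hwz⟩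
  have key : ∃ v, IsMinimalRep z y v ∧ Relation.ReflTransGen RootStep u v := by
    induction h with
    | refl => exact ⟨u, hu, .refl⟩
    | tail _ hst ih =>
      obtain ⟨v, hv, hle⟩ := ih
      have hst' := hst
      obtain ⟨a, b, n, hp, -, rfl⟩ := hst'
      obtain ⟨v₀, hv₀⟩ := exists_isMinimalRep (z := z) (y := affineReflection a b n _)
        ⟨affineReflection a b n * v, mul_mem (affineReflection_mem hp) hv.1, by
          rw [Equiv.Perm.mul_apply, hv.2.1]⟩
      obtain ⟨v', hv', hle'⟩ := exists_minimalRep_of_weightStep hz _ hst hv hv₀ rfl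
      exact ⟨v', hv', hle.trans hle'⟩
  obtain ⟨v, hv, hle⟩ := key
  refine ⟨z, hz, u, v, hu, hv, hu.1, hv.1, ?_⟩
  clear hv
  have : v ∈ affineSymmetricGroup k ∧ Relation.ReflTransGen BruhatStep u v := by
    induction hle with
    | refl => exact ⟨hu.1, .refl⟩
    | tail _ hst ih =>
      obtain ⟨h1, h2⟩ := hst.bruhatStep ih.1
      exact ⟨h1, ih.2.tail h2⟩
  exact this.2

/-- If `x ≤ y` and the simple root `α` is nonnegative at `x` and negative at `y`,
then `x ≤ s_α y`. -/
theorem WeightLE.le_simple {c d : Fin k} {m : ℤ} (hs : IsSimpleRoot c d m) (hcd : c ≠ d)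
    {x y : Fin k → ℤ} (h : WeightLE x y) (hx : 0 ≤ affineRoot c d m x)
    (hy : affineRoot c d m y < 0) : WeightLE x (affineReflection c d m y) := by
  let μ : (Fin k → ℤ) → Fin k → ℤ := fun x =>
    if affineRoot c d m x < 0 then affineReflection c d m x else x
  have hp := hs.isPosTriple hcd
  have hle : ∀ x, WeightLE (μ x) x ∧ WeightLE (μ x) (affineReflection c d m x) := by
    intro x
    simp only [μ]
    split_ifs with h
    · refine ⟨.single ⟨c, d, m, hp, ?_, (affineReflection_affineReflection c d m x).symm⟩, .refl⟩
      rw [affineRoot_affineReflection_self hcd]; omega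
    · refine ⟨.refl, ?_⟩
      rcases (not_lt.1 h).eq_or_lt with h0 | h0
      · rw [affineReflection_eq_self h0.symm]; exact .refl
      · exact .single ⟨c, d, m, hp, h0, rfl⟩
  have key : WeightLE (μ x) (μ y) := by
    clear hx hy
    induction h with
    | refl => exact .refl
    | @tail y y' _ hst ih =>
      refine ih.trans ?_
      by_cases hy' : affineRoot c d m y' < 0
      · have e : μ y' = affineReflection c d m y' := if_pos hy'
        rw [e]
        obtain ⟨a, b, n, hab, hpos, rfl⟩ := hst
        rcases exists_root_comp_simple hs hcd hab with ⟨rfl, rfl, rfl⟩ | ⟨a', b', n', hp', h1, h2⟩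
        · rw [affineReflection_affineReflection]; exact (hle y).1
        · refine (hle y).2.tail ⟨a', b', n', hp', ?_, ?_⟩
          · rw [← h1, Function.comp_apply, affineReflection_affineReflection]; exact hpos
          · rw [h2]
            simp only [Equiv.Perm.mul_apply, affineReflection_affineReflection]
      · have e : μ y' = y' := if_neg hy'
        rw [e]
        exact (hle y).1.tail hst
  simpa only [μ, if_neg (not_lt.2 hx), if_pos hy] using key

end Bruhat

open Filter MvPolynomial

/-! ### Coefficients of formal polynomials -/

/-- The exponent obtained by exchanging the entries `j` and `j + 1`. -/
def swapExp (j : ℕ) (e : ℕ →₀ ℕ) : ℕ →₀ ℕ := e.equivMapDomain (Equiv.swap j (j + 1))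

/-- The exponent `e` only involves the variables `x_1, …, x_k`. -/
def InRange (k : ℕ) (e : ℕ →₀ ℕ) : Prop := ∀ j, e j ≠ 0 → 1 ≤ j ∧ j ≤ k

theorem InRange.mono {k n : ℕ} (h : k ≤ n) {e : ℕ →₀ ℕ} (he : InRange k e) : InRange n e :=
  fun j hj => ⟨(he j hj).1, (he j hj).2.trans h⟩

theorem swapExp_apply (j : ℕ) (e : ℕ →₀ ℕ) (n : ℕ) :
    swapExp j e n = e (Equiv.swap j (j + 1) n) := by
  simp [swapExp, Finsupp.equivMapDomain_apply]

theorem swapExp_left (j : ℕ) (e : ℕ →₀ ℕ) : swapExp j e j = e (j + 1) := by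
  simp [swapExp_apply]

theorem swapExp_right (j : ℕ) (e : ℕ →₀ ℕ) : swapExp j e (j + 1) = e j := by
  simp [swapExp_apply]

theorem swapExp_of_ne {j n : ℕ} (e : ℕ →₀ ℕ) (h : n ≠ j) (h' : n ≠ j + 1) :
    swapExp j e n = e n := by
  rw [swapExp_apply, Equiv.swap_apply_of_ne_of_ne h h']

theorem swapExp_swapExp (j : ℕ) (e : ℕ →₀ ℕ) : swapExp j (swapExp j e) = e := by
  ext n
  simp [swapExp_apply]

theorem swapVars_monomial (j : ℕ) (e : ℕ →₀ ℕ) (c : K) :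
    swapVars j (monomial e c) = monomial (swapExp j e) c := by
  rw [swapVars, rename_monomial, swapExp, Finsupp.equivMapDomain_eq_mapDomain]

theorem coeff_swapVars (j : ℕ) (e : ℕ →₀ ℕ) (p : Poly) :
    coeff e (swapVars j p) = coeff (swapExp j e) p := by
  have h : e = (swapExp j e).mapDomain (Equiv.swap j (j + 1)) := by
    rw [← Finsupp.equivMapDomain_eq_mapDomain]
    exact (swapExp_swapExp j e).symm
  conv_lhs => rw [h]
  exact coeff_rename_mapDomain _ (Equiv.injective _) _ _

theorem coeff_aeval_ite (S : ℕ → Prop) [DecidablePred S] (e : ℕ →₀ ℕ) (p : Poly) :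
    coeff e (aeval (fun n => if S n then (X n : Poly) else 0) p) =
      if ∀ j ∈ e.support, S j then coeff e p else 0 := by
  classical
  induction p using MvPolynomial.induction_on' with
  | monomial e' c =>
    have h : aeval (fun n => if S n then (X n : Poly) else 0) (monomial e' c) =
        if ∀ j ∈ e'.support, S j then monomial e' c else 0 := by
      rw [aeval_monomial, Finsupp.prod]
      split_ifs with h1
      · rw [monomial_eq, Finsupp.prod, MvPolynomial.algebraMap_eq]
        congr 1
        exact Finset.prod_congr rfl fun n hn => by rw [if_pos (h1 n hn)]
      · push Not at h1
        obtain ⟨j, hj, hS⟩ := h1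
        rw [Finset.prod_eq_zero hj, mul_zero]
        rw [if_neg hS, zero_pow (Finsupp.mem_support_iff.1 hj)]
    rw [h]
    by_cases he : e' = e
    · subst he
      split_ifs <;> simp
    · split_ifs <;> simp [coeff_monomial, he]
  | add p q hp hq =>
    rw [map_add, coeff_add, hp, hq, coeff_add]
    split_ifs <;> simp

theorem coeff_dropVar (j : ℕ) (e : ℕ →₀ ℕ) (p : Poly) :
    coeff e (dropVar j p) = if e j = 0 then coeff e p else 0 := by
  have h : dropVar j = aeval (fun n => if n ≠ j then (X n : Poly) else 0) := by
    unfold dropVar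
    congr 1
    funext n
    rw [ite_not]
  rw [h, coeff_aeval_ite]
  refine if_congr ⟨fun h1 => ?_, fun h1 n hn => ?_⟩ rfl rfl
  · by_contra h2
    exact h1 j (Finsupp.mem_support_iff.2 h2) rfl
  · rintro rfl
    exact Finsupp.mem_support_iff.1 hn h1

open Classical in
theorem coeff_truncVars (k : ℕ) (e : ℕ →₀ ℕ) (p : Poly) :
    coeff e (truncVars k p) = if InRange k e then coeff e p else 0 := by
  have h : truncVars k = aeval (fun n => if n ∈ Set.Icc 1 k then (X n : Poly) else 0) := by
    unfold truncVars
    congr 1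
  rw [h, coeff_aeval_ite]
  refine if_congr ⟨fun h1 j hj => h1 j (Finsupp.mem_support_iff.2 hj),
    fun h1 j hj => h1 j (Finsupp.mem_support_iff.1 hj)⟩ rfl rfl

theorem mem_finPoly_iff {k : ℕ} {p : Poly} :
    p ∈ finPoly k ↔ ∀ e, coeff e p ≠ 0 → InRange k e := by
  rw [finPoly, mem_supported]
  constructor
  · intro h e he j hj
    exact h ((mem_vars_iff_mem_support j).2 ⟨e, mem_support_iff.2 he, Finsupp.mem_support_iff.2 hj⟩)
  · intro h j hj
    obtain ⟨e, he, hje⟩ := (mem_vars_iff_mem_support j).1 hj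
    exact h e (mem_support_iff.1 he) j (Finsupp.mem_support_iff.1 hje)

theorem degree_le_of_totalDegree_le {p : Poly} {d : ℕ} (h : p.totalDegree ≤ d) {e : ℕ →₀ ℕ}
    (he : coeff e p ≠ 0) : e.degree ≤ d :=
  (le_totalDegree (mem_support_iff.2 he)).trans h

/-- The formal polynomials that are fixed by `s_i` for all `i > m`. -/
def symPast (m : ℕ) : Submodule K (ℕ → Poly) where
  carrier := {F | F ∈ formalPoly ∧ ∀ i, m < i → ∀ n, i + 1 ≤ n → swapVars i (F n) = F n}
  add_mem' hF hG := ⟨add_mem hF.1 hG.1, fun i hi n hn => by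
    rw [Pi.add_apply, map_add, hF.2 i hi n hn, hG.2 i hi n hn]⟩
  zero_mem' := ⟨zero_mem _, fun i _ n _ => by simp⟩
  smul_mem' c F hF := ⟨Subalgebra.smul_mem _ hF.1 c, fun i hi n hn => by
    rw [Pi.smul_apply, map_smul, hF.2 i hi n hn]⟩

theorem symPast_mono {m n : ℕ} (h : m ≤ n) : symPast m ≤ symPast n :=
  fun _ hF => ⟨hF.1, fun i hi => hF.2 i (lt_of_le_of_lt h hi)⟩

theorem mem_almostSym_iff {F : ℕ → Poly} : F ∈ almostSym ↔ ∃ m, F ∈ symPast m :=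
  ⟨fun h => ⟨h.2.choose, h.1, h.2.choose_spec⟩, fun ⟨m, h⟩ => ⟨h.1, m, h.2⟩⟩

theorem symPast.mem_almostSym {m : ℕ} {F : ℕ → Poly} (h : F ∈ symPast m) : F ∈ almostSym :=
  mem_almostSym_iff.2 ⟨m, h⟩

theorem formalPoly.inRange {F : ℕ → Poly} (hF : F ∈ formalPoly) {k : ℕ} {e : ℕ →₀ ℕ}
    (h : coeff e (F k) ≠ 0) : InRange k e :=
  mem_finPoly_iff.1 (hF.1 k) e h

theorem formalPoly.coeff_eq {F : ℕ → Poly} (hF : F ∈ formalPoly) {k n : ℕ} {e : ℕ →₀ ℕ}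
    (hk : InRange k e) (hn : InRange n e) : coeff e (F k) = coeff e (F n) := by
  wlog h : k ≤ n generalizing k n
  · exact (this hn hk (le_of_not_ge h)).symm
  induction n, h using Nat.le_induction with
  | base => rfl
  | succ n h ih =>
    rw [ih (hk.mono h), ← hF.2.1 n, coeff_dropVar, if_pos]
    by_contra h0
    have := (hk _ h0).2
    omega

/-- A sequence of polynomials whose coefficients, in the relevant range, are those of a function on
exponents of bounded degree that is invariant under `s_i`, `i > m`. -/
theorem mem_symPast_of_coeff {m d : ℕ} {F : ℕ → Poly} (c : (ℕ →₀ ℕ) → K)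
    (hc : ∀ k e, (InRange k e → coeff e (F k) = c e) ∧ (¬ InRange k e → coeff e (F k) = 0))
    (hd : ∀ e, c e ≠ 0 → e.degree ≤ d) (hs : ∀ i, m < i → ∀ e, c (swapExp i e) = c e) :
    F ∈ symPast m := by
  refine ⟨⟨fun k => ?_, fun k => ?_, d, fun k => ?_⟩, fun i hi n hn => ?_⟩
  · rw [mem_finPoly_iff]
    intro e he
    by_contra h
    exact he ((hc k e).2 h)
  · ext e
    rw [coeff_dropVar]
    by_cases hk : InRange k e
    · rw [(hc _ _).1 hk, (hc _ _).1 (hk.mono (Nat.le_succ k)), if_pos]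
      by_contra h0
      have := (hk _ h0).2
      omega
    · rw [(hc _ _).2 hk]
      split_ifs with h0
      · refine (hc _ _).2 fun h1 => hk fun j hj => ⟨(h1 j hj).1, ?_⟩
        have := (h1 j hj).2
        have : j ≠ k + 1 := by rintro rfl; exact hj h0
        omega
      · rfl
  · refine Finset.sup_le fun e he => ?_
    have he := mem_support_iff.1 he
    have hr : InRange k e := by
      by_contra h
      exact he ((hc k e).2 h)
    rw [(hc k e).1 hr] at he
    exact hd e he
  · ext e
    rw [coeff_swapVars]
    have hsw : ∀ e, InRange n e → InRange n (swapExp i e) := by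
      intro e he j hj
      rw [swapExp_apply] at hj
      have := he _ hj
      by_cases h1 : j = i
      · omega
      · by_cases h2 : j = i + 1
        · omega
        · rwa [Equiv.swap_apply_of_ne_of_ne h1 h2] at this
    by_cases hr : InRange n e
    · rw [(hc _ _).1 hr, (hc _ _).1 (hsw e hr), hs i hi]
    · rw [(hc _ _).2 hr, (hc _ _).2]
      intro h
      exact hr (swapExp_swapExp i e ▸ hsw _ h)

/-! ### Exponents up to permutations of the tail -/

/-- The multiset of the nonzero entries `e_j`, `j > m`. -/
def tailMs (m : ℕ) (e : ℕ →₀ ℕ) : Multiset ℕ := (e.support.filter (m < ·)).val.map e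

/-- Two exponents agree up to `m`, and up to a permutation beyond `m`. -/
def TailRel (m : ℕ) (e e' : ℕ →₀ ℕ) : Prop := (∀ j ≤ m, e j = e' j) ∧ tailMs m e = tailMs m e'

theorem TailRel.refl (m : ℕ) (e : ℕ →₀ ℕ) : TailRel m e e := ⟨fun _ _ => rfl, rfl⟩

theorem TailRel.symm {m : ℕ} {e e' : ℕ →₀ ℕ} (h : TailRel m e e') : TailRel m e' e :=
  ⟨fun j hj => (h.1 j hj).symm, h.2.symm⟩

theorem TailRel.trans {m : ℕ} {e e' e'' : ℕ →₀ ℕ} (h : TailRel m e e') (h' : TailRel m e' e'') :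
    TailRel m e e'' :=
  ⟨fun j hj => (h.1 j hj).trans (h'.1 j hj), h.2.trans h'.2⟩

theorem sum_eq_head_add_tail (m : ℕ) (φ : ℕ → ℕ) (hφ : φ 0 = 0) (e : ℕ →₀ ℕ) :
    e.sum (fun _ v => φ v) =
      ∑ j ∈ Finset.range (m + 1), φ (e j) + ((tailMs m e).map φ).sum := by
  rw [Finsupp.sum, ← Finset.sum_filter_add_sum_filter_not e.support (m < ·), add_comm]
  congr 1
  · refine Finset.sum_subset (s₁ := e.support.filter (¬ m < ·)) ?_ ?_
    · intro j hj
      simp only [Finset.mem_filter] at hj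
      simp only [Finset.mem_range]
      omega
    · intro j hj hj'
      simp only [Finset.mem_filter, Finset.mem_range, not_and, not_lt, Finsupp.mem_support_iff]
        at hj hj'
      by_cases h : e j = 0
      · rw [h, hφ]
      · exact absurd (hj' h) (by omega)
  · rw [tailMs, Multiset.map_map]
    rfl

theorem degree_eq_head_add_tail (m : ℕ) (e : ℕ →₀ ℕ) :
    e.degree = ∑ j ∈ Finset.range (m + 1), e j + (tailMs m e).sum := by
  have := sum_eq_head_add_tail m id rfl e
  simpa [Finsupp.degree_apply, Finsupp.sum] using this

theorem TailRel.sum_eq {m : ℕ} {e e' : ℕ →₀ ℕ} (h : TailRel m e e') (φ : ℕ → ℕ) (hφ : φ 0 = 0) :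
    e.sum (fun _ v => φ v) = e'.sum (fun _ v => φ v) := by
  rw [sum_eq_head_add_tail m φ hφ, sum_eq_head_add_tail m φ hφ, h.2]
  congr 1
  refine Finset.sum_congr rfl fun j hj => ?_
  rw [h.1 j (by rw [Finset.mem_range] at hj; omega)]

theorem TailRel.degree_eq {m : ℕ} {e e' : ℕ →₀ ℕ} (h : TailRel m e e') : e.degree = e'.degree := by
  have := h.sum_eq id rfl
  simpa [Finsupp.degree_apply, Finsupp.sum] using this

theorem tailRel_swapExp {m j : ℕ} (h : m < j) (e : ℕ →₀ ℕ) : TailRel m (swapExp j e) e := by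
  refine ⟨fun n hn => swapExp_of_ne e (by omega) (by omega), ?_⟩
  have hs : (swapExp j e).support = e.support.map (Equiv.swap j (j + 1)).toEmbedding := rfl
  have hf : e.support.filter ((m < ·) ∘ (Equiv.swap j (j + 1)).toEmbedding) =
      e.support.filter (m < ·) := by
    refine Finset.filter_congr fun n _ => ?_
    simp only [Function.comp_apply, Equiv.coe_toEmbedding, Equiv.swap_apply_def]
    split_ifs <;> omega
  rw [tailMs, hs, Finset.filter_map, hf, Finset.map_val, Multiset.map_map]
  refine Multiset.map_congr rfl fun n _ => ?_
  simp [swapExp_apply]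

/-- The entries of the exponent beyond `m` are in decreasing order. -/
def TailSorted (m : ℕ) (e : ℕ →₀ ℕ) : Prop := ∀ j, m < j → e (j + 1) ≤ e j

/-- Exchange of two adjacent entries beyond `m` that are in increasing order. -/
def SortStep (m : ℕ) (e e' : ℕ →₀ ℕ) : Prop := ∃ j, m < j ∧ e j < e (j + 1) ∧ e' = swapExp j e

/-- Two exponents that agree off the positions `u` and `v`: sums over their entries differ only in
the terms at `u` and `v`. -/
theorem exists_sum_eq_of_agree {u v : ℕ} (huv : u ≠ v) {e e' : ℕ →₀ ℕ}
    (h : ∀ j, j ≠ u → j ≠ v → e' j = e j) (φ : ℕ → ℕ → ℕ) (hφ : ∀ j, φ j 0 = 0) :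
    ∃ r, e.sum φ = φ u (e u) + φ v (e v) + r ∧ e'.sum φ = φ u (e' u) + φ v (e' v) + r := by
  have hsplit : ∀ e : ℕ →₀ ℕ, e.sum φ =
      φ u (e u) + φ v (e v) + ((e.erase u).erase v).sum φ := by
    intro e
    rw [← Finsupp.add_sum_erase' e u φ hφ, ← Finsupp.add_sum_erase' (e.erase u) v φ hφ,
      Finsupp.erase_ne huv.symm, add_assoc]
  refine ⟨_, hsplit e, ?_⟩
  rw [hsplit e']
  congr 2
  ext j
  by_cases h1 : j = v
  · subst h1; simp
  · by_cases h2 : j = u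
    · subst h2; simp [Finsupp.erase_ne h1]
    · rw [Finsupp.erase_ne h1, Finsupp.erase_ne h2, Finsupp.erase_ne h1, Finsupp.erase_ne h2,
        h j h2 h1]

theorem exists_tailSorted (m : ℕ) (e : ℕ →₀ ℕ) :
    ∃ e', Relation.ReflTransGen (SortStep m) e e' ∧ TailSorted m e' := by
  -- each exchange lowers `∑ j e_j`
  generalize hN : e.sum (fun j v => j * v) = N
  induction N using Nat.strong_induction_on generalizing e with
  | _ N ih =>
    by_cases h : TailSorted m e
    · exact ⟨e, .refl, h⟩
    · simp only [TailSorted, not_forall, not_le] at h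
      obtain ⟨j, hj, hlt⟩ := h
      have hlt' : (swapExp j e).sum (fun j v => j * v) < N := by
        obtain ⟨r, h1, h2⟩ := exists_sum_eq_of_agree (by omega : j ≠ j + 1)
          (fun n h1 h2 => swapExp_of_ne e h1 h2) (fun j v => j * v) (by simp)
        rw [← hN, h1, h2, swapExp_left, swapExp_right]
        nlinarith
      obtain ⟨e', h1, h2⟩ := ih _ hlt' (swapExp j e) rfl
      exact ⟨e', .head ⟨j, hj, hlt, rfl⟩ h1, h2⟩

theorem TailRel.of_sortSteps {m : ℕ} {e e' : ℕ →₀ ℕ}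
    (h : Relation.ReflTransGen (SortStep m) e e') : TailRel m e' e := by
  induction h with
  | refl => exact .refl _ _
  | tail _ hst ih =>
    obtain ⟨j, hj, -, rfl⟩ := hst
    exact (tailRel_swapExp hj _).trans ih

theorem InRange.sortStep {m k : ℕ} {e e' : ℕ →₀ ℕ} (he : InRange k e) (h : SortStep m e e') :
    InRange k e' := by
  obtain ⟨j, hj, hlt, rfl⟩ := h
  intro n hn
  have h1 := he (j + 1) (by omega)
  by_cases h2 : n = j
  · omega
  · by_cases h3 : n = j + 1
    · omega
    · rw [swapExp_of_ne e h2 h3] at hn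
      exact he n hn

theorem InRange.sortSteps {m k : ℕ} {e e' : ℕ →₀ ℕ} (he : InRange k e)
    (h : Relation.ReflTransGen (SortStep m) e e') : InRange k e' := by
  induction h with
  | refl => exact he
  | tail _ hst ih => exact ih.sortStep hst

/-- A sorted tail is determined by its multiset: the number of entries that are at least `v` is the
`v`-th part of the conjugate partition. -/
theorem TailSorted.le_iff {m : ℕ} {e : ℕ →₀ ℕ} (he : TailSorted m e) {v j : ℕ} (hv : 0 < v)
    (hj : m < j) : v ≤ e j ↔ j ≤ m + ((tailMs m e).filter (v ≤ ·)).card := by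
  have hcard : ((tailMs m e).filter (v ≤ ·)).card =
      ((e.support.filter (m < ·)).filter (fun n => v ≤ e n)).card := by
    rw [tailMs, Multiset.filter_map, Multiset.card_map]
    rfl
  have hanti : ∀ i n, m < i → i ≤ n → e n ≤ e i := by
    intro i n hi hin
    induction n, hin using Nat.le_induction with
    | base => exact le_rfl
    | succ n hn ih => exact (he n (by omega)).trans ih
  rw [hcard]
  constructor
  · intro h
    have hsub : Finset.Ioc m j ⊆ (e.support.filter (m < ·)).filter (fun n => v ≤ e n) := by
      intro n hn
      rw [Finset.mem_Ioc] at hn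
      have := hanti n j hn.1 hn.2
      simp only [Finset.mem_filter, Finsupp.mem_support_iff]
      omega
    have := Finset.card_le_card hsub
    rw [Nat.card_Ioc] at this
    omega
  · intro h
    by_contra hlt
    have hsub : (e.support.filter (m < ·)).filter (fun n => v ≤ e n) ⊆ Finset.Ioo m j := by
      intro n hn
      simp only [Finset.mem_filter] at hn
      rw [Finset.mem_Ioo]
      refine ⟨hn.1.2, ?_⟩
      by_contra hge
      have := hanti j n hj (by omega)
      omega
    have := Finset.card_le_card hsub
    rw [Nat.card_Ioo] at this
    omega

theorem TailSorted.eq_of_tailRel {m : ℕ} {e e' : ℕ →₀ ℕ} (he : TailSorted m e)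
    (he' : TailSorted m e') (h : TailRel m e e') : e = e' := by
  ext j
  rcases le_or_gt j m with hj | hj
  · exact h.1 j hj
  · have key : ∀ v, 0 < v → (v ≤ e j ↔ v ≤ e' j) := fun v hv => by
      rw [he.le_iff hv hj, he'.le_iff hv hj, h.2]
    have h1 := key (e j)
    have h2 := key (e' j)
    omega

open Classical in
/-- The sum of the monomials in `x_1, …, x_k` whose exponents agree with `e` up to `m`, and up to a
permutation beyond `m`. -/
noncomputable def orbitSum (m : ℕ) (e : ℕ →₀ ℕ) (k : ℕ) : Poly :=
  ∑ e' ∈ (Finset.finsuppAntidiag (Finset.Icc 1 k) e.degree).filter (TailRel m · e), monomial e' 1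

theorem InRange.support_subset {k : ℕ} {e : ℕ →₀ ℕ} :
    e.support ⊆ Finset.Icc 1 k ↔ InRange k e := by
  refine ⟨fun h j hj => Finset.mem_Icc.1 (h (Finsupp.mem_support_iff.2 hj)), fun h j hj => ?_⟩
  exact Finset.mem_Icc.2 (h j (Finsupp.mem_support_iff.1 hj))

open Classical in
theorem coeff_orbitSum (m : ℕ) (e e' : ℕ →₀ ℕ) (k : ℕ) :
    coeff e' (orbitSum m e k) = if InRange k e' ∧ TailRel m e' e then 1 else 0 := by
  rw [orbitSum, coeff_sum]
  simp only [coeff_monomial]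
  rw [Finset.sum_ite_eq']
  refine if_congr ?_ rfl rfl
  rw [Finset.mem_filter, Finset.mem_finsuppAntidiag, InRange.support_subset]
  constructor
  · rintro ⟨⟨-, h⟩, h'⟩
    exact ⟨h, h'⟩
  · rintro ⟨h, h'⟩
    refine ⟨⟨?_, h⟩, h'⟩
    rw [← h'.degree_eq, Finsupp.degree]
    exact (Finset.sum_subset (InRange.support_subset.2 h) fun j _ hj =>
      Finsupp.notMem_support_iff.1 hj).symm

theorem orbitSum_mem (m : ℕ) (e : ℕ →₀ ℕ) : orbitSum m e ∈ symPast m := by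
  classical
  refine mem_symPast_of_coeff (d := e.degree) (fun e' => if TailRel m e' e then 1 else 0)
    (fun k e' => ⟨fun h => ?_, fun h => ?_⟩) (fun e' he' => ?_) fun i hi e' => ?_
  · rw [coeff_orbitSum]
    simp [h]
  · rw [coeff_orbitSum, if_neg (fun h' => h h'.1)]
  · have : TailRel m e' e := by
      by_contra h
      exact he' (if_neg h)
    exact this.degree_eq.le
  · exact if_congr ⟨fun h => ((tailRel_swapExp hi e').symm).trans h,
      fun h => (tailRel_swapExp hi e').trans h⟩ rfl rfl

theorem symPast.coeff_sortSteps {m k : ℕ} {F : ℕ → Poly} (hF : F ∈ symPast m) {e e' : ℕ →₀ ℕ}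
    (he : InRange k e) (h : Relation.ReflTransGen (SortStep m) e e') :
    coeff e' (F k) = coeff e (F k) := by
  induction h with
  | refl => rfl
  | @tail e₁ e₂ h1 hst ih =>
    rw [← ih]
    obtain ⟨j, hj, hlt, rfl⟩ := hst
    have := ((he.sortSteps h1) (j + 1) (by omega)).2
    rw [← coeff_swapVars, hF.2 j hj k this]

/-- A formal polynomial fixed by the `s_i`, `i > m`, is a linear combination of the orbit sums of
the sorted exponents at which it has a nonzero coefficient. -/
theorem symPast.mem_span {m : ℕ} {F : ℕ → Poly} (hF : F ∈ symPast m) :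
    F ∈ Submodule.span K
      (orbitSum m '' {e | TailSorted m e ∧ ∃ k, coeff e (F k) ≠ 0}) := by
  classical
  obtain ⟨d, hd⟩ := hF.1.2.2
  have hexp : F = ∑ e ∈ (F (m + d)).support.filter (TailSorted m),
      coeff e (F (m + d)) • orbitSum m e := by
    funext k
    ext e'
    rw [Finset.sum_apply, coeff_sum]
    simp only [Pi.smul_apply, coeff_smul, coeff_orbitSum, smul_eq_mul]
    by_cases hk : InRange k e'
    · obtain ⟨e, hs, hsort⟩ := exists_tailSorted m e'
      have hrel := TailRel.of_sortSteps hs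
      have hke : InRange k e := hk.sortSteps hs
      rw [← symPast.coeff_sortSteps hF hk hs, Finset.sum_eq_single e]
      · rw [if_pos ⟨hk, hrel.symm⟩, mul_one]
        by_cases hmd : InRange (m + d) e
        · exact formalPoly.coeff_eq hF.1 hke hmd
        · -- a sorted exponent that involves `x_j` with `j > m + d` has degree greater than `d`
          have h1 : coeff e (F (m + d)) = 0 := by
            by_contra h
            exact hmd (formalPoly.inRange hF.1 h)
          rw [h1]
          by_contra h
          have h2 := degree_le_of_totalDegree_le (hd k) h
          refine hmd fun j hj => ⟨(hke j hj).1, ?_⟩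
          by_contra hlt
          have h3 := (hsort.le_iff (v := 1) (j := j) one_pos (by omega)).1 (by omega)
          have h4 : ((tailMs m e).filter (1 ≤ ·)).card ≤ (tailMs m e).sum := by
            generalize tailMs m e = t
            induction t using Multiset.induction with
            | empty => simp
            | cons a t ih =>
              rw [Multiset.filter_cons]
              split_ifs <;> simp <;> omega
          rw [degree_eq_head_add_tail m e] at h2
          omega
      · intro e₁ h1 hne
        rw [if_neg, mul_zero]
        rintro ⟨-, h2⟩
        exact hne ((Finset.mem_filter.1 h1).2.eq_of_tailRel hsort (h2.symm.trans hrel.symm))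
      · intro h
        rw [Finset.mem_filter, not_and_or] at h
        rcases h with h | h
        · rw [notMem_support_iff.1 h, zero_mul]
        · exact absurd hsort h
    · rw [Finset.sum_eq_zero]
      · by_contra h
        exact hk (formalPoly.inRange hF.1 h)
      · intro e _
        rw [if_neg (fun h => hk h.1), mul_zero]
  -- `F` also occurs in the index set, which has to stay as it is
  have key : ∀ G, F = G → G ∈ Submodule.span K (orbitSum m '' {e | TailSorted m e ∧
      ∃ k, coeff e (F k) ≠ 0}) → F ∈ Submodule.span K (orbitSum m '' {e | TailSorted m e ∧
      ∃ k, coeff e (F k) ≠ 0}) := fun G h hG => h ▸ hG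
  refine key _ hexp ?_
  refine Submodule.sum_mem _ fun e he => Submodule.smul_mem _ _ (Submodule.subset_span ?_)
  rw [Finset.mem_filter] at he
  exact ⟨e, ⟨he.2, m + d, mem_support_iff.1 he.1⟩, rfl⟩

/-! ### Almost symmetric monomials as orbit sums -/

/-- The exponent with entries `l_1, l_2, …`. -/
noncomputable def listExp (l : List ℕ) : ℕ →₀ ℕ :=
  Finsupp.onFinset (Finset.Icc 1 l.length) (fun j => if j = 0 then 0 else l.getD (j - 1) 0) (by
    intro j hj
    by_cases h0 : j = 0
    · simp [h0] at hj
    · by_contra h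
      rw [Finset.mem_Icc, not_and_or] at h
      rw [if_neg h0, List.getD_eq_default _ _ (by omega)] at hj
      exact hj rfl)

theorem listExp_apply (l : List ℕ) (j : ℕ) :
    listExp l j = if j = 0 then 0 else l.getD (j - 1) 0 := rfl

theorem listExp_zero (l : List ℕ) : listExp l 0 = 0 := rfl

theorem listExp_succ (l : List ℕ) (j : ℕ) : listExp l (j + 1) = l.getD j 0 := by
  simp [listExp_apply]

theorem listExp_inRange (l : List ℕ) : InRange l.length (listExp l) := by
  rw [← InRange.support_subset]
  exact Finsupp.support_onFinset_subset

theorem listExp_append_left {l l' : List ℕ} {j : ℕ} (h : j ≤ l.length) :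
    listExp (l ++ l') j = listExp l j := by
  rw [listExp_apply, listExp_apply]
  split_ifs with h0
  · rfl
  · rw [List.getD_append _ _ _ _ (by omega)]

theorem listExp_append_right {l l' : List ℕ} (j : ℕ) :
    listExp (l ++ l') (l.length + j + 1) = l'.getD j 0 := by
  rw [listExp_succ, List.getD_append_right _ _ _ _ (by omega)]
  congr 1
  omega

theorem tailMs_listExp (l : List ℕ) {l' : List ℕ} (h : ∀ a ∈ l', 0 < a) :
    tailMs l.length (listExp (l ++ l')) = (l' : Multiset ℕ) := by
  have hinj : Function.Injective (fun j => l.length + j + 1) := fun i j h => by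
    simp only at h
    omega
  have hs : (listExp (l ++ l')).support.filter (l.length < ·) =
      (Finset.range l'.length).map ⟨fun j => l.length + j + 1, hinj⟩ := by
    ext n
    simp only [Finset.mem_filter, Finsupp.mem_support_iff, Finset.mem_map, Finset.mem_range,
      Function.Embedding.coeFn_mk]
    constructor
    · rintro ⟨h1, h2⟩
      refine ⟨n - l.length - 1, ?_, by omega⟩
      have := (listExp_inRange (l ++ l') n h1).2
      rw [List.length_append] at this
      omega
    · rintro ⟨j, hj, rfl⟩
      refine ⟨?_, by omega⟩
      rw [listExp_append_right, List.getD_eq_getElem _ _ hj]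
      exact (h _ (List.getElem_mem hj)).ne'
  rw [tailMs, hs, Finset.map_val, Multiset.map_map]
  simp only [Function.comp_def, Function.Embedding.coeFn_mk, listExp_append_right,
    Finset.range_val, Multiset.range, Multiset.map_coe]
  congr 1
  refine List.ext_getElem (by simp) fun i h1 h2 => ?_
  simp [List.getElem?_eq_getElem h2]

theorem compMonomial_eq (l : List ℕ) : compMonomial l = monomial (listExp l) 1 := by
  rw [compMonomial, monomial_eq, C_1, one_mul,
    Finsupp.prod_of_support_subset _ (InRange.support_subset.2 (listExp_inRange l)) _ (by simp)]
  have h := Fin.prod_univ_eq_prod_range (fun j => (X (j + 1) : Poly) ^ l.getD j 0) l.length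
  have h' : ∏ j : Fin l.length, (X (j.val + 1) : Poly) ^ l.get j =
      ∏ j : Fin l.length, (X (j.val + 1) : Poly) ^ l.getD j.val 0 := by
    refine Finset.prod_congr rfl fun j _ => ?_
    rw [List.getD_eq_getElem _ _ j.2]
    rfl
  rw [h', h]
  refine Finset.prod_nbij (· + 1) (fun j hj => ?_) (fun i _ j _ h => ?_) (fun j hj => ?_)
    fun j _ => by rw [listExp_succ]
  · rw [Finset.mem_range] at hj
    exact Finset.mem_Icc.2 ⟨by omega, by omega⟩
  · simp only at h
    omega
  · have hj := Finset.mem_Icc.1 (Finset.mem_coe.1 hj)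
    exact ⟨j - 1, Finset.mem_coe.2 (Finset.mem_range.2 (by omega)), by simp only; omega⟩

theorem prod_X_eq_monomial (s : Multiset ℕ) :
    (s.map (fun j => (X j : Poly))).prod = monomial (Multiset.toFinsupp s) 1 := by
  induction s using Multiset.induction with
  | empty => simp
  | cons a s ih =>
    rw [Multiset.map_cons, Multiset.prod_cons, ih, X, monomial_mul, one_mul,
      ← Multiset.singleton_add, map_add, Multiset.toFinsupp_singleton]

theorem tailMs_eq_count (m : ℕ) (e : ℕ →₀ ℕ) (t : Multiset ℕ) (h : ∀ j, m < j → e j = t.count j)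
    (ht : ∀ j ∈ t, m < j) : tailMs m e = t.dedup.map t.count := by
  have hs : e.support.filter (m < ·) = t.toFinset := by
    ext j
    simp only [Finset.mem_filter, Finsupp.mem_support_iff, Multiset.mem_toFinset]
    constructor
    · rintro ⟨h1, h2⟩
      rw [h j h2] at h1
      exact Multiset.count_ne_zero.1 h1
    · intro hj
      refine ⟨?_, ht j hj⟩
      rw [h j (ht j hj)]
      exact Multiset.count_ne_zero.2 hj
  rw [tailMs, hs, Multiset.toFinset_val]
  refine Multiset.map_congr rfl fun j hj => h j (ht j (Multiset.mem_dedup.1 hj))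

/-- The almost symmetric monomial `m_{λ|μ}` is the orbit sum of `λ μ`. -/
theorem asMonomialSeq_eq (a : AsIndex) :
    asMonomialSeq a = orbitSum a.comp.length (listExp (a.comp ++ a.part)) := by
  classical
  funext k
  rw [asMonomialSeq]
  set l := a.comp.length with hl
  have hhead : ∀ j ≤ l, listExp (a.comp ++ a.part) j = listExp a.comp j :=
    fun j hj => listExp_append_left hj
  split_ifs with hk
  · let f : Fin (k - l) → ℕ := fun j => l + j.val + 1
    have hf : Function.Injective f := fun i j h => by
      simp only [f] at h
      exact Fin.ext (by omega)
    rw [symMonomial_eq_sum, compMonomial_eq, Finset.mul_sum]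
    have hterm : ∀ s : Multiset (Fin (k - l)), monomial (listExp a.comp) (1 : K) *
        (s.map (fun j => (X (l + j.val + 1) : Poly))).prod =
        monomial (listExp a.comp + Multiset.toFinsupp (s.map f)) 1 := by
      intro s
      have := prod_X_eq_monomial (s.map f)
      rw [Multiset.map_map] at this
      rw [← one_mul (1 : K), ← monomial_mul, ← this, one_mul]
      rfl
    have hparts : ∀ s : Multiset (Fin (k - l)),
        (s.map f).dedup.map (s.map f).count = s.dedup.map s.count := by
      intro s
      rw [Multiset.dedup_map_of_injective hf, Multiset.map_map]
      refine Multiset.map_congr rfl fun j _ => ?_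
      rw [Function.comp_apply, Multiset.count_map_eq_count' f s hf]
    have hrange : ∀ (s : Multiset (Fin (k - l))), ∀ j ∈ s.map f, l < j ∧ j ≤ k := by
      intro s j hj
      obtain ⟨i, -, rfl⟩ := Multiset.mem_map.1 hj
      have := i.2
      simp only [f]
      omega
    have htail : ∀ s : Multiset (Fin (k - l)),
        tailMs l (listExp a.comp + Multiset.toFinsupp (s.map f)) = s.dedup.map s.count := by
      intro s
      rw [tailMs_eq_count l _ (s.map f) (fun j hj => ?_) fun j hj => (hrange s j hj).1, hparts]
      have : listExp a.comp j = 0 := by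
        by_contra h
        have := (listExp_inRange a.comp j h).2
        omega
      simp [this, Multiset.toFinsupp_apply]
    have hzero : ∀ (s : Multiset (Fin (k - l))) j, ¬ (l < j ∧ j ≤ k) →
        Multiset.toFinsupp (s.map f) j = 0 := by
      intro s j hj
      rw [Multiset.toFinsupp_apply]
      exact Multiset.count_eq_zero.2 fun h => hj (hrange s j h)
    ext e
    rw [coeff_orbitSum, Finset.sum_congr rfl fun s _ => hterm s.1.1, coeff_sum]
    simp only [coeff_monomial]
    by_cases hex : ∃ s : {s : Sym (Fin (k - l)) a.part.sum // .ofSym s = a.toPartition},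
        listExp a.comp + Multiset.toFinsupp (s.1.1.map f) = e
    · obtain ⟨s, hs⟩ := hex
      rw [Finset.sum_eq_single s, if_pos hs, if_pos]
      · subst hs
        refine ⟨fun j hj => ?_, fun j hj => ?_, ?_⟩
        · rw [Finsupp.add_apply] at hj
          by_cases h1 : listExp a.comp j = 0
          · have := not_not.1 (mt (hzero s.1.1 j) (fun h => hj (by rw [h1, h])))
            omega
          · have := listExp_inRange a.comp j h1
            omega
        · rw [Finsupp.add_apply, hzero _ _ (by omega), add_zero, hhead j hj]
        · rw [htail, tailMs_listExp a.comp a.pos]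
          exact congrArg Nat.Partition.parts s.2
      · intro s' _ hne
        rw [if_neg]
        intro hs'
        apply hne
        rw [← hs, add_right_inj, EmbeddingLike.apply_eq_iff_eq] at hs'
        exact Subtype.ext (Subtype.ext (Multiset.map_injective hf hs'))
      · intro h; exact absurd (Finset.mem_univ _) h
    · rw [Finset.sum_eq_zero, if_neg]
      · rintro ⟨hr, hrel⟩
        apply hex
        obtain ⟨t, ht⟩ : ∃ t : Multiset ℕ, t = Finsupp.toMultiset (e.filter (l < ·)) := ⟨_, rfl⟩
        have hcount : ∀ j, t.count j = if l < j then e j else 0 := by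
          intro j
          rw [ht, Finsupp.count_toMultiset, Finsupp.filter_apply]
        have hmem : ∀ j ∈ t, l < j ∧ j ≤ k := by
          intro j hj
          have h1 := Multiset.count_ne_zero.2 hj
          rw [hcount] at h1
          split_ifs at h1 with h2
          · exact ⟨h2, (hr j h1).2⟩
          · exact absurd rfl h1
        obtain ⟨s, hs⟩ : ∃ s : Multiset (Fin (k - l)), s.map f = t := by
          clear ht hcount
          induction t using Multiset.induction with
          | empty => exact ⟨0, rfl⟩
          | cons x t ih =>
            obtain ⟨s, rfl⟩ := ih fun j hj => hmem j (Multiset.mem_cons_of_mem hj)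
            have hx := hmem x (Multiset.mem_cons_self _ _)
            refine ⟨⟨x - l - 1, by omega⟩ ::ₘ s, ?_⟩
            rw [Multiset.map_cons]
            congr 1
            simp only [f]
            omega
        have hparts' : s.dedup.map s.count = (a.part : Multiset ℕ) := by
          rw [← hparts, hs, ← tailMs_eq_count l e t (fun j hj => by rw [hcount, if_pos hj])
            fun j hj => (hmem j hj).1, hrel.2, tailMs_listExp a.comp a.pos]
        have hcard : Multiset.card s = a.part.sum := by
          rw [← Multiset.toFinset_sum_count_eq, ← Multiset.sum_coe, ← hparts']
          rfl
        refine ⟨⟨⟨s, hcard⟩, ?_⟩, ?_⟩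
        · exact Nat.Partition.ext hparts'
        · ext j
          rw [Finsupp.add_apply, Multiset.toFinsupp_apply]
          change _ + (s.map f).count j = e j
          rw [hs, hcount]
          split_ifs with h
          · have : listExp a.comp j = 0 := by
              by_contra h'
              have := (listExp_inRange a.comp j h').2
              omega
            omega
          · rw [add_zero, hrel.1 j (by omega), hhead j (by omega)]
      · intro s _
        rw [if_neg fun h => hex ⟨s, h⟩]
  · ext e
    rw [coeff_orbitSum, if_neg, coeff_zero]
    rintro ⟨hr, hrel⟩
    -- the last part of the composition is nonzero
    have hne : a.comp ≠ [] := by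
      intro h
      rw [h] at hl
      exact hk (hl.trans_le (Nat.zero_le _))
    have hpos : 0 < l := List.length_pos_of_ne_nil hne
    have h1 := a.strict hne
    rw [List.getLast_eq_getElem] at h1
    have h2 : e l ≠ 0 := by
      rw [hrel.1 l le_rfl, hhead l le_rfl, listExp_apply, if_neg hpos.ne',
        List.getD_eq_getElem _ _ (by omega)]
      exact h1
    exact hk (hr l h2).2

/-! ### Expansion of orbit sums in almost symmetric monomials -/

theorem tailMs_congr {m : ℕ} {e e' : ℕ →₀ ℕ} (h : ∀ j, m < j → e j = e' j) :
    tailMs m e = tailMs m e' := by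
  have hs : e.support.filter (m < ·) = e'.support.filter (m < ·) := by
    ext j
    simp only [Finset.mem_filter, Finsupp.mem_support_iff]
    refine and_congr_left fun hj => ?_
    rw [h j hj]
  rw [tailMs, tailMs, hs]
  exact Multiset.map_congr rfl fun j hj => h j (Finset.mem_filter.1 hj).2

theorem tailMs_eq_cons {m p : ℕ} {e : ℕ →₀ ℕ} (hp : m < p) (h : e p ≠ 0) :
    tailMs m e = e p ::ₘ tailMs m (e.erase p) := by
  have hs : e.support.filter (m < ·) = Finset.cons p ((e.erase p).support.filter (m < ·))
      (by simp) := by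
    ext j
    simp only [Finset.mem_filter, Finsupp.mem_support_iff, Finset.mem_cons]
    by_cases hj : j = p
    · subst hj; simp [h, hp]
    · simp [hj, Finsupp.erase_ne hj]
  rw [tailMs, hs, Finset.cons_val, Multiset.map_cons, tailMs]
  congr 1
  refine Multiset.map_congr rfl fun j hj => ?_
  rw [Finsupp.erase_ne]
  rintro rfl
  have := (Finset.mem_filter.1 (show j ∈ Finset.filter _ _ from hj)).1
  simp at this

theorem tailMs_of_eq_zero {m : ℕ} {e : ℕ →₀ ℕ} (h : e (m + 1) = 0) :
    tailMs m e = tailMs (m + 1) e := by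
  have hs : e.support.filter (m < ·) = e.support.filter (m + 1 < ·) := by
    refine Finset.filter_congr fun j hj => ?_
    have : j ≠ m + 1 := by rintro rfl; exact Finsupp.mem_support_iff.1 hj h
    omega
  rw [tailMs, tailMs, hs]

theorem tailMs_of_ne_zero {m : ℕ} {e : ℕ →₀ ℕ} (h : e (m + 1) ≠ 0) :
    tailMs m e = e (m + 1) ::ₘ tailMs (m + 1) e := by
  rw [tailMs_eq_cons (Nat.lt_succ_self m) h,
    tailMs_of_eq_zero (e := e.erase (m + 1)) (by simp)]
  congr 1
  exact tailMs_congr fun j hj => Finsupp.erase_ne (by omega)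

theorem TailRel.orbitSum_eq {m : ℕ} {e e' : ℕ →₀ ℕ} (h : TailRel m e e') :
    orbitSum m e = orbitSum m e' := by
  classical
  funext k
  ext e''
  rw [coeff_orbitSum, coeff_orbitSum]
  exact if_congr (and_congr_right fun _ => ⟨fun h' => h'.trans h, fun h' => h'.trans h.symm⟩)
    rfl rfl

/-- The list `λ 0^{m - ℓ(λ)} μ`. -/
def AsIndex.padded (a : AsIndex) (m : ℕ) : List ℕ :=
  a.comp ++ List.replicate (m - a.comp.length) 0 ++ a.part

/-- An exponent with sorted tail beyond `m` is of the form `λ μ` with `ℓ(λ) = m`, if its entry at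
`m` is nonzero. -/
theorem exists_asIndex {m : ℕ} {e : ℕ →₀ ℕ} (h0 : e 0 = 0) (hs : TailSorted m e)
    (hm : m = 0 ∨ e m ≠ 0) :
    ∃ a : AsIndex, a.comp.length = m ∧ listExp (a.comp ++ a.part) = e := by
  obtain ⟨N, hN⟩ : ∃ N, N = ((tailMs m e).filter (1 ≤ ·)).card := ⟨_, rfl⟩
  have hpos : ∀ j, m < j → (1 ≤ e j ↔ j ≤ m + N) := fun j hj => by
    rw [hN]; exact hs.le_iff one_pos hj
  have hlen : ((List.range m).map fun j => e (j + 1)).length = m := by simp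
  refine ⟨⟨(List.range m).map fun j => e (j + 1), ?_,
    (List.range N).map fun j => e (m + j + 1), ?_, ?_⟩, hlen, ?_⟩
  · intro h
    rw [List.getLast_eq_getElem]
    have : m ≠ 0 := by rintro rfl; simp at h
    have e1 : m - 1 + 1 = m := by omega
    simpa [e1] using hm.resolve_left this
  · rw [List.pairwise_map]
    refine List.Pairwise.imp_of_mem ?_ List.pairwise_lt_range
    intro i j _ _ hij
    have hij' : i + 1 ≤ j := hij
    clear hij
    induction j, hij' using Nat.le_induction with
    | base => exact hs (m + i + 1) (by omega)
    | succ j hj ih =>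
      exact (hs (m + j + 1) (by omega)).trans (ih (List.mem_range.2 (by
        have := List.mem_range.1 ‹j + 1 ∈ List.range N›
        omega)))
  · intro x hx
    obtain ⟨j, hj, rfl⟩ := List.mem_map.1 hx
    have := (hpos (m + j + 1) (by omega)).2 (by have := List.mem_range.1 hj; omega)
    omega
  · ext j
    rcases Nat.eq_zero_or_pos j with rfl | hj
    · rw [listExp_zero, h0]
    · obtain ⟨j, rfl⟩ : ∃ i, j = i + 1 := ⟨j - 1, by omega⟩
      rcases lt_or_ge j m with h | h
      · rw [listExp_append_left (by rw [hlen]; omega), listExp_succ,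
          List.getD_eq_getElem _ _ (by rw [hlen]; exact h)]
        simp
      · obtain ⟨i, rfl⟩ := Nat.exists_eq_add_of_le h
        have := listExp_append_right (l := (List.range m).map fun j => e (j + 1))
          (l' := (List.range N).map fun j => e (m + j + 1)) i
        rw [hlen] at this
        rw [this]
        rcases lt_or_ge i N with h | h
        · rw [List.getD_eq_getElem _ _ (by simpa using h)]
          simp
        · rw [List.getD_eq_default _ _ (by simpa using h)]
          have := (hpos (m + i + 1) (by omega)).not.2 (by omega)
          omega

/-- The exponent `e`, restricted to the variables `x_1, …, x_k`, as a weight. -/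
def expWeight (k : ℕ) (e : ℕ →₀ ℕ) : Fin k → ℤ := fun j => e (j.val + 1)

theorem affineReflection_expWeight {k : ℕ} {a b : Fin k} (hab : a ≠ b) {e e' : ℕ →₀ ℕ} {n : ℤ}
    (h : ∀ j, j ≠ a.val + 1 → j ≠ b.val + 1 → e' j = e j)
    (ha : (e' (a.val + 1) : ℤ) = e (b.val + 1) - n)
    (hb : (e' (b.val + 1) : ℤ) = e (a.val + 1) + n) :
    affineReflection a b n (expWeight k e) = expWeight k e' := by
  funext j
  rw [affineReflection_apply hab]
  simp only [expWeight]
  split_ifs with h1 h2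
  · rw [h1, ha]
  · rw [h2, hb]
  · rw [h (j.val + 1)]
    · simpa [Fin.ext_iff] using h1
    · simpa [Fin.ext_iff] using h2

theorem SortStep.exists_simple {m k : ℕ} {e e' : ℕ →₀ ℕ} (h : SortStep m e e') (he : InRange k e) :
    ∃ c d : Fin k, IsSimpleRoot c d 0 ∧ c ≠ d ∧ m < c.val + 1 ∧ d.val = c.val + 1 ∧
      affineRoot c d 0 (expWeight k e) < 0 ∧
      affineReflection c d 0 (expWeight k e) = expWeight k e' := by
  obtain ⟨j, hj, hlt, rfl⟩ := h
  have hk := (he (j + 1) (by omega)).2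
  have e1 : j - 1 + 1 = j := by omega
  have hne : (⟨j - 1, by omega⟩ : Fin k) ≠ ⟨j, by omega⟩ := by
    intro h
    have := Fin.ext_iff.1 h
    simp only at this
    omega
  refine ⟨⟨j - 1, by omega⟩, ⟨j, by omega⟩, Or.inl ⟨e1, rfl⟩, hne, by simp only; omega, e1.symm, ?_,
    affineReflection_expWeight hne (fun n h1 h2 => ?_) ?_ ?_⟩
  · simp only [affineRoot, expWeight, e1]
    omega
  · simp only [e1] at h1 h2
    exact swapExp_of_ne e h1 h2
  · simp only [e1, swapExp_left]
    omega
  · simp only [e1, swapExp_right]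
    omega

/-- Sorting the tail of an exponent moves it down. -/
theorem WeightLE.of_sortSteps {m k : ℕ} {e e' : ℕ →₀ ℕ} (he : InRange k e)
    (h : Relation.ReflTransGen (SortStep m) e e') :
    WeightLE (expWeight k e') (expWeight k e) := by
  induction h with
  | refl => exact .refl
  | tail h1 hst ih =>
    obtain ⟨c, d, hs, hcd, -, -, hneg, heq⟩ := hst.exists_simple (he.sortSteps h1)
    refine .head ⟨c, d, 0, hs.isPosTriple hcd, ?_, ?_⟩ ih
    · rw [← heq, affineRoot_affineReflection_self hcd]; omega
    · rw [← heq, affineReflection_affineReflection]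

/-- A weight with sorted tail that lies below a given one lies below its rearrangement with
sorted tail. -/
theorem WeightLE.trans_sortSteps {m k : ℕ} {e e' f : ℕ →₀ ℕ} (he : InRange k e)
    (hf : TailSorted m f) (h : Relation.ReflTransGen (SortStep m) e e')
    (hle : WeightLE (expWeight k f) (expWeight k e)) :
    WeightLE (expWeight k f) (expWeight k e') := by
  induction h with
  | refl => exact hle
  | tail h1 hst ih =>
    obtain ⟨c, d, hs, hcd, hm, hd, hneg, heq⟩ := hst.exists_simple (he.sortSteps h1)
    rw [← heq]
    refine ih.le_simple hs hcd ?_ hneg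
    have := hf (c.val + 1) hm
    simp only [affineRoot, expWeight, hd]
    omega

/-- The sum of the squares of the entries. -/
noncomputable def sqSum (e : ℕ →₀ ℕ) : ℕ := e.sum fun _ v => v ^ 2

/-- The sum of the entries `e_j`, `j ≤ m`, with weights that decrease with `j`. -/
noncomputable def headSum (m : ℕ) (e : ℕ →₀ ℕ) : ℕ := e.sum fun j v => (m + 1 - j) * v

/-- An order on exponents that makes the expansions below strictly triangular: the sum of squares
drops, or it stays the same and the weighted sum of the first `m` entries grows. -/
def HeadBelow (m : ℕ) (f e : ℕ →₀ ℕ) : Prop :=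
  sqSum f < sqSum e ∨ sqSum f = sqSum e ∧ headSum m e < headSum m f

theorem HeadBelow.trans {m : ℕ} {f e d : ℕ →₀ ℕ} (h : HeadBelow m f e) (h' : HeadBelow m e d) :
    HeadBelow m f d := by
  unfold HeadBelow at *
  omega

theorem HeadBelow.ne {m : ℕ} {f e : ℕ →₀ ℕ} (h : HeadBelow m f e) : f ≠ e := by
  rintro rfl
  unfold HeadBelow at h
  omega

theorem headSum_congr {m : ℕ} {e e' : ℕ →₀ ℕ} (h : ∀ j ≤ m, e j = e' j) :
    headSum m e = headSum m e' := by
  have key : ∀ e : ℕ →₀ ℕ, headSum m e = ∑ j ∈ Finset.range (m + 1), (m + 1 - j) * e j := by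
    intro e
    rw [headSum, Finsupp.sum]
    refine Finset.sum_congr_of_eq_on_inter ?_ ?_ ?_
    · intro j _ hj
      rw [Finset.mem_range, not_lt] at hj
      rw [Nat.sub_eq_zero_of_le hj, zero_mul]
    · intro j _ hj
      rw [Finsupp.notMem_support_iff.1 hj, mul_zero]
    · intro j _ _; rfl
  rw [key, key]
  refine Finset.sum_congr rfl fun j hj => ?_
  rw [h j (by rw [Finset.mem_range] at hj; omega)]

theorem TailRel.headBelow_iff {m : ℕ} {e e' f : ℕ →₀ ℕ} (h : TailRel m e e') :
    HeadBelow m f e ↔ HeadBelow m f e' := by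
  have h1 : sqSum e = sqSum e' := h.sum_eq (fun v => v ^ 2) rfl
  rw [HeadBelow, HeadBelow, h1, headSum_congr h.1]

theorem TailRel.headBelow_iff_left {m : ℕ} {e e' f : ℕ →₀ ℕ} (h : TailRel m e e') :
    HeadBelow m e f ↔ HeadBelow m e' f := by
  have h1 : sqSum e = sqSum e' := h.sum_eq (fun v => v ^ 2) rfl
  rw [HeadBelow, HeadBelow, h1, headSum_congr h.1]

theorem tailSorted_padded (a : AsIndex) {m : ℕ} (h : a.comp.length ≤ m) :
    TailSorted m (listExp (a.padded m)) := by
  have hlen : (a.comp ++ List.replicate (m - a.comp.length) 0).length = m := by simp; omega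
  intro j hj
  obtain ⟨i, rfl⟩ := Nat.exists_eq_add_of_lt hj
  have key : ∀ i, listExp (a.padded m) (m + i + 1) = a.part.getD i 0 := fun i => by
    have := listExp_append_right (l := a.comp ++ List.replicate (m - a.comp.length) 0)
      (l' := a.part) i
    rwa [hlen] at this
  rw [key, show m + i + 1 + 1 = m + (i + 1) + 1 by ring, key]
  rcases lt_or_ge (i + 1) a.part.length with hi | hi
  · rw [List.getD_eq_getElem _ _ hi, List.getD_eq_getElem _ _ (by omega)]
    exact List.pairwise_iff_getElem.1 a.sorted _ _ _ _ (Nat.lt_succ_self i)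
  · rw [List.getD_eq_default _ _ hi]
    exact Nat.zero_le _

theorem tailMs_padded (a : AsIndex) {m : ℕ} (h : a.comp.length ≤ m) :
    tailMs m (listExp (a.padded m)) = (a.part : Multiset ℕ) := by
  have hlen : (a.comp ++ List.replicate (m - a.comp.length) 0).length = m := by simp; omega
  have := tailMs_listExp (a.comp ++ List.replicate (m - a.comp.length) 0) a.pos
  rwa [hlen] at this

theorem listExp_padded_of_le (a : AsIndex) {m j : ℕ} (h : a.comp.length ≤ m) (hj : j ≤ m) :
    listExp (a.padded m) j = listExp a.comp j := by
  have hlen : (a.comp ++ List.replicate (m - a.comp.length) 0).length = m := by simp; omega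
  rw [AsIndex.padded, listExp_append_left (by omega), listExp_apply, listExp_apply]
  split_ifs
  · rfl
  · rcases lt_or_ge (j - 1) a.comp.length with h1 | h1
    · rw [List.getD_append _ _ _ _ h1]
    · rw [List.getD_append_right _ _ _ _ h1, List.getD_eq_default _ _ h1,
        List.getD_eq_getElem _ _ (by rw [List.length_replicate]; omega), List.getElem_replicate]

/-- If `λ μ`, with `ℓ(λ) = n`, is obtained from `e` by dropping zero entries between `n` and `m`,
then `λ 0⋯0 μ` agrees with `e` up to a permutation of the tail. -/
theorem tailRel_padded {a : AsIndex} {m n : ℕ} {e' e : ℕ →₀ ℕ} (hlen : a.comp.length = n)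
    (hn : n ≤ m) (ha : listExp (a.comp ++ a.part) = e')
    (hhead : ∀ j ≤ n, e j = e' j) (hzero : ∀ j, n < j → j ≤ m → e j = 0)
    (htail : tailMs m e = tailMs n e') : TailRel m (listExp (a.padded m)) e := by
  refine ⟨fun j hj => ?_, ?_⟩
  · rw [listExp_padded_of_le a (hlen ▸ hn) hj]
    rcases le_or_gt j n with h | h
    · rw [hhead j h, ← ha, listExp_append_left (by omega)]
    · rw [hzero j h hj]
      by_contra h'
      have := (listExp_inRange a.comp j h').2
      omega
  · rw [tailMs_padded a (hlen ▸ hn), htail, ← ha, ← hlen, tailMs_listExp _ a.pos]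

/-- An orbit sum for an exponent with sorted tail is a combination of almost symmetric monomials
`m_{λ|μ}` such that `λ 0⋯0 μ` lies below the exponent. If `e_m = 0`, the sum over permutations of
the entries beyond `m - 1` differs from the one over permutations of the entries beyond `m` by
sums with a nonzero entry at the position `m`. -/
theorem orbitSum_mem_span {m k : ℕ} {e : ℕ →₀ ℕ} (he : InRange k e) (hs : TailSorted m e) :
    orbitSum m e ∈ Submodule.span K (asMonomialSeq '' {a : AsIndex | a.comp.length ≤ m ∧
      InRange k (listExp (a.padded m)) ∧
      WeightLE (expWeight k (listExp (a.padded m))) (expWeight k e) ∧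
      (listExp (a.padded m) = e ∨ HeadBelow m (listExp (a.padded m)) e)}) := by
  have he0 : e 0 = 0 := by
    by_contra h
    have := (he 0 h).1
    omega
  suffices H : ∀ n ≤ m, (∀ j, n < j → j ≤ m → e j = 0) → orbitSum n e ∈ Submodule.span K
      (asMonomialSeq '' {a : AsIndex | a.comp.length ≤ m ∧ InRange k (listExp (a.padded m)) ∧
      WeightLE (expWeight k (listExp (a.padded m))) (expWeight k e) ∧
      (listExp (a.padded m) = e ∨ HeadBelow m (listExp (a.padded m)) e)}) from
    H m le_rfl fun j h h' => by omega
  intro n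
  induction n with
  | zero =>
    intro hn hz
    obtain ⟨e', hst, hs'⟩ := exists_tailSorted 0 e
    have hrel := TailRel.of_sortSteps hst
    obtain ⟨a, hlen, ha⟩ := exists_asIndex (by rw [hrel.1 0 le_rfl, he0]) hs' (Or.inl rfl)
    have htail : ∀ j ≤ m, tailMs 0 e = tailMs j e := by
      intro j
      induction j with
      | zero => intro _; rfl
      | succ j ih => intro hj; rw [ih (by omega), tailMs_of_eq_zero (hz (j + 1) (by omega) hj)]
    have h1 : listExp (a.padded m) = e :=
      (tailSorted_padded a (by omega)).eq_of_tailRel hs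
        (tailRel_padded hlen hn ha (fun j hj => (hrel.1 j hj).symm) hz
          ((htail m le_rfl).symm.trans hrel.2.symm))
    refine Submodule.subset_span ⟨a, ⟨by omega, by rw [h1]; exact he, by rw [h1]; exact .refl,
      Or.inl h1⟩, ?_⟩
    rw [asMonomialSeq_eq, ha, hlen, hrel.orbitSum_eq]
  | succ n ih =>
    intro hn hz
    have htail : ∀ i, n + 1 + i ≤ m → tailMs (n + 1) e = tailMs (n + 1 + i) e := by
      intro i
      induction i with
      | zero => intro _; rfl
      | succ i ih =>
        intro hi
        rw [ih (by omega), tailMs_of_eq_zero (hz (n + 1 + i + 1) (by omega) (by omega))]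
        rfl
    have htail' : tailMs (n + 1) e = tailMs m e := by
      have := htail (m - (n + 1)) (by omega)
      rwa [Nat.add_sub_cancel' hn] at this
    by_cases hen : e (n + 1) = 0
    · have hF : orbitSum n e - orbitSum (n + 1) e ∈ symPast (n + 1) :=
        sub_mem (symPast_mono (Nat.le_succ n) (orbitSum_mem n e)) (orbitSum_mem _ e)
      rw [← sub_sub_cancel (orbitSum n e) (orbitSum (n + 1) e)]
      refine sub_mem (ih (by omega) fun j hj hj' => ?_)
        (Submodule.span_le.2 ?_ (symPast.mem_span hF))
      · rcases Nat.eq_or_lt_of_le (Nat.succ_le_of_lt hj) with rfl | h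
        · exact hen
        · exact hz j h hj'
      · classical
        rintro _ ⟨e', ⟨hs', r, hr⟩, rfl⟩
        rw [Pi.sub_apply, coeff_sub, coeff_orbitSum, coeff_orbitSum] at hr
        have hup : TailRel (n + 1) e' e → TailRel n e' e := fun h =>
          ⟨fun j hj => h.1 j (by omega), by
            rw [tailMs_of_eq_zero (e := e') (by rw [h.1 _ le_rfl, hen]), tailMs_of_eq_zero hen,
              h.2]⟩
        have hrel : TailRel n e' e ∧ ¬ TailRel (n + 1) e' e := by
          by_cases h1 : TailRel (n + 1) e' e
          · simp [h1, hup h1] at hr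
          · refine ⟨?_, h1⟩
            by_contra h2
            simp [h1, h2] at hr
        obtain ⟨hrel, hnrel⟩ := hrel
        have hne : e' (n + 1) ≠ 0 := by
          intro h
          refine hnrel ⟨fun j hj => ?_, ?_⟩
          · rcases Nat.eq_or_lt_of_le hj with rfl | h'
            · rw [h, hen]
            · exact hrel.1 j (by omega)
          · rw [← tailMs_of_eq_zero h, hrel.2, tailMs_of_eq_zero hen]
        obtain ⟨a, hlen, ha⟩ := exists_asIndex (by rw [hrel.1 0 (Nat.zero_le _), he0]) hs'
          (Or.inr hne)
        -- the entry `e'_{n+1}` occurs in `e` at a position `p > m`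
        have hmem : e' (n + 1) ∈ tailMs m e := by
          rw [← htail', ← tailMs_of_eq_zero hen, ← hrel.2, tailMs_of_ne_zero hne]
          exact Multiset.mem_cons_self _ _
        obtain ⟨p, hp, hpe⟩ := Multiset.mem_map.1 hmem
        obtain ⟨hp1, hp2⟩ := Finset.mem_filter.1 hp
        rw [Finsupp.mem_support_iff] at hp1
        -- moving this entry to the position `n + 1` is a step down
        let g : ℕ →₀ ℕ := (e.erase p).update (n + 1) (e p)
        have hg1 : g (n + 1) = e p := by simp [g]
        have hg2 : g p = 0 := by
          simp only [g]
          rw [Finsupp.update_apply, if_neg (by omega), Finsupp.erase_same]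
        have hg3 : ∀ j, j ≠ n + 1 → j ≠ p → g j = e j := by
          intro j h1 h2
          simp only [g]
          rw [Finsupp.update_apply, if_neg h1, Finsupp.erase_ne h2]
        have hgr : InRange k g := by
          intro j hj
          have := he p hp1
          by_cases h1 : j = n + 1
          · omega
          · by_cases h2 : j = p
            · omega
            · rw [hg3 j h1 h2] at hj
              exact he j hj
        have hgrel : TailRel m (listExp (a.padded m)) g := by
          refine tailRel_padded hlen hn ha (fun j hj => ?_) (fun j hj hj' => ?_) ?_
          · rcases Nat.eq_or_lt_of_le hj with rfl | h'
            · rw [hg1, hpe]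
            · rw [hg3 j (by omega) (by omega), hrel.1 j (by omega)]
          · rw [hg3 j (by omega) (by omega), hz j hj hj']
          · have h1 : tailMs m g = tailMs m (e.erase p) := by
              refine tailMs_congr fun j hj => ?_
              simp only [g]
              rw [Finsupp.update_apply, if_neg (by omega)]
            have h2 := tailMs_eq_cons hp2 hp1
            rw [← htail', ← tailMs_of_eq_zero hen, ← hrel.2, tailMs_of_ne_zero hne, hpe,
              Multiset.cons_inj_right] at h2
            rw [h1, h2]
        obtain ⟨g', hst, hgs⟩ := exists_tailSorted m g
        have hg' : listExp (a.padded m) = g' :=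
          (tailSorted_padded a (by omega)).eq_of_tailRel hgs
            (hgrel.trans (TailRel.of_sortSteps hst).symm)
        have hpk := (he p hp1).2
        have hne' : (⟨n, by omega⟩ : Fin k) ≠ ⟨p - 1, by omega⟩ := by
          intro h
          have := Fin.ext_iff.1 h
          simp only at this
          omega
        have ep : p - 1 + 1 = p := by omega
        have hstep : WeightStep (expWeight k g) (expWeight k e) := by
          refine ⟨_, _, 0, ⟨hne', Or.inr ⟨rfl, Fin.lt_def.2 (by simp only; omega)⟩⟩, ?_,
            (affineReflection_expWeight hne' (fun j h1 h2 => ?_) ?_ ?_).symm⟩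
          · simp only [affineRoot, expWeight, ep, hg1, hg2]
            omega
          · simp only [ep] at h1 h2
            exact (hg3 j h1 h2).symm
          · simp only [ep, hg2, hen]
            simp
          · simp only [ep, hg1]
            simp
        refine Submodule.subset_span ⟨a, ⟨by omega, ?_, ?_, Or.inr ?_⟩, ?_⟩
        · rw [hg']; exact hgr.sortSteps hst
        · rw [hg']; exact (WeightLE.of_sortSteps hgr hst).tail hstep
        · rw [hgrel.headBelow_iff_left]
          obtain ⟨r, h1, h2⟩ := exists_sum_eq_of_agree (by omega : n + 1 ≠ p) hg3
            (fun _ v => v ^ 2) (by simp)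
          obtain ⟨r', h3, h4⟩ := exists_sum_eq_of_agree (by omega : n + 1 ≠ p) hg3
            (fun j v => (m + 1 - j) * v) (by simp)
          refine Or.inr ⟨?_, ?_⟩
          · rw [sqSum, sqSum, h1, h2, hg1, hg2, hen]
            ring
          · rw [headSum, headSum, h3, h4, hg1, hg2, hen]
            have h5 : m + 1 - p = 0 := by omega
            have h6 : 0 < (m + 1 - (n + 1)) * e p := Nat.mul_pos (by omega) (by omega)
            rw [h5]
            omega
        · rw [asMonomialSeq_eq, ha, hlen]
    · obtain ⟨e', hst, hs'⟩ := exists_tailSorted (n + 1) e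
      have hrel := TailRel.of_sortSteps hst
      obtain ⟨a, hlen, ha⟩ := exists_asIndex (by rw [hrel.1 0 (Nat.zero_le _), he0]) hs'
        (Or.inr (by rw [hrel.1 _ le_rfl]; exact hen))
      have h1 : listExp (a.padded m) = e :=
        (tailSorted_padded a (by omega)).eq_of_tailRel hs
          (tailRel_padded hlen hn ha (fun j hj => (hrel.1 j hj).symm) hz
            (htail'.symm.trans hrel.2.symm))
      refine Submodule.subset_span ⟨a, ⟨by omega, by rw [h1]; exact he, by rw [h1]; exact .refl,
        Or.inl h1⟩, ?_⟩
      rw [asMonomialSeq_eq, ha, hlen, hrel.orbitSum_eq]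

/-! ### Triangularity of the Demazure-Lusztig operators -/

/-- The polynomials that only involve monomials with exponents in `S`. -/
def suppIn (S : Set (ℕ →₀ ℕ)) : Submodule K Poly where
  carrier := {p | ∀ e, coeff e p ≠ 0 → e ∈ S}
  add_mem' := by
    intro p q hp hq e he
    by_contra h
    have h1 : coeff e p = 0 := by by_contra h'; exact h (hp e h')
    have h2 : coeff e q = 0 := by by_contra h'; exact h (hq e h')
    exact he (by rw [coeff_add, h1, h2, add_zero])
  zero_mem' := fun e he => absurd (coeff_zero e) he
  smul_mem' c p hp e he := hp e fun h => he (by rw [coeff_smul, h, smul_zero])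

theorem monomial_mem_suppIn {S : Set (ℕ →₀ ℕ)} {e : ℕ →₀ ℕ} (h : e ∈ S) (c : K) :
    monomial e c ∈ suppIn S := by
  classical
  intro e' he'
  rw [coeff_monomial] at he'
  by_cases hee : e = e'
  · exact hee ▸ h
  · rw [if_neg hee] at he'
    exact absurd rfl he'

theorem suppIn_mono {S S' : Set (ℕ →₀ ℕ)} (h : S ⊆ S') : suppIn S ≤ suppIn S' :=
  fun _ hp e he => h (hp e he)

theorem map_mem_of_monomial {L : Module.End K Poly} {S : Set (ℕ →₀ ℕ)} {N : Submodule K Poly}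
    (h : ∀ e ∈ S, L (monomial e 1) ∈ N) {p : Poly} (hp : p ∈ suppIn S) : L p ∈ N := by
  rw [p.as_sum, map_sum]
  refine Submodule.sum_mem _ fun e he => ?_
  have h1 : monomial e (coeff e p) = coeff e p • (monomial e 1 : Poly) := by
    rw [smul_monomial, smul_eq_mul, mul_one]
  rw [h1, map_smul]
  exact Submodule.smul_mem _ _ (h e (hp e (mem_support_iff.1 he)))

/-- The operator `L` is triangular on monomials with respect to `P`, with diagonal entries `κ`. Only
monomials that do not involve the unused variable `x_0` are considered. -/
def IsTriangular (L : Module.End K Poly) (κ : (ℕ →₀ ℕ) → K)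
    (P : (ℕ →₀ ℕ) → (ℕ →₀ ℕ) → Prop) : Prop :=
  ∀ e, e 0 = 0 → L (monomial e 1) - κ e • monomial e 1 ∈ suppIn {e' | P e' e}

theorem IsTriangular.mono {L : Module.End K Poly} {κ : (ℕ →₀ ℕ) → K}
    {P P' : (ℕ →₀ ℕ) → (ℕ →₀ ℕ) → Prop} (h : IsTriangular L κ P)
    (hP : ∀ e e', P e' e → P' e' e) : IsTriangular L κ P' :=
  fun e he => suppIn_mono (fun e' he' => hP e e' he') (h e he)

theorem IsTriangular.mul {L L' : Module.End K Poly} {κ κ' : (ℕ →₀ ℕ) → K}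
    {P : (ℕ →₀ ℕ) → (ℕ →₀ ℕ) → Prop} (h : IsTriangular L κ P) (h' : IsTriangular L' κ' P)
    (hP : ∀ {e e' e''}, P e'' e' → P e' e → P e'' e) (hP0 : ∀ {e e'}, P e' e → e 0 = 0 → e' 0 = 0) :
    IsTriangular (L * L') (fun e => κ e * κ' e) P := by
  intro e he
  have h1 : L (L' (monomial e 1) - κ' e • monomial e 1) ∈ suppIn {e' | P e' e} := by
    refine map_mem_of_monomial (fun e' he' => ?_) (h' e he)
    rw [← sub_add_cancel (L (monomial e' 1)) (κ e' • monomial e' 1)]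
    exact add_mem (suppIn_mono (fun e'' h'' => hP h'' he') (h e' (hP0 he' he)))
      (Submodule.smul_mem _ _ (monomial_mem_suppIn he' 1))
  have h2 := Submodule.smul_mem _ (κ' e) (h e he)
  have h3 := add_mem h1 h2
  rw [map_sub, map_smul, smul_sub, sub_add_sub_cancel, smul_smul, mul_comm] at h3
  exact h3

theorem IsTriangular.smul {L : Module.End K Poly} {κ : (ℕ →₀ ℕ) → K}
    {P : (ℕ →₀ ℕ) → (ℕ →₀ ℕ) → Prop} (h : IsTriangular L κ P) (c : K) :
    IsTriangular (c • L) (fun e => c * κ e) P := by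
  intro e he
  have := Submodule.smul_mem _ c (h e he)
  rwa [smul_sub, smul_smul] at this

/-- The action of a permutation of the variables. -/
noncomputable def permVars (σ : Equiv.Perm ℕ) : Module.End K Poly :=
  (rename σ : Poly →ₐ[K] Poly).toLinearMap

theorem permVars_monomial (σ : Equiv.Perm ℕ) (e : ℕ →₀ ℕ) (c : K) :
    permVars σ (monomial e c) = monomial (e.equivMapDomain σ) c := by
  rw [permVars, AlgHom.toLinearMap_apply, rename_monomial, Finsupp.equivMapDomain_eq_mapDomain]

theorem permVars_mul (σ τ : Equiv.Perm ℕ) : permVars (σ * τ) = permVars σ * permVars τ := by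
  refine LinearMap.ext fun p => ?_
  simp only [permVars, Module.End.mul_apply, AlgHom.toLinearMap_apply, rename_rename]
  rfl

theorem permVars_one : permVars 1 = 1 := by
  refine LinearMap.ext fun p => ?_
  simp only [permVars, AlgHom.toLinearMap_apply]
  exact rename_id_apply p

theorem permVars_inv_mul (σ : Equiv.Perm ℕ) : permVars σ⁻¹ * permVars σ = 1 := by
  rw [← permVars_mul, inv_mul_cancel, permVars_one]

theorem permVars_mul_inv (σ : Equiv.Perm ℕ) : permVars σ * permVars σ⁻¹ = 1 := by
  rw [← permVars_mul, mul_inv_cancel, permVars_one]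

theorem IsTriangular.conj {L : Module.End K Poly} {κ : (ℕ →₀ ℕ) → K}
    {P : (ℕ →₀ ℕ) → (ℕ →₀ ℕ) → Prop} (h : IsTriangular L κ P) {σ : Equiv.Perm ℕ} (hσ : σ 0 = 0) :
    IsTriangular (permVars σ⁻¹ * L * permVars σ) (fun e => κ (e.equivMapDomain σ))
      (fun e' e => P (e'.equivMapDomain σ) (e.equivMapDomain σ)) := by
  intro e he
  have hσ' : σ.symm 0 = 0 := by rw [Equiv.symm_apply_eq, hσ]
  have hinv : ∀ e : ℕ →₀ ℕ, (e.equivMapDomain σ).equivMapDomain σ⁻¹ = e := by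
    intro e; ext n; exact congrArg e (σ.symm_apply_apply n)
  have hinv' : ∀ e : ℕ →₀ ℕ, (e.equivMapDomain σ⁻¹).equivMapDomain σ = e := by
    intro e; ext n; exact congrArg e (σ.apply_symm_apply n)
  have h1 := h (e.equivMapDomain σ) (by rw [Finsupp.equivMapDomain_apply, hσ', he])
  have h2 : permVars σ⁻¹ (L (monomial (e.equivMapDomain σ) 1) -
      κ (e.equivMapDomain σ) • monomial (e.equivMapDomain σ) 1) ∈
      suppIn {e' | P (e'.equivMapDomain σ) (e.equivMapDomain σ)} := by
    refine map_mem_of_monomial (fun e' he' => ?_) h1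
    rw [permVars_monomial]
    refine monomial_mem_suppIn ?_ 1
    change P _ _
    rwa [hinv']
  rw [map_sub, map_smul, permVars_monomial, hinv] at h2
  rwa [Module.End.mul_apply, Module.End.mul_apply, permVars_monomial]

/-- The exponents produced from `e` by a two-variable operator in `x_u`, `x_v`: the entries at `u`
and `v` move strictly towards each other, or they are exchanged, if `e_v < e_u`. -/
def Moves (u v : ℕ) (e' e : ℕ →₀ ℕ) : Prop :=
  (∀ n, n ≠ u → n ≠ v → e' n = e n) ∧
    ((e' u + e' v = e u + e v ∧ min (e u) (e v) < e' u ∧ min (e u) (e v) < e' v) ∨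
      (e v < e u ∧ e' u = e v ∧ e' v = e u))

theorem moves_equivMapDomain_iff (σ : Equiv.Perm ℕ) (u v : ℕ) (e' e : ℕ →₀ ℕ) :
    Moves u v (e'.equivMapDomain σ) (e.equivMapDomain σ) ↔ Moves (σ⁻¹ u) (σ⁻¹ v) e' e := by
  unfold Moves
  simp only [Finsupp.equivMapDomain_apply]
  refine and_congr ⟨fun h n h1 h2 => ?_, fun h n h1 h2 => ?_⟩ Iff.rfl
  · have := h (σ n) (fun h3 => h1 (by simp [← h3])) (fun h3 => h2 (by simp [← h3]))
    simpa using this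
  · refine h (σ.symm n) (fun h3 => h1 ?_) (fun h3 => h2 ?_)
    · exact σ.symm.injective h3
    · exact σ.symm.injective h3

/-- The exponent `e` with the entries at `j` and `j + 1` replaced by `x` and `y`. -/
noncomputable def pairExp (j : ℕ) (e : ℕ →₀ ℕ) (x y : ℕ) : ℕ →₀ ℕ :=
  (e.erase j).erase (j + 1) + (Finsupp.single j x + Finsupp.single (j + 1) y)

theorem pairExp_left (j : ℕ) (e : ℕ →₀ ℕ) (x y : ℕ) : pairExp j e x y j = x := by
  simp [pairExp]

theorem pairExp_right (j : ℕ) (e : ℕ →₀ ℕ) (x y : ℕ) : pairExp j e x y (j + 1) = y := by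
  simp [pairExp]

theorem pairExp_of_ne {j n : ℕ} (e : ℕ →₀ ℕ) (x y : ℕ) (h : n ≠ j) (h' : n ≠ j + 1) :
    pairExp j e x y n = e n := by
  simp [pairExp, Finsupp.erase_ne h, Finsupp.erase_ne h', Finsupp.single_eq_of_ne h,
    Finsupp.single_eq_of_ne h']

theorem monomial_pairExp (j : ℕ) (e : ℕ →₀ ℕ) (x y : ℕ) :
    (monomial (pairExp j e x y) 1 : Poly) =
      monomial ((e.erase j).erase (j + 1)) 1 * (X j ^ x * X (j + 1) ^ y) := by
  rw [X_pow_eq_monomial, X_pow_eq_monomial, monomial_mul, monomial_mul, one_mul, one_mul, pairExp]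

theorem eq_pairExp_self (j : ℕ) (e : ℕ →₀ ℕ) : e = pairExp j e (e j) (e (j + 1)) := by
  ext n
  by_cases h : n = j
  · subst h; rw [pairExp_left]
  · by_cases h' : n = j + 1
    · subst h'; rw [pairExp_right]
    · rw [pairExp_of_ne e _ _ h h']

theorem swapExp_eq_pairExp (j : ℕ) (e : ℕ →₀ ℕ) :
    swapExp j e = pairExp j e (e (j + 1)) (e j) := by
  ext n
  by_cases h : n = j
  · subst h; rw [pairExp_left, swapExp_left]
  · by_cases h' : n = j + 1
    · subst h'; rw [pairExp_right, swapExp_right]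
    · rw [pairExp_of_ne e _ _ h h', swapExp_of_ne e h h']

/-- The image of a monomial with `e_j ≥ e_{j+1}` under `x_{j+1} ∂_j` runs through the exponents in
which the pair of entries `(e_{j+1} + c, e_j - c)` replaces `(e_j, e_{j+1})`. -/
theorem X_mul_dividedDifference_monomial {j : ℕ} {e : ℕ →₀ ℕ} (h : e (j + 1) ≤ e j) :
    X (j + 1) * dividedDifference j (monomial e 1) =
      ∑ c ∈ Finset.range (e j - e (j + 1)),
        monomial (pairExp j e (e (j + 1) + c) (e j - c)) (1 : K) := by
  obtain ⟨d, hd⟩ := Nat.exists_eq_add_of_le h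
  have hdd : dividedDifference j (monomial e 1) = monomial ((e.erase j).erase (j + 1)) 1 *
      ((X j * X (j + 1)) ^ e (j + 1) *
        ∑ c ∈ Finset.range d, X j ^ c * X (j + 1) ^ (d - 1 - c)) := by
    apply mul_left_cancel₀ (X_sub_X_ne_zero j)
    have hm : (monomial e 1 : Poly) = monomial ((e.erase j).erase (j + 1)) 1 *
        (X j ^ e j * X (j + 1) ^ e (j + 1)) := by
      rw [← monomial_pairExp, ← eq_pairExp_self]
    rw [dividedDifference_spec, swapVars_monomial, swapExp_eq_pairExp, monomial_pairExp, hm, hd,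
      pow_add, pow_add, mul_pow]
    have := geom_sum₂_mul (X j : Poly) (X (j + 1)) d
    linear_combination (-monomial ((e.erase j).erase (j + 1)) 1 *
      (X j ^ e (j + 1) * X (j + 1) ^ e (j + 1))) * this
  rw [hdd, Finset.mul_sum, Finset.mul_sum, Finset.mul_sum]
  have hd' : e j - e (j + 1) = d := by omega
  rw [hd']
  refine Finset.sum_congr rfl fun c hc => ?_
  rw [Finset.mem_range] at hc
  rw [monomial_pairExp, mul_pow, pow_add]
  have h1 : e j - c = e (j + 1) + (d - 1 - c) + 1 := by omega
  rw [h1, pow_succ, pow_add]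
  ring

theorem dividedDifference_swapVars (j : ℕ) (f : Poly) :
    dividedDifference j (swapVars j f) = - dividedDifference j f := by
  apply mul_left_cancel₀ (X_sub_X_ne_zero j)
  have h := dividedDifference_spec j (swapVars j f)
  rw [swapVars_swapVars] at h
  linear_combination h + dividedDifference_spec j f

theorem demazureLusztig_apply (j : ℕ) (f : Poly) : demazureLusztig j f =
    swapVars j f + (1 - tpar) • (X j * dividedDifference j f) := rfl

theorem permVars_swap_apply (j : ℕ) (f : Poly) :
    permVars (Equiv.swap j (j + 1)) f = swapVars j f := rfl

theorem swap_mul_demazureLusztig_apply (j : ℕ) (f : Poly) :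
    (permVars (Equiv.swap j (j + 1)) * demazureLusztig j) f =
      f + (1 - tpar) • (X (j + 1) * dividedDifference j f) := by
  rw [Module.End.mul_apply, permVars_swap_apply, demazureLusztig_apply, map_add, map_smul, map_mul,
    swapVars_swapVars, swapVars_dividedDifference]
  simp [swapVars]

theorem swap_mul_inv_apply (j : ℕ) (f : Poly) :
    (permVars (Equiv.swap j (j + 1)) * (tpar • demazureLusztigInv j)) f =
      f + (1 - tpar) • (X (j + 1) * dividedDifference j f) + (tpar - 1) • swapVars j f := by
  rw [← swap_mul_demazureLusztig_apply, demazureLusztigInv, smul_smul,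
    mul_inv_cancel₀ tpar_ne_zero, one_smul, mul_add, LinearMap.add_apply]
  congr 1
  simp only [Module.End.mul_apply, LinearMap.smul_apply, Module.End.one_apply, map_smul,
    permVars_swap_apply]

/-- The operator `s_j T_j` is triangular. Exchanges occur only if `e_j > e_{j+1}`. -/
theorem isTriangular_swap_mul (j : ℕ) :
    IsTriangular (permVars (Equiv.swap j (j + 1)) * demazureLusztig j)
      (fun e => if e j < e (j + 1) then tpar else 1) (Moves j (j + 1)) := by
  intro e _
  beta_reduce
  rw [swap_mul_demazureLusztig_apply]
  rcases le_or_gt (e (j + 1)) (e j) with h | h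
  · rw [if_neg (not_lt.2 h), one_smul, add_sub_cancel_left, X_mul_dividedDifference_monomial h]
    refine Submodule.smul_mem _ _ (Submodule.sum_mem _ fun c hc => monomial_mem_suppIn ?_ 1)
    rw [Finset.mem_range] at hc
    refine ⟨fun n h1 h2 => pairExp_of_ne e _ _ h1 h2, ?_⟩
    rw [pairExp_left, pairExp_right]
    omega
  · rw [if_pos h]
    have hsw : (monomial e 1 : Poly) = swapVars j (monomial (swapExp j e) 1) := by
      rw [swapVars_monomial, swapExp_swapExp]
    have h' : swapExp j e (j + 1) ≤ swapExp j e j := by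
      rw [swapExp_left, swapExp_right]; exact h.le
    obtain ⟨d, hd⟩ : ∃ d, swapExp j e j - swapExp j e (j + 1) = d + 1 :=
      ⟨e (j + 1) - e j - 1, by rw [swapExp_left, swapExp_right]; omega⟩
    -- the first term of the divided difference is the given monomial
    have hdd : X (j + 1) * dividedDifference j (monomial e 1) = - monomial e (1 : K) -
        ∑ c ∈ Finset.range d, monomial (pairExp j (swapExp j e)
          (swapExp j e (j + 1) + (c + 1)) (swapExp j e j - (c + 1))) (1 : K) := by
      conv_lhs => rw [hsw]
      have h1 := X_mul_dividedDifference_monomial h'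
      rw [hd, Finset.sum_range_succ', add_zero, Nat.sub_zero, ← swapExp_eq_pairExp,
        swapExp_swapExp] at h1
      rw [dividedDifference_swapVars]
      linear_combination -h1
    rw [hdd]
    have e1 : ∀ S : Poly, monomial e 1 + (1 - tpar) • (- monomial e 1 - S) - tpar • monomial e 1 =
        -((1 - tpar) • S) := by
      intro S
      simp only [smul_eq_C_mul, map_sub, map_one]
      ring
    rw [e1]
    refine neg_mem (Submodule.smul_mem _ _ (Submodule.sum_mem _ fun c hc =>
      monomial_mem_suppIn ?_ 1))
    rw [Finset.mem_range] at hc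
    refine ⟨fun n h1 h2 => ?_, ?_⟩
    · rw [pairExp_of_ne _ _ _ h1 h2, swapExp_of_ne e h1 h2]
    · rw [pairExp_left, pairExp_right]
      rw [swapExp_left, swapExp_right] at *
      omega

/-- The operator `s_j t T_j⁻¹` is triangular. Exchanges occur only if `e_j < e_{j+1}`. -/
theorem isTriangular_swap_mul_inv (j : ℕ) :
    IsTriangular (permVars (Equiv.swap j (j + 1)) * (tpar • demazureLusztigInv j))
      (fun e => if e (j + 1) < e j then 1 else tpar) (Moves (j + 1) j) := by
  intro e _
  beta_reduce
  rw [swap_mul_inv_apply]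
  have hmov : ∀ {e'}, Moves j (j + 1) e' e → e' ≠ swapExp j e → Moves (j + 1) j e' e := by
    rintro e' ⟨h1, h2⟩ hne
    refine ⟨fun n h3 h4 => h1 n h4 h3, ?_⟩
    rcases h2 with h2 | ⟨h2, h3, h4⟩
    · left
      rw [min_comm]
      omega
    · refine absurd ?_ hne
      ext n
      by_cases h5 : n = j
      · subst h5; rw [swapExp_left, h3]
      · by_cases h6 : n = j + 1
        · subst h6; rw [swapExp_right, h4]
        · rw [swapExp_of_ne e h5 h6, h1 n h5 h6]
  rw [swapVars_monomial]
  rcases lt_trichotomy (e (j + 1)) (e j) with h | h | h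
  · rw [if_pos h, X_mul_dividedDifference_monomial h.le]
    obtain ⟨d, hd⟩ : ∃ d, e j - e (j + 1) = d + 1 := ⟨e j - e (j + 1) - 1, by omega⟩
    rw [hd, Finset.sum_range_succ', add_zero, Nat.sub_zero, ← swapExp_eq_pairExp]
    have e1 : ∀ S M M' : Poly, M + (1 - tpar) • (S + M') + (tpar - 1) • M' - (1 : K) • M =
        (1 - tpar) • S := by
      intro S M M'
      simp only [smul_eq_C_mul, map_sub, map_one]
      ring
    rw [e1]
    refine Submodule.smul_mem _ _ (Submodule.sum_mem _ fun c hc => monomial_mem_suppIn ?_ 1)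
    rw [Finset.mem_range] at hc
    refine ⟨fun n h1 h2 => pairExp_of_ne e _ _ h2 h1, ?_⟩
    rw [pairExp_left, pairExp_right]
    omega
  · rw [if_neg (by omega), X_mul_dividedDifference_monomial h.le, h, Nat.sub_self,
      Finset.sum_range_zero]
    have : swapExp j e = e := by rw [swapExp_eq_pairExp, h]; conv_rhs => rw [eq_pairExp_self j e, h]
    rw [this]
    have e1 : ∀ M : Poly, M + (1 - tpar) • (0 : Poly) + (tpar - 1) • M - tpar • M = 0 := by
      intro M
      simp only [smul_eq_C_mul, map_sub, map_one]
      ring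
    rw [e1]
    exact zero_mem _
  · rw [if_neg (by omega)]
    have h1 := isTriangular_swap_mul j e ‹_›
    beta_reduce at h1
    rw [swap_mul_demazureLusztig_apply, if_pos h] at h1
    have h2 : monomial e 1 + (1 - tpar) • (X (j + 1) * dividedDifference j (monomial e 1)) -
        tpar • monomial e 1 ∈ suppIn {e' | Moves (j + 1) j e' e} := by
      refine suppIn_mono (fun e' he' => hmov he' ?_) h1
      rintro rfl
      rcases he'.2 with h3 | h3
      · rw [swapExp_left, swapExp_right] at h3
        omega
      · omega
    have e1 : ∀ M M' A : Poly, M + A + (tpar - 1) • M' - tpar • M =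
        (M + A - tpar • M) + (tpar - 1) • M' := by
      intro M M' A
      simp only [smul_eq_C_mul, map_sub, map_one]
      ring
    rw [e1]
    refine add_mem h2 (Submodule.smul_mem _ _ (monomial_mem_suppIn ?_ 1))
    refine ⟨fun n h3 h4 => swapExp_of_ne e h4 h3, Or.inr ⟨h, swapExp_right j e, swapExp_left j e⟩⟩

/-! ### Triangularity of the deformed Cherednik operators -/

/-- The cyclic permutation that moves `i` to `i + n`, and `j` to `j - 1` for `i < j ≤ i + n`. -/
def trackPerm (i : ℕ) : ℕ → Equiv.Perm ℕ
  | 0 => 1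
  | n + 1 => Equiv.swap (i + n) (i + n + 1) * trackPerm i n

theorem trackPerm_apply (i n j : ℕ) :
    trackPerm i n j = if j = i then i + n else if i < j ∧ j ≤ i + n then j - 1 else j := by
  induction n with
  | zero =>
    simp only [trackPerm, Equiv.Perm.one_apply]
    split_ifs <;> omega
  | succ n ih =>
    rw [trackPerm, Equiv.Perm.mul_apply, ih, Equiv.swap_apply_def]
    split_ifs <;> omega

theorem trackPerm_zero {i : ℕ} (hi : 1 ≤ i) (n : ℕ) : trackPerm i n 0 = 0 := by
  rw [trackPerm_apply, if_neg (by omega), if_neg (by omega)]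

theorem trackPerm_symm_eq {i n j j' : ℕ} (h : trackPerm i n j' = j) : (trackPerm i n).symm j = j' :=
  (Equiv.symm_apply_eq _).2 h.symm

/-- A two-variable move at positions `a < b ≤ k` with `a ≤ m`; exchanges occur only if
`e_a < e_b`. -/
def LowStep (m k : ℕ) (e' e : ℕ →₀ ℕ) : Prop :=
  ∃ a b, 1 ≤ a ∧ a ≤ m ∧ a < b ∧ b ≤ k ∧ Moves b a e' e

theorem LowStep.apply_zero {m k : ℕ} {e' e : ℕ →₀ ℕ} (h : LowStep m k e' e) : e' 0 = e 0 := by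
  obtain ⟨a, b, h1, _, h3, _, h5, _⟩ := h
  exact h5 0 (by omega) (by omega)

theorem transGen_lowStep_apply_zero {m k : ℕ} {e' e : ℕ →₀ ℕ}
    (h : Relation.TransGen (LowStep m k) e' e) : e' 0 = e 0 := by
  induction h with
  | single h => exact h.apply_zero
  | tail _ h ih => exact ih.trans h.apply_zero

theorem isTriangular_one (P : (ℕ →₀ ℕ) → (ℕ →₀ ℕ) → Prop) :
    IsTriangular 1 (fun _ => 1) P := by
  intro e _
  rw [Module.End.one_apply, one_smul, sub_self]
  exact zero_mem _

theorem IsTriangular.mul_low {m k : ℕ} {L L' : Module.End K Poly} {κ κ' : (ℕ →₀ ℕ) → K}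
    (h : IsTriangular L κ (Relation.TransGen (LowStep m k)))
    (h' : IsTriangular L' κ' (Relation.TransGen (LowStep m k))) :
    IsTriangular (L * L') (fun e => κ e * κ' e) (Relation.TransGen (LowStep m k)) :=
  h.mul h' (fun h1 h2 => h1.trans h2) fun h1 h2 => (transGen_lowStep_apply_zero h1).trans h2

theorem prod_range'_reverse_succ (f : ℕ → Module.End K Poly) (i n : ℕ) :
    ((List.range' i (n + 1)).reverse.map f).prod =
      f (i + n) * ((List.range' i n).reverse.map f).prod := by
  rw [List.range'_concat]
  simp

/-- Up to the permutation of the variables that moves `x_i` to `x_{i+n}`, the operator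
`t^n T_{i+n-1}⁻¹ ⋯ T_i⁻¹` is triangular. -/
theorem isTriangular_prod_inv {i m k : ℕ} (hi : 1 ≤ i) (hm : i ≤ m) (n : ℕ) (hn : i + n ≤ k) :
    IsTriangular (permVars (trackPerm i n)⁻¹ *
        (tpar ^ n • ((List.range' i n).reverse.map demazureLusztigInv).prod))
      (fun e => ∏ j ∈ Finset.Ioc i (i + n), if e j < e i then 1 else tpar)
      (Relation.TransGen (LowStep m k)) := by
  induction n with
  | zero =>
    simpa [trackPerm, permVars_one] using isTriangular_one (Relation.TransGen (LowStep m k))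
  | succ n ih =>
    set σ := trackPerm i n with hσ
    have h0 : σ 0 = 0 := trackPerm_zero hi n
    have h1 : σ.symm (i + n) = i := trackPerm_symm_eq (by rw [trackPerm_apply, if_pos rfl])
    have h2 : σ.symm (i + n + 1) = i + n + 1 :=
      trackPerm_symm_eq (by rw [trackPerm_apply]; split_ifs <;> omega)
    have hop : permVars (trackPerm i (n + 1))⁻¹ *
        (tpar ^ (n + 1) • ((List.range' i (n + 1)).reverse.map demazureLusztigInv).prod) =
        (permVars σ⁻¹ * (permVars (Equiv.swap (i + n) (i + n + 1)) *
          (tpar • demazureLusztigInv (i + n))) * permVars σ) *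
        (permVars σ⁻¹ * (tpar ^ n • ((List.range' i n).reverse.map demazureLusztigInv).prod)) := by
      rw [mul_assoc _ (permVars σ), ← mul_assoc (permVars σ), permVars_mul_inv, one_mul, trackPerm,
        ← hσ, mul_inv_rev, Equiv.swap_inv, permVars_mul, prod_range'_reverse_succ]
      simp only [mul_assoc, mul_smul_comm, smul_mul_assoc, smul_smul, pow_succ]
    rw [hop]
    have hconj := ((isTriangular_swap_mul_inv (i + n)).conj h0).mono
      (P' := Relation.TransGen (LowStep m k)) fun e e' h => by
        rw [moves_equivMapDomain_iff] at h
        refine .single ⟨i, i + n + 1, hi, hm, by omega, by omega, ?_⟩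
        have e1 : σ⁻¹ (i + n) = i := h1
        have e2 : σ⁻¹ (i + n + 1) = i + n + 1 := h2
        rwa [e1, e2] at h
    convert hconj.mul_low (ih (by omega)) using 1
    funext e
    rw [← add_assoc, Finset.prod_Ioc_succ_top (by omega), mul_comm]
    simp only [Finsupp.equivMapDomain_apply, h1, h2]

/-- Up to permutations of the variables, the operator `T_n ⋯ T_1` is triangular after `x_i` has been
moved to `x_1`. -/
theorem isTriangular_prod {i m k : ℕ} (hm : i ≤ m) (hk : i ≤ k) (n : ℕ)
    (hn : n + 1 ≤ i) :
    IsTriangular (permVars (trackPerm 1 n * (trackPerm 1 (i - 1))⁻¹)⁻¹ *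
        (((List.range' 1 n).reverse.map demazureLusztig).prod * permVars (trackPerm 1 (i - 1))⁻¹))
      (fun e => ∏ j ∈ Finset.Ioc 0 n, if e i < e j then tpar else 1)
      (Relation.TransGen (LowStep m k)) := by
  induction n with
  | zero =>
    have := isTriangular_one (Relation.TransGen (LowStep m k))
    simpa [trackPerm, permVars_mul_inv] using this
  | succ n ih =>
    set d := (trackPerm 1 (i - 1))⁻¹ with hd
    set σ := trackPerm 1 n * d with hσ
    have hd1 : ∀ {j j'}, trackPerm 1 (i - 1) j = j' → d j' = j := fun h => trackPerm_symm_eq h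
    have hσ1 : ∀ {j j' j''}, trackPerm 1 (i - 1) j' = j → trackPerm 1 n j' = j'' →
        σ.symm j'' = j := by
      intro j j' j'' h h'
      rw [Equiv.symm_apply_eq, hσ, Equiv.Perm.mul_apply, hd1 h, h']
    have h0 : σ 0 = 0 := by
      have : σ.symm 0 = 0 := hσ1 (trackPerm_zero le_rfl _) (trackPerm_zero le_rfl _)
      rw [Equiv.symm_apply_eq] at this
      exact this.symm
    have h1 : σ.symm (n + 1) = i := hσ1 (j' := 1) (by rw [trackPerm_apply, if_pos rfl]; omega)
      (by rw [trackPerm_apply, if_pos rfl]; omega)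
    have h2 : σ.symm (n + 1 + 1) = n + 1 := hσ1 (j' := n + 2)
      (by rw [trackPerm_apply]; split_ifs <;> omega)
      (by rw [trackPerm_apply]; split_ifs <;> omega)
    have hop : permVars (trackPerm 1 (n + 1) * d)⁻¹ *
        (((List.range' 1 (n + 1)).reverse.map demazureLusztig).prod * permVars d) =
        (permVars σ⁻¹ * (permVars (Equiv.swap (n + 1) (n + 1 + 1)) * demazureLusztig (n + 1)) *
          permVars σ) *
        (permVars σ⁻¹ * (((List.range' 1 n).reverse.map demazureLusztig).prod * permVars d)) := by
      rw [mul_assoc _ (permVars σ), ← mul_assoc (permVars σ), permVars_mul_inv, one_mul, trackPerm,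
        mul_assoc (Equiv.swap _ _), ← hσ, mul_inv_rev, Equiv.swap_inv, permVars_mul,
        prod_range'_reverse_succ, add_comm 1 n]
      simp only [mul_assoc]
    rw [hop]
    have hconj := ((isTriangular_swap_mul (n + 1)).conj h0).mono
      (P' := Relation.TransGen (LowStep m k)) fun e e' h => by
        rw [moves_equivMapDomain_iff] at h
        refine .single ⟨n + 1, i, by omega, by omega, by omega, hk, ?_⟩
        have e1 : σ⁻¹ (n + 1) = i := h1
        have e2 : σ⁻¹ (n + 1 + 1) = n + 1 := h2
        rwa [e1, e2] at h
    convert hconj.mul_low (ih (by omega)) using 1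
    funext e
    rw [Finset.prod_Ioc_succ_top (by omega), mul_comm]
    simp only [Finsupp.equivMapDomain_apply, h1, h2]

/-- On a monomial whose variable `x_i` has been moved to `x_k`, the substitution `ω_k⁻¹` is the
scalar `q^{e_i}` times the permutation that moves `x_i` to `x_1`. -/
theorem omegaInv_rename_monomial {i k : ℕ} (hi : 1 ≤ i) (hk : i ≤ k) {e : ℕ →₀ ℕ} (h0 : e 0 = 0) :
    omegaInv k (permVars (trackPerm i (k - i)) (monomial e 1)) =
      qpar ^ e i • permVars (trackPerm 1 (i - 1))⁻¹ (monomial e 1) := by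
  set d := (trackPerm 1 (i - 1))⁻¹ with hd
  have hd1 : ∀ {j j'}, trackPerm 1 (i - 1) j = j' → d j' = j := fun h => trackPerm_symm_eq h
  have hdi : d i = 1 := hd1 (by rw [trackPerm_apply, if_pos rfl]; omega)
  have hX : ∀ j, j ≠ 0 → omegaInv k (X (trackPerm i (k - i) j)) =
      (if j = i then C qpar else 1) * X (d j) := by
    intro j hj
    rw [omegaInv, aeval_X, trackPerm_apply]
    by_cases h1 : j = i
    · subst h1
      rw [if_pos rfl, if_pos rfl, if_neg (by omega), if_pos (by omega), hdi]
    · rw [if_neg h1, if_neg h1, one_mul]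
      by_cases h2 : i < j ∧ j ≤ i + (k - i)
      · have h3 : d j = j := hd1 (by rw [trackPerm_apply]; split_ifs <;> omega)
        rw [if_pos h2, if_pos (by omega), h3, Nat.sub_add_cancel (by omega)]
      · rw [if_neg h2]
        by_cases h4 : j < i
        · have h3 : d j = j + 1 := hd1 (by rw [trackPerm_apply]; split_ifs <;> omega)
          rw [if_pos (by omega), h3]
        · have h3 : d j = j := hd1 (by rw [trackPerm_apply]; split_ifs <;> omega)
          rw [if_neg (by omega), if_neg (by omega), h3]
  have hprod : ∀ f : ℕ → Poly, (∏ j ∈ e.support, ((if j = i then C qpar else 1) * f j) ^ e j) =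
      C qpar ^ e i * ∏ j ∈ e.support, f j ^ e j := by
    intro f
    simp only [mul_pow, Finset.prod_mul_distrib]
    congr 1
    rw [Finset.prod_eq_single i]
    · rw [if_pos rfl]
    · intro j _ hj
      rw [if_neg hj, one_pow]
    · intro h
      rw [Finsupp.notMem_support_iff.1 h, pow_zero]
  simp only [permVars, AlgHom.toLinearMap_apply, smul_eq_C_mul]
  rw [monomial_eq, C_1, one_mul, Finsupp.prod]
  simp only [map_prod, map_pow, rename_X]
  rw [← hprod]
  refine Finset.prod_congr rfl fun j hj => ?_
  have : j ≠ 0 := by rintro rfl; exact Finsupp.mem_support_iff.1 hj h0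
  rw [hX j this]

/-- The operator `ϖ_k` is diagonal, up to the permutations that move `x_i` to `x_k` and to `x_1`. -/
theorem isTriangular_varpi {i k : ℕ} (hi : 1 ≤ i) (hk : i ≤ k)
    (P : (ℕ →₀ ℕ) → (ℕ →₀ ℕ) → Prop) :
    IsTriangular (permVars (trackPerm 1 (i - 1)) * varpi k * permVars (trackPerm i (k - i)))
      (fun e => if e i = 0 then 0 else qpar ^ e i) P := by
  intro e he
  have h1 : (trackPerm 1 (i - 1)).symm i = 1 := trackPerm_symm_eq
    (by rw [trackPerm_apply, if_pos rfl]; omega)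
  have h2 : (e.equivMapDomain (trackPerm 1 (i - 1))⁻¹) 1 = e i := by
    rw [Finsupp.equivMapDomain_apply]
    congr 1
    change trackPerm 1 (i - 1) 1 = i
    rw [trackPerm_apply, if_pos rfl]
    omega
  have h3 : (permVars (trackPerm 1 (i - 1)) * varpi k * permVars (trackPerm i (k - i)))
      (monomial e 1) = (if e i = 0 then 0 else qpar ^ e i) • monomial e 1 := by
    rw [Module.End.mul_apply, Module.End.mul_apply, varpi, Module.End.mul_apply,
      AlgHom.toLinearMap_apply, omegaInv_rename_monomial hi hk he, map_smul, map_smul,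
      permVars_monomial, prOne_monomial, h2]
    split_ifs with h
    · simp
    · rw [← permVars_monomial, ← Module.End.mul_apply, permVars_mul_inv, Module.End.one_apply]
  beta_reduce
  rw [h3, sub_self]
  exact zero_mem _

/-- The diagonal entries of the deformed Cherednik operator. -/
noncomputable def cherednikWeight (i k : ℕ) (e : ℕ →₀ ℕ) : K :=
  tpar * ((∏ j ∈ Finset.Ioc 0 (i - 1), if e i < e j then tpar else 1) *
    ((if e i = 0 then 0 else qpar ^ e i) *
      ∏ j ∈ Finset.Ioc i k, if e j < e i then 1 else tpar))

/-- The deformed Cherednik operators are triangular: in between the factors of `Ỹ_i^{(k)}`, insert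
the permutations of the variables that follow `x_i` on its way to `x_k`, then to `x_1` and back to
`x_i`. -/
theorem isTriangular_deformedCherednik {i m k : ℕ} (hi : 1 ≤ i) (hm : i ≤ m) (hk : i ≤ k) :
    IsTriangular (deformedCherednik i k) (cherednikWeight i k)
      (Relation.TransGen (LowStep m k)) := by
  have h1 := isTriangular_prod_inv hi hm (k - i) (k := k) (by omega)
  have h2 := isTriangular_varpi hi hk (Relation.TransGen (LowStep m k))
  have h3 := isTriangular_prod hm hk (i - 1) (by omega)
  rw [mul_inv_cancel, inv_one, permVars_one, one_mul] at h3
  convert (h3.mul_low (h2.mul_low h1)).smul tpar using 1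
  · rw [deformedCherednik]
    set A := ((List.range' 1 (i - 1)).reverse.map demazureLusztig).prod
    set B := ((List.range' i (k - i)).reverse.map demazureLusztigInv).prod
    have e1 : A * permVars (trackPerm 1 (i - 1))⁻¹ *
        (permVars (trackPerm 1 (i - 1)) * varpi k * permVars (trackPerm i (k - i)) *
          (permVars (trackPerm i (k - i))⁻¹ * (tpar ^ (k - i) • B))) =
        tpar ^ (k - i) • (A * varpi k * B) := by
      calc _ = A * (permVars (trackPerm 1 (i - 1))⁻¹ * permVars (trackPerm 1 (i - 1))) * varpi k *
          (permVars (trackPerm i (k - i)) * permVars (trackPerm i (k - i))⁻¹) *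
            (tpar ^ (k - i) • B) := by simp only [mul_assoc]
        _ = _ := by
          rw [permVars_inv_mul, permVars_mul_inv, mul_one, mul_one, mul_smul_comm]
    rw [e1, smul_smul, ← pow_succ', show k + 1 - i = k - i + 1 by omega]
  · funext e
    rw [cherednikWeight, Nat.add_sub_cancel' hk]

/-- A two-variable move is a step down for the order on weights. The reflection is in the root
`n δ + ε_a - ε_b` with `n = e'_b - e_a` if `e_a ≤ e_b`, in the root `n δ + ε_b - ε_a` with
`n = e'_a - e_b` if `e_a > e_b`, and in the root `ε_a - ε_b` for an exchange. -/
theorem LowStep.weightStep {m k : ℕ} {e' e : ℕ →₀ ℕ} (h : LowStep m k e' e) (he : InRange k e) :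
    InRange k e' ∧ WeightStep (expWeight k e') (expWeight k e) ∧ HeadBelow m e' e := by
  obtain ⟨a, b, h1, h2, h3, h4, h5, h6⟩ := h
  have ea : a - 1 + 1 = a := by omega
  have eb : b - 1 + 1 = b := by omega
  obtain ⟨a', ha'⟩ : ∃ a' : Fin k, a'.val + 1 = a := ⟨⟨a - 1, by omega⟩, ea⟩
  obtain ⟨b', hb'⟩ : ∃ b' : Fin k, b'.val + 1 = b := ⟨⟨b - 1, by omega⟩, eb⟩
  have hlt : a' < b' := Fin.lt_def.2 (by omega)
  have wa : ∀ e, expWeight k e a' = e a := fun e => by rw [expWeight, ha']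
  have wb : ∀ e, expWeight k e b' = e b := fun e => by rw [expWeight, hb']
  have hag : ∀ j, j ≠ a → j ≠ b → e j = e' j := fun j h h' => (h5 j h' h).symm
  obtain ⟨r, s1, s2⟩ := exists_sum_eq_of_agree (by omega : b ≠ a) h5 (fun _ v => v ^ 2) (by simp)
  obtain ⟨r', s3, s4⟩ := exists_sum_eq_of_agree (by omega : b ≠ a) h5
    (fun j v => (m + 1 - j) * v) (by simp)
  refine ⟨fun j hj => ?_, ?_, ?_⟩
  · by_cases hja : j = a
    · omega
    · by_cases hjb : j = b
      · omega
      · rw [h5 j hjb hja] at hj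
        exact he j hj
  · rcases h6 with ⟨h6, h7, h8⟩ | ⟨h6, h7, h8⟩
    · rcases le_or_gt (e a) (e b) with hle | hgt
      · rw [min_eq_right hle] at h7 h8
        refine ⟨a', b', e' b - e a, ⟨hlt.ne, Or.inl (by omega)⟩, ?_,
          (affineReflection_expWeight hlt.ne (by rwa [ha', hb']) ?_ ?_).symm⟩
        · rw [affineRoot, wa, wb]; omega
        · rw [ha', hb']; omega
        · rw [ha', hb']; omega
      · rw [min_eq_left hgt.le] at h7 h8
        refine ⟨b', a', e' a - e b, ⟨hlt.ne', Or.inl (by omega)⟩, ?_,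
          (affineReflection_expWeight hlt.ne' (fun j h h' => ?_) ?_ ?_).symm⟩
        · rw [affineRoot, wa, wb]; omega
        · rw [ha'] at h'; rw [hb'] at h
          exact hag j h' h
        · rw [ha', hb']; omega
        · rw [ha', hb']; omega
    · refine ⟨a', b', 0, ⟨hlt.ne, Or.inr ⟨rfl, hlt⟩⟩, ?_,
        (affineReflection_expWeight hlt.ne (by rwa [ha', hb']) ?_ ?_).symm⟩
      · rw [affineRoot, wa, wb]; omega
      · rw [ha', hb']; omega
      · rw [ha', hb']; omega
  · rcases h6 with ⟨h6, h7, h8⟩ | ⟨h6, h7, h8⟩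
    · refine Or.inl ?_
      rw [sqSum, sqSum, s1, s2]
      -- the entries at `a` and `b` move strictly towards each other
      rcases le_total (e a) (e b) with hle | hle
      · rw [min_eq_right hle] at h7 h8
        obtain ⟨x, hx⟩ := Nat.exists_eq_add_of_lt h7
        obtain ⟨y, hy⟩ := Nat.exists_eq_add_of_lt h8
        have hb2 : e b = e a + x + 1 + y + 1 := by omega
        rw [hx, hy, hb2]
        nlinarith [Nat.zero_le (x * y), Nat.zero_le x, Nat.zero_le y]
      · rw [min_eq_left hle] at h7 h8
        obtain ⟨x, hx⟩ := Nat.exists_eq_add_of_lt h7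
        obtain ⟨y, hy⟩ := Nat.exists_eq_add_of_lt h8
        have hb2 : e a = e b + x + 1 + y + 1 := by omega
        rw [hx, hy, hb2]
        nlinarith [Nat.zero_le (x * y), Nat.zero_le x, Nat.zero_le y]
    · refine Or.inr ⟨?_, ?_⟩
      · rw [sqSum, sqSum, s1, s2, h7, h8]
        ring
      · rw [headSum, headSum, s3, s4, h7, h8]
        obtain ⟨x, hx⟩ := Nat.exists_eq_add_of_lt h6
        obtain ⟨y, hy⟩ : ∃ y, m + 1 - a = (m + 1 - b) + y + 1 :=
          ⟨m + 1 - a - (m + 1 - b) - 1, by omega⟩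
        rw [hx, hy]
        generalize m + 1 - b = w
        have : w * e a + (w + y + 1) * (e a + x + 1) + r' =
            w * (e a + x + 1) + (w + y + 1) * e a + r' + (y + 1) * (x + 1) := by ring
        have : 0 < (y + 1) * (x + 1) := by positivity
        omega

theorem transGen_lowStep {m k : ℕ} {e' e : ℕ →₀ ℕ} (h : Relation.TransGen (LowStep m k) e' e)
    (he : InRange k e) :
    InRange k e' ∧ WeightLE (expWeight k e') (expWeight k e) ∧ HeadBelow m e' e := by
  induction h using Relation.TransGen.head_induction_on with
  | single h =>
    obtain ⟨h1, h2, h3⟩ := h.weightStep he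
    exact ⟨h1, .single h2, h3⟩
  | head h _ ih =>
    obtain ⟨h1, h2, h3⟩ := h.weightStep ih.1
    exact ⟨h1, .head h2 ih.2.1, h3.trans ih.2.2⟩

/-! ### Sequences that are stable from some index on -/

theorem totalDegree_aeval_le {f : ℕ → Poly} (hf : ∀ j, (f j).totalDegree ≤ 1) (p : Poly) :
    (aeval f p).totalDegree ≤ p.totalDegree := by
  rw [p.as_sum, map_sum, ← p.as_sum]
  refine totalDegree_finsetSum_le fun e he => ?_
  rw [aeval_monomial, MvPolynomial.algebraMap_eq]
  refine (totalDegree_mul _ _).trans ?_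
  rw [totalDegree_C, zero_add]
  refine (totalDegree_finsetProd _ _).trans (le_trans (Finset.sum_le_sum fun j _ => ?_)
    (le_totalDegree he))
  exact (totalDegree_pow _ _).trans ((Nat.mul_le_mul_left _ (hf j)).trans_eq (mul_one _))

theorem map_mem_finPoly {k n : ℕ} (φ : Poly →ₐ[K] Poly)
    (h : ∀ j, 1 ≤ j → j ≤ k → φ (X j) ∈ finPoly n) {p : Poly} (hp : p ∈ finPoly k) :
    φ p ∈ finPoly n := by
  have : finPoly k ≤ (finPoly n).comap φ := by
    refine Algebra.adjoin_le ?_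
    rintro _ ⟨j, hj, rfl⟩
    exact h j hj.1 hj.2
  exact this hp

theorem X_mem_finPoly {j k : ℕ} (h : 1 ≤ j) (h' : j ≤ k) : (X j : Poly) ∈ finPoly k :=
  X_mem_supported.2 ⟨h, h'⟩

theorem truncVars_mem (k : ℕ) (p : Poly) : truncVars k p ∈ finPoly k := by
  classical
  rw [mem_finPoly_iff]
  intro e he
  rw [coeff_truncVars] at he
  by_contra h
  exact he (if_neg h)

theorem truncVars_of_mem {k : ℕ} {p : Poly} (hp : p ∈ finPoly k) : truncVars k p = p := by
  classical
  ext e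
  rw [coeff_truncVars]
  split_ifs with h
  · rfl
  · by_contra h'
    exact h (mem_finPoly_iff.1 hp e fun h0 => h' h0.symm)

theorem totalDegree_truncVars_le (k : ℕ) (p : Poly) :
    (truncVars k p).totalDegree ≤ p.totalDegree := by
  refine totalDegree_aeval_le (fun j => ?_) p
  split_ifs <;> simp

theorem totalDegree_dropVar_le (j : ℕ) (p : Poly) :
    (dropVar j p).totalDegree ≤ p.totalDegree := by
  refine totalDegree_aeval_le (fun j => ?_) p
  split_ifs <;> simp

/-- The sequences of polynomials in `x_1, …, x_k` whose terms with `k ≥ m` are those of a formal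
polynomial fixed by the `s_i`, `i > m`. -/
def asFrom (m : ℕ) : Subalgebra K (ℕ → Poly) where
  carrier := {F | (∀ k, m ≤ k → F k ∈ finPoly k) ∧
    (∀ k, m ≤ k → dropVar (k + 1) (F (k + 1)) = F k) ∧
    (∃ d : ℕ, ∀ k, m ≤ k → (F k).totalDegree ≤ d) ∧
    ∀ i, m < i → ∀ n, i + 1 ≤ n → swapVars i (F n) = F n}
  mul_mem' := by
    rintro F G ⟨hF, hF', ⟨d, hd⟩, hs⟩ ⟨hG, hG', ⟨e, he⟩, ht⟩
    refine ⟨fun k hk => mul_mem (hF k hk) (hG k hk), fun k hk => ?_, ⟨d + e, fun k hk => ?_⟩,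
      fun i hi n hn => ?_⟩
    · simp [hF' k hk, hG' k hk]
    · exact (totalDegree_mul _ _).trans (add_le_add (hd k hk) (he k hk))
    · rw [Pi.mul_apply, map_mul, hs i hi n hn, ht i hi n hn]
  add_mem' := by
    rintro F G ⟨hF, hF', ⟨d, hd⟩, hs⟩ ⟨hG, hG', ⟨e, he⟩, ht⟩
    refine ⟨fun k hk => add_mem (hF k hk) (hG k hk), fun k hk => ?_, ⟨max d e, fun k hk => ?_⟩,
      fun i hi n hn => ?_⟩
    · simp [hF' k hk, hG' k hk]
    · exact (totalDegree_add _ _).trans (max_le_max (hd k hk) (he k hk))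
    · rw [Pi.add_apply, map_add, hs i hi n hn, ht i hi n hn]
  algebraMap_mem' r := by
    refine ⟨fun k _ => (finPoly k).algebraMap_mem r, fun k _ => ?_, ⟨0, fun k _ => ?_⟩,
      fun i _ n _ => ?_⟩
    · simp
    · simp [Pi.algebraMap_apply, MvPolynomial.algebraMap_eq]
    · simp

theorem symPast.mem_asFrom {m : ℕ} {F : ℕ → Poly} (hF : F ∈ symPast m) : F ∈ asFrom m :=
  ⟨fun k _ => hF.1.1 k, fun k _ => hF.1.2.1 k, hF.1.2.2.imp fun _ h k _ => h k, hF.2⟩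

/-- A sequence that is stable from the index `m` on extends to an almost symmetric formal
polynomial. -/
theorem exists_symPast_of_asFrom {m : ℕ} {F : ℕ → Poly} (hF : F ∈ asFrom m) :
    ∃ G ∈ symPast m, ∀ k, m ≤ k → G k = F k := by
  classical
  obtain ⟨h1, h2, ⟨d, hd⟩, h4⟩ := hF
  have hG : ∀ k, m ≤ k → truncVars k (F (max k m)) = F k := fun k hk => by
    rw [max_eq_left hk, truncVars_of_mem (h1 k hk)]
  refine ⟨fun k => truncVars k (F (max k m)), ⟨⟨fun k => truncVars_mem k _, fun k => ?_, d,
    fun k => (totalDegree_truncVars_le k _).trans (hd _ (le_max_right _ _))⟩,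
    fun i hi n hn => ?_⟩, hG⟩
  · rcases le_or_gt m k with hk | hk
    · simp only [hG k hk, hG (k + 1) (by omega)]
      exact h2 k hk
    · simp only [max_eq_right hk.le, max_eq_right (show k + 1 ≤ m from hk)]
      ext e
      rw [coeff_dropVar, coeff_truncVars, coeff_truncVars]
      by_cases h : InRange k e
      · rw [if_pos h, if_pos (h.mono (Nat.le_succ k)), if_pos]
        by_contra h0
        have := (h _ h0).2
        omega
      · rw [if_neg h]
        split_ifs with h5 h6
        · refine absurd (fun j hj => ⟨(h6 j hj).1, ?_⟩) h
          have := (h6 j hj).2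
          have : j ≠ k + 1 := by rintro rfl; exact hj h5
          omega
        · rfl
        · rfl
  · simp only [hG n (by omega)]
    exact h4 i hi n hn

theorem swapVars_X (i j : ℕ) : swapVars i (X j : Poly) = X (Equiv.swap i (i + 1) j) := by
  rw [swapVars, rename_X]

/-- Operators given by an algebra morphism that commutes with the `s_j` and fixes `x_j`, `x_{j+1}`
commute with `T_j`. -/
theorem map_demazureLusztig {j : ℕ} (φ : Poly →ₐ[K] Poly)
    (hs : ∀ n, swapVars j (φ (X n)) = φ (swapVars j (X n))) (h1 : φ (X j) = X j)
    (h2 : φ (X (j + 1)) = X (j + 1)) (f : Poly) :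
    φ (demazureLusztig j f) = demazureLusztig j (φ f) := by
  have hs' : ∀ f, swapVars j (φ f) = φ (swapVars j f) := by
    intro f
    have : (swapVars j).comp φ = φ.comp (swapVars j) := algHom_ext hs
    exact DFunLike.congr_fun this f
  have hd : φ (dividedDifference j f) = dividedDifference j (φ f) := by
    apply mul_left_cancel₀ (X_sub_X_ne_zero j)
    have h := congrArg φ (dividedDifference_spec j f)
    rw [map_mul, map_sub, map_sub, h1, h2] at h
    rw [h, dividedDifference_spec, hs']
  rw [demazureLusztig_apply, demazureLusztig_apply, map_add, map_smul, map_mul, hd, h1, hs']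

theorem totalDegree_X_mul_dividedDifference_le (j : ℕ) (f : Poly) :
    (X j * dividedDifference j f).totalDegree ≤ f.totalDegree := by
  by_cases h0 : dividedDifference j f = 0
  · rw [h0, mul_zero, totalDegree_zero]
    exact Nat.zero_le _
  · have h1 : (1 : ℕ) ≤ (X j - X (j + 1) : Poly).totalDegree := by
      have : coeff (Finsupp.single j 1) (X j - X (j + 1) : Poly) ≠ 0 := by
        rw [coeff_sub, coeff_X, coeff_X, if_pos rfl, if_neg]
        · simp
        · rw [Finsupp.single_left_inj one_ne_zero]
          omega
      have h2 := le_totalDegree (mem_support_iff.2 this)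
      simpa using h2
    have h2 := totalDegree_mul_of_isDomain (X_sub_X_ne_zero j) h0
    rw [dividedDifference_spec] at h2
    have h3 : (f - swapVars j f).totalDegree ≤ f.totalDegree :=
      (totalDegree_sub _ _).trans (max_le le_rfl (totalDegree_rename_le _ _))
    refine (totalDegree_mul _ _).trans ?_
    rw [totalDegree_X]
    omega

theorem demazureLusztig_mem_asFrom {j m : ℕ} (hj : 1 ≤ j) (hjm : j < m) {F : ℕ → Poly}
    (hF : F ∈ asFrom m) : (fun k => demazureLusztig j (F k)) ∈ asFrom m := by
  obtain ⟨h1, h2, ⟨d, hd⟩, h4⟩ := hF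
  refine ⟨fun k hk => ?_, fun k hk => ?_, ⟨d, fun k hk => ?_⟩, fun i hi n hn => ?_⟩
  · beta_reduce
    rw [← truncVars_of_mem (h1 k hk), ← map_demazureLusztig]
    · exact truncVars_mem k _
    · intro n
      by_cases hn : n = j
      · subst hn
        simp only [truncVars, aeval_X, swapVars_X, Equiv.swap_apply_left, Set.mem_Icc]
        rw [if_pos (by omega), if_pos (by omega), swapVars_X, Equiv.swap_apply_left]
      · by_cases hn' : n = j + 1
        · subst hn'
          simp only [truncVars, aeval_X, swapVars_X, Equiv.swap_apply_right, Set.mem_Icc]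
          rw [if_pos (by omega), if_pos (by omega), swapVars_X, Equiv.swap_apply_right]
        · rw [swapVars_X, Equiv.swap_apply_of_ne_of_ne hn hn']
          simp only [truncVars, aeval_X]
          split_ifs
          · rw [swapVars_X, Equiv.swap_apply_of_ne_of_ne hn hn']
          · rw [map_zero]
    · simp only [truncVars, aeval_X, Set.mem_Icc]
      rw [if_pos (by omega)]
    · simp only [truncVars, aeval_X, Set.mem_Icc]
      rw [if_pos (by omega)]
  · beta_reduce
    rw [map_demazureLusztig, h2 k hk]
    · intro n
      by_cases hn : n = k + 1
      · subst hn
        rw [swapVars_X, Equiv.swap_apply_of_ne_of_ne (by omega) (by omega)]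
        simp [dropVar]
      · have hn' : Equiv.swap j (j + 1) n ≠ k + 1 := by
          rw [Equiv.swap_apply_def]
          split_ifs <;> omega
        simp only [dropVar, aeval_X, swapVars_X, if_neg hn, if_neg hn']
    · simp only [dropVar, aeval_X]
      rw [if_neg (by omega)]
    · simp only [dropVar, aeval_X]
      rw [if_neg (by omega)]
  · refine le_trans ?_ (hd k hk)
    beta_reduce
    rw [demazureLusztig_apply]
    refine (totalDegree_add _ _).trans (max_le (totalDegree_rename_le _ _) ?_)
    exact (totalDegree_smul_le _ _).trans (totalDegree_X_mul_dividedDifference_le j _)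
  · beta_reduce
    rw [map_demazureLusztig, h4 i hi n hn]
    · intro r
      simp only [swapVars_X]
      congr 1
      simp only [Equiv.swap_apply_def]
      split_ifs <;> omega
    · rw [swapVars_X, Equiv.swap_apply_of_ne_of_ne (by omega) (by omega)]
    · rw [swapVars_X, Equiv.swap_apply_of_ne_of_ne (by omega) (by omega)]

theorem demazureLusztigInv_apply (j : ℕ) (f : Poly) :
    demazureLusztigInv j f = tpar⁻¹ • (demazureLusztig j f + (tpar - 1) • f) := rfl

theorem demazureLusztigInv_mem_asFrom {j m : ℕ} (hj : 1 ≤ j) (hjm : j < m) {F : ℕ → Poly}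
    (hF : F ∈ asFrom m) : (fun k => demazureLusztigInv j (F k)) ∈ asFrom m :=
  Subalgebra.smul_mem _ (add_mem (demazureLusztig_mem_asFrom hj hjm hF)
    (Subalgebra.smul_mem _ hF (tpar - 1))) tpar⁻¹

theorem prod_mem_asFrom {f : ℕ → Module.End K Poly} {i m : ℕ}
    (hf : ∀ j, i ≤ j → j < m → ∀ F ∈ asFrom m, (fun k => f j (F k)) ∈ asFrom m) (n : ℕ)
    (hn : i + n ≤ m) {F : ℕ → Poly} (hF : F ∈ asFrom m) :
    (fun k => ((List.range' i n).reverse.map f).prod (F k)) ∈ asFrom m := by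
  induction n with
  | zero => simpa using hF
  | succ n ih =>
    simp only [prod_range'_reverse_succ, Module.End.mul_apply]
    exact hf (i + n) (by omega) (by omega) _ (ih (by omega))

theorem demazureLusztigInv_mul_of_swapVars {j : ℕ} {p : Poly} (hp : swapVars j p = p) (f : Poly) :
    demazureLusztigInv j (p * f) = p * demazureLusztigInv j f := by
  have hd : dividedDifference j (p * f) = p * dividedDifference j f := by
    apply mul_left_cancel₀ (X_sub_X_ne_zero j)
    rw [dividedDifference_spec, map_mul, hp]
    linear_combination (-p) * dividedDifference_spec j f
  rw [demazureLusztigInv_apply, demazureLusztigInv_apply, demazureLusztig_apply,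
    demazureLusztig_apply, hd, map_mul, hp]
  simp only [smul_eq_C_mul]
  ring

theorem prod_inv_mul_of_swapVars {i n : ℕ} {p : Poly}
    (hp : ∀ j, i ≤ j → j < i + n → swapVars j p = p) (f : Poly) :
    ((List.range' i n).reverse.map demazureLusztigInv).prod (p * f) =
      p * ((List.range' i n).reverse.map demazureLusztigInv).prod f := by
  induction n with
  | zero => simp
  | succ n ih =>
    rw [prod_range'_reverse_succ, Module.End.mul_apply, Module.End.mul_apply,
      ih fun j h h' => hp j h (by omega),
      demazureLusztigInv_mul_of_swapVars (hp _ (by omega) (by omega))]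

theorem demazureLusztigInv_one (j : ℕ) : demazureLusztigInv j 1 = 1 := by
  have hd : dividedDifference j 1 = 0 := by
    apply mul_left_cancel₀ (X_sub_X_ne_zero j)
    rw [dividedDifference_spec, map_one, sub_self, mul_zero]
  have ht : C tpar⁻¹ * C tpar = (1 : Poly) := by
    rw [← C_mul, inv_mul_cancel₀ tpar_ne_zero, C_1]
  rw [demazureLusztigInv_apply, demazureLusztig_apply, hd, map_one]
  simp only [smul_eq_C_mul, map_sub, map_one]
  linear_combination ht

theorem prod_inv_one (i n : ℕ) :
    ((List.range' i n).reverse.map demazureLusztigInv).prod (1 : Poly) = 1 := by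
  induction n with
  | zero => simp
  | succ n ih =>
    rw [prod_range'_reverse_succ, Module.End.mul_apply, ih, demazureLusztigInv_one]

/-- `t T_j⁻¹ x_j^{a+1} = x_{j+1}^{a+1} + (1 - t) (x_j x_{j+1}^a + ⋯ + x_j^a x_{j+1})`. -/
theorem demazureLusztigInv_X_pow (j a : ℕ) :
    tpar • demazureLusztigInv j (X j ^ (a + 1)) = X (j + 1) ^ (a + 1) +
      (1 - tpar) • ∑ c ∈ Finset.range a, X j ^ (c + 1) * X (j + 1) ^ (a - c) := by
  have hsw : swapVars j (X j ^ (a + 1) : Poly) = X (j + 1) ^ (a + 1) := by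
    rw [map_pow, swapVars_X, Equiv.swap_apply_left]
  have hd : dividedDifference j (X j ^ (a + 1)) =
      ∑ c ∈ Finset.range (a + 1), X j ^ c * X (j + 1) ^ (a + 1 - 1 - c) := by
    apply mul_left_cancel₀ (X_sub_X_ne_zero j)
    rw [dividedDifference_spec, hsw, mul_comm, geom_sum₂_mul]
  rw [demazureLusztigInv_apply, smul_smul, mul_inv_cancel₀ tpar_ne_zero, one_smul,
    demazureLusztig_apply, hd, hsw, Finset.sum_range_succ, mul_add, Finset.mul_sum]
  have hsum : ∑ c ∈ Finset.range a, (X j : Poly) * (X j ^ c * X (j + 1) ^ (a + 1 - 1 - c)) =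
      ∑ c ∈ Finset.range a, X j ^ (c + 1) * X (j + 1) ^ (a - c) := by
    refine Finset.sum_congr rfl fun c _ => ?_
    rw [pow_succ', Nat.add_sub_cancel]
    ring
  rw [hsum]
  simp only [smul_eq_C_mul, map_sub, map_one, Nat.add_sub_cancel, Nat.sub_self, pow_zero]
  ring

/-! ### Generating series -/

/-- The series `(1 - t x u) / (1 - x u)` in `u`. -/
noncomputable def factorSeries (x : Poly) : PowerSeries Poly :=
  PowerSeries.mk fun n => if n = 0 then 1 else C (1 - tpar) * x ^ n

/-- The series `x u / (1 - x u)` in `u`. -/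
noncomputable def geomSeries (x : Poly) : PowerSeries Poly :=
  PowerSeries.mk fun n => if n = 0 then 0 else x ^ n

theorem coeff_zero_mul_geomSeries (G : PowerSeries Poly) (x : Poly) :
    PowerSeries.coeff 0 (G * geomSeries x) = 0 := by
  rw [PowerSeries.coeff_mul, Finset.Nat.antidiagonal_zero, Finset.sum_singleton, geomSeries,
    PowerSeries.coeff_mk, if_pos rfl, mul_zero]

theorem coeff_succ_factorSeries_mul (x : Poly) {G : PowerSeries Poly}
    (hG : PowerSeries.coeff 0 G = 0) (a : ℕ) :
    PowerSeries.coeff (a + 1) (factorSeries x * G) = PowerSeries.coeff (a + 1) G +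
      C (1 - tpar) * ∑ c ∈ Finset.range a, x ^ (c + 1) * PowerSeries.coeff (a - c) G := by
  rw [PowerSeries.coeff_mul, Finset.Nat.sum_antidiagonal_eq_sum_range_succ
    (fun i j => PowerSeries.coeff i (factorSeries x) * PowerSeries.coeff j G),
    Finset.sum_range_succ, Finset.sum_range_succ', Nat.sub_self, hG, mul_zero, add_zero,
    Nat.sub_zero, factorSeries, PowerSeries.coeff_mk, if_pos rfl, one_mul, add_comm, Finset.mul_sum]
  congr 1
  refine Finset.sum_congr rfl fun c _ => ?_
  rw [PowerSeries.coeff_mk, if_neg (Nat.succ_ne_zero c), mul_assoc, Nat.add_sub_add_right]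

/-- `t^n T_{m+n-1}⁻¹ ⋯ T_m⁻¹ x_m^a` is the coefficient of `u^a` in
`∏_{m ≤ j < m+n} (1 - t x_j u) / (1 - x_j u) · x_{m+n} u / (1 - x_{m+n} u)`, for `a > 0`. -/
theorem prod_inv_X_pow (n : ℕ) : ∀ m a : ℕ,
    tpar ^ n • ((List.range' m n).reverse.map demazureLusztigInv).prod (X m ^ (a + 1) : Poly) =
      PowerSeries.coeff (a + 1) ((∏ j ∈ Finset.Ico m (m + n), factorSeries (X j)) *
        geomSeries (X (m + n))) := by
  induction n with
  | zero =>
    intro m a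
    simp [geomSeries]
  | succ n ih =>
    intro m a
    have hop : ((List.range' m (n + 1)).reverse.map demazureLusztigInv).prod =
        ((List.range' (m + 1) n).reverse.map demazureLusztigInv).prod * demazureLusztigInv m := by
      rw [List.range'_succ]
      simp
    have e1 : m + (n + 1) = m + 1 + n := by omega
    rw [hop, Finset.prod_eq_prod_Ico_succ_bot (by omega), mul_assoc, e1,
      coeff_succ_factorSeries_mul _ (coeff_zero_mul_geomSeries _ _), Module.End.mul_apply, pow_succ,
      mul_smul, ← map_smul, demazureLusztigInv_X_pow, map_add, smul_add, ih, map_smul, map_sum,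
      smul_comm, smul_eq_C_mul _ (1 - tpar), Finset.smul_sum]
    congr 2
    refine Finset.sum_congr rfl fun c hc => ?_
    rw [Finset.mem_range] at hc
    obtain ⟨r, hr⟩ : ∃ r, a - c = r + 1 := ⟨a - c - 1, by omega⟩
    rw [prod_inv_mul_of_swapVars, hr, ← ih, mul_smul_comm]
    intro j hj _
    rw [map_pow, swapVars_X, Equiv.swap_apply_of_ne_of_ne (by omega) (by omega)]

theorem map_factorSeries (φ : Poly →ₐ[K] Poly) (x : Poly) :
    PowerSeries.map (φ : Poly →+* Poly) (factorSeries x) = factorSeries (φ x) := by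
  ext n : 1
  have hC : φ (C (1 - tpar)) = C (1 - tpar) := φ.commutes _
  rw [PowerSeries.coeff_map, factorSeries, factorSeries, PowerSeries.coeff_mk,
    PowerSeries.coeff_mk]
  split_ifs
  · simp
  · rw [RingHom.coe_coe, map_mul, hC, map_pow]

theorem map_geomSeries (φ : Poly →ₐ[K] Poly) (x : Poly) :
    PowerSeries.map (φ : Poly →+* Poly) (geomSeries x) = geomSeries (φ x) := by
  ext n : 1
  rw [PowerSeries.coeff_map, geomSeries, geomSeries, PowerSeries.coeff_mk, PowerSeries.coeff_mk]
  split_ifs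
  · simp
  · rw [RingHom.coe_coe, map_pow]

theorem map_coeff_series (φ : Poly →ₐ[K] Poly) (s : Finset ℕ) (x : Poly) (a : ℕ) :
    φ (PowerSeries.coeff a ((∏ j ∈ s, factorSeries (X j)) * geomSeries x)) =
      PowerSeries.coeff a ((∏ j ∈ s, factorSeries (φ (X j))) * geomSeries (φ x)) := by
  have := PowerSeries.coeff_map (φ : Poly →+* Poly) a
    ((∏ j ∈ s, factorSeries (X j)) * geomSeries x)
  rw [RingHom.coe_coe] at this
  rw [← this, map_mul, map_prod, map_geomSeries]
  simp only [map_factorSeries]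

theorem factorSeries_zero : factorSeries 0 = 1 := by
  ext n : 1
  rw [factorSeries, PowerSeries.coeff_mk, PowerSeries.coeff_one]
  split_ifs with h
  · rfl
  · rw [zero_pow h, mul_zero]

/-- The coefficient of `u^n` has degree at most `n`. -/
def IsGradedSeries (G : PowerSeries Poly) : Prop :=
  ∀ n, (PowerSeries.coeff n G).totalDegree ≤ n

theorem IsGradedSeries.mul {F G : PowerSeries Poly} (hF : IsGradedSeries F)
    (hG : IsGradedSeries G) : IsGradedSeries (F * G) := by
  intro n
  rw [PowerSeries.coeff_mul]
  refine totalDegree_finsetSum_le fun p hp => (totalDegree_mul _ _).trans ?_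
  have := Finset.HasAntidiagonal.mem_antidiagonal.1 hp
  have h1 := hF p.1
  have h2 := hG p.2
  omega

theorem isGradedSeries_factorSeries {x : Poly} (hx : x.totalDegree ≤ 1) :
    IsGradedSeries (factorSeries x) := by
  intro n
  rw [factorSeries, PowerSeries.coeff_mk]
  split_ifs
  · simp
  · refine (totalDegree_mul _ _).trans ?_
    rw [totalDegree_C, zero_add]
    exact (totalDegree_pow _ _).trans ((Nat.mul_le_mul_left _ hx).trans_eq (mul_one _))

theorem isGradedSeries_geomSeries {x : Poly} (hx : x.totalDegree ≤ 1) :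
    IsGradedSeries (geomSeries x) := by
  intro n
  rw [geomSeries, PowerSeries.coeff_mk]
  split_ifs
  · simp
  · exact (totalDegree_pow _ _).trans ((Nat.mul_le_mul_left _ hx).trans_eq (mul_one _))

theorem isGradedSeries_prod (s : Finset ℕ) :
    IsGradedSeries (∏ j ∈ s, factorSeries (X j)) := by
  classical
  induction s using Finset.induction_on with
  | empty =>
    intro n
    rw [Finset.prod_empty, PowerSeries.coeff_one]
    split_ifs <;> simp
  | insert j s hj ih =>
    rw [Finset.prod_insert hj]
    exact (isGradedSeries_factorSeries (by simp)).mul ih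

/-- The coefficient of `u^a` in `∏_{m < j ≤ k} (1 - t x_j u) / (1 - x_j u) · q x_1 u / (1 - q x_1
u)`. -/
noncomputable def limitSeries (m a k : ℕ) : Poly :=
  PowerSeries.coeff a ((∏ j ∈ Finset.Ico (m + 1) (k + 1), factorSeries (X j)) *
    geomSeries (C qpar * X 1))

theorem limitSeries_mem_asFrom {m : ℕ} (hm : 1 ≤ m) (a : ℕ) : limitSeries m a ∈ asFrom m := by
  have hCX : ∀ φ : Poly →ₐ[K] Poly, φ (C qpar * X 1) = C qpar * φ (X 1) := fun φ => by
    rw [map_mul]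
    exact congrArg (· * φ (X 1)) (φ.commutes _)
  refine ⟨fun k hk => ?_, fun k hk => ?_, ⟨a, fun k hk => ?_⟩, fun i hi n hn => ?_⟩
  · have : truncVars k (limitSeries m a k) = limitSeries m a k := by
      rw [limitSeries, map_coeff_series, hCX, truncVars_of_mem (X_mem_finPoly le_rfl
        (by omega))]
      congr 2
      refine Finset.prod_congr rfl fun j hj => ?_
      rw [Finset.mem_Ico] at hj
      rw [truncVars_of_mem (X_mem_finPoly (by omega) (by omega))]
    rw [← this]
    exact truncVars_mem k _
  · rw [limitSeries, limitSeries, map_coeff_series, hCX,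
      Finset.prod_Ico_succ_top (by omega)]
    have h1 : dropVar (k + 1) (X (k + 1) : Poly) = 0 := by simp [dropVar]
    have h2 : ∀ j, j ≠ k + 1 → dropVar (k + 1) (X j : Poly) = X j := fun j hj => by
      simp [dropVar, hj]
    rw [h1, factorSeries_zero, mul_one, h2 1 (by omega)]
    congr 2
    refine Finset.prod_congr rfl fun j hj => ?_
    rw [Finset.mem_Ico] at hj
    rw [h2 j (by omega)]
  · have hx : (C qpar * X 1 : Poly).totalDegree ≤ 1 := by
      refine (totalDegree_mul _ _).trans ?_
      rw [totalDegree_C, totalDegree_X]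
    exact ((isGradedSeries_prod _).mul (isGradedSeries_geomSeries hx)) a
  · have hprod : ∏ j ∈ Finset.Ico (m + 1) (n + 1), factorSeries (swapVars i (X j)) =
        ∏ j ∈ Finset.Ico (m + 1) (n + 1), factorSeries (X j) := by
      refine Finset.prod_equiv (Equiv.swap i (i + 1)) (fun j => ?_) fun j _ => by rw [swapVars_X]
      simp only [Finset.mem_Ico, Equiv.swap_apply_def]
      split_ifs <;> omega
    rw [limitSeries, map_coeff_series, hCX, swapVars_X,
      Equiv.swap_apply_of_ne_of_ne (by omega) (by omega), hprod]

/-! ### Convergence of the deformed Cherednik operators -/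

theorem omegaInv_X (k j : ℕ) : omegaInv k (X j) =
    if j < k then X (j + 1) else if j = k then C qpar * X 1 else X j := by
  rw [omegaInv, aeval_X]

/-- The substitution `ω_k⁻¹` does not depend on `k` on the polynomials that are fixed by the
relevant transpositions. -/
theorem omegaInv_eq_of_swapVars {m k : ℕ} (hk : m ≤ k) {p : Poly}
    (hp : ∀ j, m ≤ j → j < k → swapVars j p = p) : omegaInv k p = omegaInv m p := by
  induction k, hk using Nat.le_induction with
  | base => rfl
  | succ k hk ih =>
    rw [← ih fun j h h' => hp j h (by omega)]
    have h : (omegaInv (k + 1)).comp (swapVars k) = omegaInv k := by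
      refine algHom_ext fun j => ?_
      rw [AlgHom.comp_apply, swapVars_X, omegaInv_X, omegaInv_X, Equiv.swap_apply_def]
      split_ifs <;> first | rfl | omega | (congr 1; omega)
    rw [← h, AlgHom.comp_apply, hp k hk (by omega)]

theorem omegaInv_mem_asFrom {m : ℕ} (hm : 1 ≤ m) {S : ℕ → Poly} (hS : S ∈ symPast (m - 1)) :
    (fun k => omegaInv m (S k)) ∈ asFrom m := by
  have hCX : ∀ φ : Poly →ₐ[K] Poly, φ (C qpar * X 1) = C qpar * φ (X 1) := fun φ => by
    rw [map_mul]
    exact congrArg (· * φ (X 1)) (φ.commutes _)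
  have h1 : ∀ k j, j ≠ k + 1 → dropVar (k + 1) (X j : Poly) = X j := fun k j hj => by
    simp [dropVar, hj]
  obtain ⟨⟨hS1, hS2, d, hd⟩, hS3⟩ := hS
  refine ⟨fun k hk => ?_, fun k hk => ?_, ⟨d, fun k hk => ?_⟩, fun i hi n hn => ?_⟩
  · refine map_mem_finPoly _ (fun j hj hjk => ?_) (hS1 k)
    rw [omegaInv_X]
    split_ifs
    · exact X_mem_finPoly (by omega) (by omega)
    · exact mul_mem ((finPoly k).algebraMap_mem qpar) (X_mem_finPoly le_rfl (by omega))
    · exact X_mem_finPoly hj hjk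
  · have h : (dropVar (k + 1)).comp (omegaInv m) = (omegaInv m).comp (dropVar (k + 1)) := by
      refine algHom_ext fun j => ?_
      rw [AlgHom.comp_apply, AlgHom.comp_apply]
      by_cases hj : j = k + 1
      · subst hj
        have h0 : dropVar (k + 1) (X (k + 1) : Poly) = 0 := by simp [dropVar]
        rw [omegaInv_X, if_neg (by omega), if_neg (by omega), h0, map_zero]
      · rw [h1 k j hj, omegaInv_X]
        split_ifs
        · exact h1 k _ (by omega)
        · rw [hCX, h1 k _ (by omega)]
        · exact h1 k _ hj
    have h' := DFunLike.congr_fun h (S (k + 1))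
    rw [AlgHom.comp_apply, AlgHom.comp_apply, hS2 k] at h'
    exact h'
  · refine (totalDegree_aeval_le (fun j => ?_) _).trans (hd k)
    split_ifs
    · simp
    · refine (totalDegree_mul _ _).trans ?_
      rw [totalDegree_C, totalDegree_X]
    · simp
  · have h : (swapVars i).comp (omegaInv m) = (omegaInv m).comp (swapVars i) := by
      refine algHom_ext fun j => ?_
      rw [AlgHom.comp_apply, AlgHom.comp_apply, swapVars_X, omegaInv_X, omegaInv_X]
      rcases lt_trichotomy j m with hj | hj | hj
      · rw [Equiv.swap_apply_of_ne_of_ne (by omega) (by omega), if_pos hj, swapVars_X,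
          Equiv.swap_apply_of_ne_of_ne (by omega) (by omega)]
      · rw [Equiv.swap_apply_of_ne_of_ne (by omega) (by omega), if_neg (by omega), if_pos hj, hCX,
          swapVars_X, Equiv.swap_apply_of_ne_of_ne (by omega) (by omega)]
      · have : m < Equiv.swap i (i + 1) j := by
          rw [Equiv.swap_apply_def]
          split_ifs <;> omega
        rw [if_neg (by omega), if_neg (by omega), if_neg (by omega), if_neg (by omega), swapVars_X]
    have h' := DFunLike.congr_fun h (S n)
    rw [AlgHom.comp_apply, AlgHom.comp_apply, hS3 i (by omega) n hn] at h'
    exact h'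

theorem prOne_mem_asFrom {m : ℕ} (hm : 1 ≤ m) {F : ℕ → Poly} (hF : F ∈ asFrom m) :
    (fun k => prOne (F k)) ∈ asFrom m := by
  have h0 : ∀ j, dropVar 1 (X j : Poly) = if j = 1 then 0 else X j := fun j => by
    rw [dropVar, aeval_X]
  have hmem : (fun k => dropVar 1 (F k)) ∈ asFrom m := by
    obtain ⟨h1, h2, ⟨d, hd⟩, h4⟩ := hF
    refine ⟨fun k hk => ?_, fun k hk => ?_, ⟨d, fun k hk => ?_⟩, fun i hi n hn => ?_⟩
    · refine map_mem_finPoly _ (fun j hj hjk => ?_) (h1 k hk)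
      rw [h0]
      split_ifs
      · exact zero_mem _
      · exact X_mem_finPoly hj hjk
    · have h : (dropVar (k + 1)).comp (dropVar 1) = (dropVar 1).comp (dropVar (k + 1)) := by
        refine algHom_ext fun j => ?_
        simp only [AlgHom.comp_apply, dropVar, aeval_X]
        split_ifs <;> simp_all
      have h' := DFunLike.congr_fun h (F (k + 1))
      rw [AlgHom.comp_apply, AlgHom.comp_apply, h2 k hk] at h'
      exact h'
    · exact (totalDegree_dropVar_le _ _).trans (hd k hk)
    · have h : (swapVars i).comp (dropVar 1) = (dropVar 1).comp (swapVars i) := by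
        refine algHom_ext fun j => ?_
        rw [AlgHom.comp_apply, AlgHom.comp_apply, h0, swapVars_X, h0]
        by_cases hj : j = 1
        · rw [Equiv.swap_apply_of_ne_of_ne (by omega) (by omega), if_pos hj, map_zero]
        · have : Equiv.swap i (i + 1) j ≠ 1 := by
            rw [Equiv.swap_apply_def]
            split_ifs <;> omega
          rw [if_neg hj, if_neg this, swapVars_X]
      have h' := DFunLike.congr_fun h (F n)
      rw [AlgHom.comp_apply, AlgHom.comp_apply, h4 i hi n hn] at h'
      exact h'
  exact sub_mem hF hmem

/-- The part `t^{k+1-m} ϖ_k T_{k-1}⁻¹ ⋯ T_m⁻¹` of the deformed Cherednik operator. -/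
noncomputable def affinePart (m k : ℕ) : Module.End K Poly :=
  tpar ^ (k + 1 - m) •
    (varpi k * ((List.range' m (k - m)).reverse.map demazureLusztigInv).prod)

theorem deformedCherednik_eq {i m k : ℕ} (hi : i ≤ m) (hk : m ≤ k) :
    deformedCherednik i k = tpar ^ (m - i) •
      (((List.range' 1 (i - 1)).reverse.map demazureLusztig).prod * affinePart m k *
        ((List.range' i (m - i)).reverse.map demazureLusztigInv).prod) := by
  have h : List.range' i (k - i) = List.range' i (m - i) ++ List.range' m (k - m) := by
    have := List.range'_append (s := i) (m := m - i) (n := k - m) (step := 1)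
    rw [one_mul, Nat.add_sub_cancel' hi] at this
    rw [this]
    congr 1
    omega
  rw [deformedCherednik, affinePart, h, List.reverse_append, List.map_append, List.prod_append]
  simp only [mul_smul_comm, smul_mul_assoc, smul_smul, mul_assoc, ← pow_add]
  congr 2
  omega

theorem affinePart_of_symPast {m : ℕ} (hm : 1 ≤ m) {S : ℕ → Poly} (hS : S ∈ symPast (m - 1)) :
    ∃ g ∈ asFrom m, ∀ k, m ≤ k → affinePart m k (S k) = tpar ^ k • g k := by
  refine ⟨(tpar ^ (m - 1))⁻¹ • fun k => prOne (omegaInv m (S k)),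
    Subalgebra.smul_mem _ (prOne_mem_asFrom hm (omegaInv_mem_asFrom hm hS)) _, fun k hk => ?_⟩
  have hsw : ∀ j, m ≤ j → j < k → swapVars j (S k) = S k := fun j h h' =>
    hS.2 j (by omega) k h'
  have h1 : ((List.range' m (k - m)).reverse.map demazureLusztigInv).prod (S k) = S k := by
    have := prod_inv_mul_of_swapVars (i := m) (n := k - m) (p := S k)
      (fun j h h' => hsw j h (by omega)) 1
    rwa [mul_one, prod_inv_one, mul_one] at this
  have ht : tpar ^ k = tpar ^ (k + 1 - m) * tpar ^ (m - 1) := by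
    rw [← pow_add]
    congr 1
    omega
  rw [affinePart, LinearMap.smul_apply, Module.End.mul_apply, h1, varpi, Module.End.mul_apply,
    AlgHom.toLinearMap_apply, omegaInv_eq_of_swapVars hk hsw, Pi.smul_apply, smul_smul, ht,
    mul_assoc, mul_inv_cancel₀ (pow_ne_zero _ tpar_ne_zero), mul_one]

/-- The limit series is divisible by `x_1`, so that `pr_1` does not affect it. -/
theorem dropVar_limitSeries (m a k : ℕ) : dropVar 1 (limitSeries m a k) = 0 := by
  have h : dropVar 1 (C qpar * X 1 : Poly) = 0 := by
    rw [map_mul, dropVar, aeval_X, if_pos rfl, mul_zero]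
  have h' : geomSeries 0 = 0 := by
    ext n : 1
    rw [geomSeries, PowerSeries.coeff_mk, map_zero]
    split_ifs with hn
    · rfl
    · exact zero_pow hn
  rw [limitSeries, map_coeff_series, h, h', mul_zero, map_zero]

theorem omegaInv_series (m k a : ℕ) :
    omegaInv k (PowerSeries.coeff a ((∏ j ∈ Finset.Ico m k, factorSeries (X j)) *
      geomSeries (X k))) = limitSeries m a k := by
  have h : ∏ j ∈ Finset.Ico m k, factorSeries (omegaInv k (X j)) =
      ∏ j ∈ Finset.Ico (m + 1) (k + 1), factorSeries (X j) := by
    rw [← Finset.prod_Ico_add']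
    refine Finset.prod_congr rfl fun j hj => ?_
    rw [omegaInv_X, if_pos (Finset.mem_Ico.1 hj).2]
  rw [map_coeff_series, h, omegaInv_X, if_neg (lt_irrefl k), if_pos rfl, limitSeries]

/-- For `a > 0` the images of `x_m^a S` under `t^{k+1-m} ϖ_k T_{k-1}⁻¹ ⋯ T_m⁻¹` are stable: no
powers of `t` that grow with `k` occur. -/
theorem affinePart_mul_X_pow {m k : ℕ} (hk : m ≤ k) {S : ℕ → Poly} (hS : S ∈ symPast (m - 1))
    (hm : 1 ≤ m) (a : ℕ) : affinePart m k (S k * X m ^ (a + 1)) =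
      tpar • (omegaInv m (S k) * limitSeries m (a + 1) k) := by
  have hsw : ∀ j, m ≤ j → j < k → swapVars j (S k) = S k := fun j h h' =>
    hS.2 j (by omega) k h'
  have h1 := prod_inv_X_pow (k - m) m a
  rw [Nat.add_sub_cancel' hk] at h1
  rw [affinePart, LinearMap.smul_apply, Module.End.mul_apply, prod_inv_mul_of_swapVars
    fun j h h' => hsw j h (by omega), show k + 1 - m = 1 + (k - m) by omega, pow_add, pow_one,
    mul_smul, ← map_smul, ← mul_smul_comm, h1, varpi, Module.End.mul_apply,
    AlgHom.toLinearMap_apply, map_mul, omegaInv_series, omegaInv_eq_of_swapVars hk hsw, prOne,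
    LinearMap.sub_apply, Module.End.one_apply, AlgHom.toLinearMap_apply, map_mul,
    dropVar_limitSeries, mul_zero, sub_zero]

/-- The sequences `F` for which `t^{k+1-m} ϖ_k T_{k-1}⁻¹ ⋯ T_m⁻¹ F_k` is the sum of a stable
sequence and of `t^k` times a stable sequence. -/
def convergentFrom (m : ℕ) : Submodule K (ℕ → Poly) where
  carrier := {F | ∃ h ∈ asFrom m, ∃ g ∈ asFrom m, ∀ k, m ≤ k →
    affinePart m k (F k) = h k + tpar ^ k • g k}
  add_mem' := by
    rintro F G ⟨h, hh, g, hg, H⟩ ⟨h', hh', g', hg', H'⟩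
    refine ⟨h + h', add_mem hh hh', g + g', add_mem hg hg', fun k hk => ?_⟩
    simp only [Pi.add_apply, map_add, smul_add, H k hk, H' k hk]
    abel
  zero_mem' := ⟨0, zero_mem _, 0, zero_mem _, fun k _ => by simp⟩
  smul_mem' := by
    rintro c F ⟨h, hh, g, hg, H⟩
    refine ⟨c • h, Subalgebra.smul_mem _ hh c, c • g, Subalgebra.smul_mem _ hg c, fun k hk => ?_⟩
    simp only [Pi.smul_apply, map_smul, H k hk, smul_add, smul_comm c]

theorem convergentFrom_congr {m : ℕ} {F G : ℕ → Poly} (h : ∀ k, m ≤ k → F k = G k)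
    (hG : G ∈ convergentFrom m) : F ∈ convergentFrom m := by
  obtain ⟨p, hp, g, hg, H⟩ := hG
  exact ⟨p, hp, g, hg, fun k hk => by rw [h k hk, H k hk]⟩

theorem mul_X_pow_mem_convergentFrom {m : ℕ} (hm : 1 ≤ m) {S : ℕ → Poly}
    (hS : S ∈ symPast (m - 1)) (a : ℕ) : (fun k => S k * X m ^ a) ∈ convergentFrom m := by
  cases a with
  | zero =>
    obtain ⟨g, hg, H⟩ := affinePart_of_symPast hm hS
    exact ⟨0, zero_mem _, g, hg, fun k hk => by
      simpa using H k hk⟩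
  | succ a =>
    refine ⟨tpar • ((fun k => omegaInv m (S k)) * limitSeries m (a + 1)),
      Subalgebra.smul_mem _ (mul_mem (omegaInv_mem_asFrom hm hS) (limitSeries_mem_asFrom hm _)) _,
      0, zero_mem _, fun k hk => ?_⟩
    rw [affinePart_mul_X_pow hk hS hm, Pi.zero_apply, smul_zero, add_zero]
    rfl

theorem X_pow_mem_asFrom {m : ℕ} (hm : 1 ≤ m) (a : ℕ) : (fun _ => X m ^ a) ∈ asFrom m := by
  refine ⟨fun k hk => pow_mem (X_mem_finPoly hm hk) _, fun k hk => ?_, ⟨a, fun k _ => ?_⟩,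
    fun i hi n _ => ?_⟩
  · rw [map_pow, dropVar, aeval_X, if_neg (by omega)]
  · rw [totalDegree_X_pow]
  · rw [map_pow, swapVars_X, Equiv.swap_apply_of_ne_of_ne (by omega) (by omega)]

theorem TailRel.erase {m : ℕ} (hm : 1 ≤ m) {f e : ℕ →₀ ℕ} (h : TailRel m f e) :
    TailRel (m - 1) (f.erase m) (e.erase m) := by
  obtain ⟨n, rfl⟩ : ∃ n, m = n + 1 := ⟨m - 1, by omega⟩
  rw [Nat.add_sub_cancel]
  refine ⟨fun j hj => ?_, ?_⟩
  · rw [Finsupp.erase_ne (by omega), Finsupp.erase_ne (by omega)]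
    exact h.1 j (by omega)
  · have key : ∀ d : ℕ →₀ ℕ, tailMs n (d.erase (n + 1)) = tailMs (n + 1) d := fun d => by
      rw [tailMs_of_eq_zero (Finsupp.erase_same)]
      exact tailMs_congr fun j hj => Finsupp.erase_ne (by omega)
    rw [key, key, h.2]

/-- Multiplying by `x_m^a` the orbit sum in the variables `x_m, x_{m+1}, …` gives the orbit sum of
`e` in the variables `x_{m+1}, x_{m+2}, …` up to orbit sums that have a smaller degree in the
latter. -/
theorem tail_sum_lt {m k : ℕ} (hm : 1 ≤ m) {e f : ℕ →₀ ℕ} (hf : InRange k f)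
    (h : coeff f (orbitSum (m - 1) (e.erase m) k * X m ^ e m) ≠ coeff f (orbitSum m e k)) :
    (tailMs m f).sum < (tailMs m e).sum := by
  classical
  rw [X_pow_eq_monomial, coeff_mul_monomial', coeff_orbitSum, coeff_orbitSum] at h
  by_cases hfe : TailRel m f e
  · refine absurd ?_ h
    have h1 : Finsupp.single m (e m) ≤ f := by
      rw [Finsupp.single_le_iff, hfe.1 m le_rfl]
    have h2 : f - Finsupp.single m (e m) = f.erase m := by
      ext j
      rw [Finsupp.tsub_apply]
      by_cases hj : j = m
      · subst hj
        rw [Finsupp.single_eq_same, Finsupp.erase_same, hfe.1 j le_rfl, Nat.sub_self]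
      · rw [Finsupp.single_eq_of_ne hj, Finsupp.erase_ne hj, Nat.sub_zero]
    have h3 : InRange k (f.erase m) := fun j hj => hf j fun h0 => hj (by
      by_cases hjm : j = m
      · rw [hjm, Finsupp.erase_same]
      · rw [Finsupp.erase_ne hjm, h0])
    rw [if_pos h1, h2, if_pos ⟨h3, hfe.erase hm⟩, if_pos ⟨hf, hfe⟩, mul_one]
  · rw [if_neg (c := InRange k f ∧ TailRel m f e) fun h' => hfe h'.2] at h
    have h1 : Finsupp.single m (e m) ≤ f := by
      by_contra h1
      exact h (if_neg h1)
    rw [if_pos h1, mul_one] at h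
    have h2 : TailRel (m - 1) (f - Finsupp.single m (e m)) (e.erase m) := by
      by_contra h2
      exact h (if_neg fun h' => h2 h'.2)
    obtain ⟨n, rfl⟩ : ∃ n, m = n + 1 := ⟨m - 1, by omega⟩
    rw [Nat.add_sub_cancel] at h2
    set f' := f - Finsupp.single (n + 1) (e (n + 1)) with hf'
    have hne : ∀ j, j ≠ n + 1 → f' j = f j := fun j hj => by
      rw [hf', Finsupp.tsub_apply, Finsupp.single_eq_of_ne hj, Nat.sub_zero]
    have e1 : tailMs (n + 1) f' = tailMs (n + 1) f := tailMs_congr fun j hj => hne j (by omega)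
    have e2 : tailMs n (e.erase (n + 1)) = tailMs (n + 1) e := by
      rw [tailMs_of_eq_zero (Finsupp.erase_same)]
      exact tailMs_congr fun j hj => Finsupp.erase_ne (by omega)
    have h3 := h2.2
    rw [e2] at h3
    by_cases h0 : f' (n + 1) = 0
    · refine absurd ⟨fun j hj => ?_, ?_⟩ hfe
      · by_cases hj' : j = n + 1
        · subst hj'
          have h4 := Finsupp.single_le_iff.1 h1
          rw [hf', Finsupp.tsub_apply, Finsupp.single_eq_same] at h0
          omega
        · rw [← hne j hj', h2.1 j (by omega), Finsupp.erase_ne hj']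
      · rw [← e1, ← tailMs_of_eq_zero h0, h3]
    · rw [← h3, tailMs_of_ne_zero h0, Multiset.sum_cons, e1]
      omega

theorem orbitSum_mem_convergentFrom {m : ℕ} (hm : 1 ≤ m) (e : ℕ →₀ ℕ) :
    orbitSum m e ∈ convergentFrom m := by
  generalize hN : (tailMs m e).sum = N
  induction N using Nat.strong_induction_on generalizing e with
  | _ N ih =>
    have hS := orbitSum_mem (m - 1) (e.erase m)
    have hmul := mul_X_pow_mem_convergentFrom hm hS (e m)
    have hfrom : (fun k => orbitSum (m - 1) (e.erase m) k * X m ^ e m) ∈ asFrom m :=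
      mul_mem (symPast.mem_asFrom (symPast_mono (Nat.sub_le m 1) hS)) (X_pow_mem_asFrom hm (e m))
    obtain ⟨G, hG, hGk⟩ := exists_symPast_of_asFrom hfrom
    have hG' := convergentFrom_congr hGk hmul
    have hD := sub_mem hG (orbitSum_mem m e)
    have hle : Submodule.span K (orbitSum m ''
        {f | TailSorted m f ∧ ∃ k, coeff f ((G - orbitSum m e) k) ≠ 0}) ≤ convergentFrom m := by
      rw [Submodule.span_le]
      rintro _ ⟨f, ⟨-, k, hk⟩, rfl⟩
      refine ih _ ?_ f rfl
      rw [← hN]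
      have hr := formalPoly.inRange hD.1 hk
      have hr' := hr.mono (le_max_left k m)
      rw [formalPoly.coeff_eq hD.1 hr hr', Pi.sub_apply, hGk _ (le_max_right k m), coeff_sub,
        sub_ne_zero] at hk
      exact tail_sum_lt hm hr' hk
    have := sub_mem hG' (hle (symPast.mem_span hD))
    rwa [sub_sub_cancel] at this

theorem symPast_le_convergentFrom {m : ℕ} (hm : 1 ≤ m) : symPast m ≤ convergentFrom m := by
  intro F hF
  refine (Submodule.span_le.2 ?_) (symPast.mem_span hF)
  rintro _ ⟨e, -, rfl⟩
  exact orbitSum_mem_convergentFrom hm e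

/-- The images `Ỹ_i^{(k)} F_k` are the sum of a stable sequence and of `t^k` times a stable
sequence. -/
theorem exists_deformedCherednik_eq {i m : ℕ} (hi : 1 ≤ i) (hm : i ≤ m) {F : ℕ → Poly}
    (hF : F ∈ symPast m) : ∃ h ∈ symPast m, ∃ g ∈ symPast m, ∀ k, m ≤ k →
      deformedCherednik i k (F k) = h k + tpar ^ k • g k := by
  have h1 := prod_mem_asFrom (f := demazureLusztigInv) (i := i) (m := m)
    (fun j hj hjm F hF => demazureLusztigInv_mem_asFrom (hi.trans hj) hjm hF) (m - i) (by omega)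
    (symPast.mem_asFrom hF)
  obtain ⟨G, hG, hGk⟩ := exists_symPast_of_asFrom h1
  obtain ⟨p, hp, r, hr, H⟩ := symPast_le_convergentFrom (hi.trans hm) hG
  have h2 : ∀ {p : ℕ → Poly}, p ∈ asFrom m → ∃ h ∈ symPast m, ∀ k, m ≤ k → h k =
      tpar ^ (m - i) • ((List.range' 1 (i - 1)).reverse.map demazureLusztig).prod (p k) :=
    fun {p} hp => exists_symPast_of_asFrom (Subalgebra.smul_mem _ (prod_mem_asFrom
      (f := demazureLusztig) (i := 1) (fun j hj hjm F hF => demazureLusztig_mem_asFrom hj hjm hF)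
      (i - 1) (by omega) hp) (tpar ^ (m - i)))
  obtain ⟨h, hh, Hh⟩ := h2 hp
  obtain ⟨g, hg, Hg⟩ := h2 hr
  refine ⟨h, hh, g, hg, fun k hk => ?_⟩
  rw [deformedCherednik_eq hm hk, LinearMap.smul_apply, Module.End.mul_apply, Module.End.mul_apply,
    ← hGk k hk, H k hk, Hh k hk, Hg k hk, map_add, map_smul, smul_add, smul_comm]

/-- If `F` is symmetric in `x_i, x_{i+1}, …`, then `Ỹ_i^{(k)} F_k` is `t^k` times a stable
sequence. -/
theorem exists_deformedCherednik_eq_of_lt {i : ℕ} (hi : 1 ≤ i) {F : ℕ → Poly}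
    (hF : F ∈ symPast (i - 1)) : ∃ g ∈ symPast i, ∀ k, i ≤ k →
      deformedCherednik i k (F k) = tpar ^ k • g k := by
  obtain ⟨r, hr, H⟩ := affinePart_of_symPast hi hF
  obtain ⟨g, hg, Hg⟩ := exists_symPast_of_asFrom (prod_mem_asFrom
    (f := demazureLusztig) (i := 1) (fun j hj hjm F hF => demazureLusztig_mem_asFrom hj hjm hF)
    (i - 1) (by omega) hr)
  refine ⟨g, hg, fun k hk => ?_⟩
  rw [deformedCherednik_eq le_rfl hk, Nat.sub_self, pow_zero, one_smul, List.range'_zero,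
    List.reverse_nil, List.map_nil, List.prod_nil, mul_one, Module.End.mul_apply, H k hk, map_smul,
    Hg k hk]

theorem scalarTendsto_tpar_pow : ScalarTendsto (fun k => tpar ^ k) 0 := by
  intro N
  filter_upwards [eventually_ge_atTop N] with k hk
  refine ⟨X 0 ^ k, 1, one_ne_zero, ?_, ?_⟩
  · rw [sub_zero, map_pow, map_one, div_one, tpar]
  · have h1 : polyOrd 1 = 0 := by
      rw [polyOrd, emultiplicity_eq_zero]
      exact X_prime.not_dvd_one
    rw [h1, add_zero]
    exact le_emultiplicity_of_pow_dvd (pow_dvd_pow _ hk)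

/-- A sequence of the form `h_k + t^k g_k` converges to `h`. -/
theorem isSeqLimit_add_pow_smul {m : ℕ} {f h g : ℕ → Poly} (hh : h ∈ symPast m)
    (hg : g ∈ symPast m) (hf : ∀ k, m ≤ k → f k = h k + tpar ^ k • g k) : IsSeqLimit f h := by
  refine ⟨1, h, fun _ => g, fun _ k => tpar ^ k, fun _ => 0, hh.1,
    fun _ => symPast.mem_almostSym hg, fun _ => scalarTendsto_tpar_pow, ?_, ?_⟩
  · filter_upwards [eventually_ge_atTop m] with k hk
    simpa using hf k hk
  · simp

/-! ### The limit Cherednik operators on almost symmetric monomials -/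

theorem coe_limitCherednik {i : ℕ} {f : almostSym} {F : ℕ → Poly} (hF : F ∈ almostSym)
    (h : IsSeqLimit (fun k => deformedCherednik i k ((f : ℕ → Poly) k)) F) :
    (limitCherednik i f : ℕ → Poly) = F := by
  have hex : ∃ F : almostSym,
      IsSeqLimit (fun k => deformedCherednik i k ((f : ℕ → Poly) k)) (F : ℕ → Poly) :=
    ⟨⟨F, hF⟩, h⟩
  rw [limitCherednik, dif_pos hex]
  exact hex.choose_spec.unique h

theorem isSeqLimit_limitCherednik {i : ℕ} (hi : 1 ≤ i) (f : almostSym) :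
    IsSeqLimit (fun k => deformedCherednik i k ((f : ℕ → Poly) k))
      (limitCherednik i f : ℕ → Poly) := by
  obtain ⟨m, hm⟩ := mem_almostSym_iff.1 f.2
  obtain ⟨h, hh, g, hg, H⟩ := exists_deformedCherednik_eq hi (le_max_left i m)
    (symPast_mono (le_max_right i m) hm)
  have := isSeqLimit_add_pow_smul hh hg H
  rwa [coe_limitCherednik (symPast.mem_almostSym hh) this]

theorem entry_eq_listExp (l : List ℕ) {j : ℕ} (hj : 1 ≤ j) : entry l j = listExp l j := by
  rw [listExp_apply, if_neg (by omega), entry]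

/-- The diagonal entry of `Ỹ_i^{(k)}` at a composition with `i`-th part `c` is `q^c t^u`, with `u`
the statistic `uStat`, or `0` if `c = 0`. -/
theorem cherednikWeight_listExp {i k : ℕ} (hi : 1 ≤ i) {l : List ℕ} (hil : i ≤ l.length)
    (hk : l.length ≤ k) : cherednikWeight i k (listExp l) =
      sgn i l * qpar ^ entry l i * tpar ^ uStat l i := by
  rw [cherednikWeight, sgn, entry_eq_listExp l hi]
  set e := listExp l
  by_cases h0 : e i = 0
  · rw [if_pos h0, if_neg (by omega)]
    ring
  · have h1 : (Finset.Icc 1 i).filter (fun j => entry l i < entry l j) =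
        (Finset.Ioc 0 (i - 1)).filter fun j => e i < e j := by
      ext j
      simp only [Finset.mem_filter, Finset.mem_Icc, Finset.mem_Ioc]
      constructor
      · rintro ⟨⟨hj, hji⟩, h⟩
        rw [entry_eq_listExp l hi, entry_eq_listExp l hj] at h
        have : j ≠ i := by
          rintro rfl
          exact lt_irrefl _ h
        exact ⟨by omega, h⟩
      · rintro ⟨hj, h⟩
        rw [entry_eq_listExp l hi, entry_eq_listExp l (by omega)]
        exact ⟨by omega, h⟩
    have h2 : (Finset.Icc i l.length).filter (fun j => entry l i ≤ entry l j) =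
        insert i ((Finset.Ioc i k).filter fun j => ¬ e j < e i) := by
      ext j
      simp only [Finset.mem_filter, Finset.mem_Icc, Finset.mem_insert, Finset.mem_Ioc, not_lt]
      constructor
      · rintro ⟨hj, h⟩
        rw [entry_eq_listExp l hi, entry_eq_listExp l (by omega)] at h
        by_cases hji : j = i
        · exact .inl hji
        · exact .inr ⟨by omega, h⟩
      · rintro (rfl | ⟨hj, h⟩)
        · exact ⟨by omega, le_rfl⟩
        · rw [entry_eq_listExp l hi, entry_eq_listExp l (by omega)]
          have h4 : e j ≠ 0 := by omega
          have := (listExp_inRange l j h4).2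
          exact ⟨by omega, h⟩
    rw [uStat, h1, h2, Finset.card_insert_of_notMem (by simp), if_neg h0, if_pos (by omega),
      Finset.prod_ite, Finset.prod_ite, Finset.prod_const_one, Finset.prod_const_one,
      Finset.prod_const, Finset.prod_const]
    ring

theorem toWeight_eq_expWeight (k : ℕ) (l : List ℕ) : toWeight k l = expWeight k (listExp l) := by
  funext j
  rw [toWeight, expWeight, listExp_succ]

/-- The list `λ 0⋯0 μ` is at most as long as the number of available variables, since the parts of
`μ` are nonzero. -/
theorem length_padded_le (b : AsIndex) {m k : ℕ} (hb : b.comp.length ≤ m) (hm : m ≤ k)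
    (h : InRange k (listExp (b.padded m))) : (b.padded m).length ≤ k := by
  by_cases hp : b.part = []
  · simp only [AsIndex.padded, hp, List.length_append, List.length_replicate, List.length_nil]
    omega
  · have hlen : b.padded m ≠ [] := by simp [AsIndex.padded, hp]
    have hlast : (b.padded m).getLast hlen = b.part.getLast hp := by
      simp only [AsIndex.padded]
      rw [List.getLast_append_of_ne_nil _ hp]
    have hpos := b.pos _ (List.getLast_mem hp)
    have h1 : listExp (b.padded m) (b.padded m).length = b.part.getLast hp := by
      rw [← hlast, List.getLast_eq_getElem, listExp_apply,
        if_neg (List.length_pos_iff.2 hlen).ne', List.getD_eq_getElem]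
    exact (h _ (by omega)).2

theorem prec_of_headBelow {a b : AsIndex} {k : ℕ} (hk : (a.comp ++ a.part).length ≤ k)
    (hlen : b.comp.length ≤ a.comp.length) (hr : InRange k (listExp (b.padded a.comp.length)))
    (hle : WeightLE (expWeight k (listExp (b.padded a.comp.length)))
      (expWeight k (listExp (a.comp ++ a.part))))
    (hlt : HeadBelow a.comp.length (listExp (b.padded a.comp.length))
      (listExp (a.comp ++ a.part))) : b.Prec a := by
  refine ⟨⟨hlen, k, length_padded_le b hlen ?_ hr, hk, ?_⟩, ?_⟩
  · rw [List.length_append] at hk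
    omega
  · rw [toWeight_eq_expWeight, toWeight_eq_expWeight]
    exact hle.weightBruhatLE
  · rintro rfl
    refine hlt.ne ?_
    rw [AsIndex.padded, Nat.sub_self, List.replicate_zero, List.append_nil]

/-- At each finite level, `Ỹ_i^{(k)} m_a - κ m_a` only involves lower exponents, as far as exponents
that are sorted beyond `ℓ(λ)` are concerned. -/
theorem deformedCherednik_asMonomialSeq {i k : ℕ} (hi : 1 ≤ i) (a : AsIndex)
    (hia : i ≤ a.comp.length) (hk : (a.comp ++ a.part).length ≤ k) :
    deformedCherednik i k (asMonomialSeq a k) -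
        cherednikWeight i k (listExp (a.comp ++ a.part)) • asMonomialSeq a k ∈
      suppIn {e | TailSorted a.comp.length e → InRange k e ∧
        WeightLE (expWeight k e) (expWeight k (listExp (a.comp ++ a.part))) ∧
        HeadBelow a.comp.length e (listExp (a.comp ++ a.part))} := by
  classical
  set m := a.comp.length with hm
  set E := listExp (a.comp ++ a.part) with hE
  have hEs : TailSorted m E := by
    have := tailSorted_padded a (m := m) le_rfl
    rwa [AsIndex.padded, Nat.sub_self, List.replicate_zero, List.append_nil] at this
  have hik : i ≤ k := by
    rw [List.length_append] at hk
    omega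
  have hsupp : asMonomialSeq a k ∈ suppIn {e | InRange k e ∧ TailRel m e E} := by
    intro e he
    rw [asMonomialSeq_eq, coeff_orbitSum] at he
    by_contra h
    exact he (if_neg h)
  refine map_mem_of_monomial (L := deformedCherednik i k - cherednikWeight i k E • 1)
    (fun e he => ?_) hsupp
  obtain ⟨hr, hrel⟩ := he
  have he0 : e 0 = 0 := by
    by_contra h
    have := (hr 0 h).1
    omega
  have htri := isTriangular_deformedCherednik hi hia hik e he0
  have hlow : deformedCherednik i k (monomial e 1) - cherednikWeight i k e • monomial e 1 ∈
      suppIn {f | TailSorted m f → InRange k f ∧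
        WeightLE (expWeight k f) (expWeight k E) ∧ HeadBelow m f E} := by
    intro f hf hfs
    replace hf := htri f hf
    obtain ⟨h1, h2, h3⟩ := transGen_lowStep hf hr
    obtain ⟨s, hs, hs'⟩ := exists_tailSorted m e
    have hsE : s = E := hs'.eq_of_tailRel hEs ((TailRel.of_sortSteps hs).trans hrel)
    rw [hsE] at hs
    exact ⟨h1, h2.trans_sortSteps hr hfs hs, hrel.headBelow_iff.1 h3⟩
  have hdiag : (cherednikWeight i k e - cherednikWeight i k E) • (monomial e 1 : Poly) ∈
      suppIn {f | TailSorted m f → InRange k f ∧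
        WeightLE (expWeight k f) (expWeight k E) ∧ HeadBelow m f E} := by
    by_cases hes : TailSorted m e
    · rw [hes.eq_of_tailRel hEs hrel, sub_self, zero_smul]
      exact zero_mem _
    · refine Submodule.smul_mem _ _ (monomial_mem_suppIn ?_ 1)
      exact fun h => absurd h hes
  have := add_mem hlow hdiag
  rw [sub_smul] at this
  simpa using this

/-- The coefficients of the limit `h` of a sequence `h_k + t^k g_k` can be detected on terms of the
sequence with `k` large. -/
theorem exists_coeff_ne_zero {h g : ℕ → Poly} (hh : h ∈ formalPoly) (hg : g ∈ formalPoly)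
    {k : ℕ} {e : ℕ →₀ ℕ} (he : coeff e (h k) ≠ 0) (n : ℕ) :
    ∃ k', n ≤ k' ∧ coeff e (h k' + tpar ^ k' • g k') ≠ 0 := by
  by_contra! hcon
  have hr := formalPoly.inRange hh he
  have h1 : ScalarTendsto (fun j => coeff e (h k) + tpar ^ j * coeff e (g k))
      (coeff e (h k) + 0 * coeff e (g k)) :=
    (ScalarTendsto.const _).add (scalarTendsto_tpar_pow.mul_const _)
  have h2 := h1.unique (ScalarTendsto.const 0) (by
    filter_upwards [eventually_ge_atTop n, eventually_ge_atTop k] with j hj hj'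
    have h3 := hcon j hj
    rwa [coeff_add, coeff_smul, smul_eq_mul, ← formalPoly.coeff_eq hh hr (hr.mono hj'),
      ← formalPoly.coeff_eq hg hr (hr.mono hj')] at h3)
  rw [zero_mul, add_zero] at h2
  exact he h2

/-- The limit `h` of `Ỹ_i^{(k)} m_a` minus its leading term is a combination of lower monomials. -/
theorem sub_mem_span_prec {i : ℕ} (hi : 1 ≤ i) (a : AsIndex) (hia : i ≤ a.comp.length)
    {h g : ℕ → Poly} (hh : h ∈ symPast a.comp.length) (hg : g ∈ symPast a.comp.length)
    (H : ∀ k, a.comp.length ≤ k →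
      deformedCherednik i k (asMonomialSeq a k) = h k + tpar ^ k • g k) :
    h - (sgn i (a.comp ++ a.part) * qpar ^ entry (a.comp ++ a.part) i *
        tpar ^ uStat (a.comp ++ a.part) i) • asMonomialSeq a ∈
      Submodule.span K (asMonomialSeq '' {b : AsIndex | b.Prec a}) := by
  set κ := sgn i (a.comp ++ a.part) * qpar ^ entry (a.comp ++ a.part) i *
    tpar ^ uStat (a.comp ++ a.part) i with hκ
  have hlen : a.comp.length ≤ (a.comp ++ a.part).length := by
    rw [List.length_append]
    omega
  have hD : h - κ • asMonomialSeq a ∈ symPast a.comp.length := by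
    refine sub_mem hh (Submodule.smul_mem _ κ ?_)
    rw [asMonomialSeq_eq]
    exact orbitSum_mem _ _
  refine (Submodule.span_le.2 ?_) (symPast.mem_span hD)
  rintro _ ⟨e, ⟨hes, k, hk⟩, rfl⟩
  obtain ⟨n, hn, hne⟩ := exists_coeff_ne_zero hD.1 hg.1 hk (a.comp ++ a.part).length
  have heq : (h - κ • asMonomialSeq a) n + tpar ^ n • g n =
      deformedCherednik i n (asMonomialSeq a n) -
        cherednikWeight i n (listExp (a.comp ++ a.part)) • asMonomialSeq a n := by
    rw [H n (hlen.trans hn), cherednikWeight_listExp hi (hia.trans hlen) hn, Pi.sub_apply,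
      Pi.smul_apply]
    abel
  rw [heq] at hne
  obtain ⟨hr, hle, hlt⟩ := deformedCherednik_asMonomialSeq hi a hia hn e hne hes
  refine Submodule.span_mono (Set.image_mono ?_) (orbitSum_mem_span hr hes)
  rintro b ⟨hb, hbr, hble, hbe⟩
  refine prec_of_headBelow hn hb hbr (hble.trans hle) ?_
  rcases hbe with hbe | hbe
  · rwa [hbe]
  · exact hbe.trans hlt

theorem mem_span_asMonomial {S : Set AsIndex} {f : almostSym}
    (h : (f : ℕ → Poly) ∈ Submodule.span K (asMonomialSeq '' S)) :
    f ∈ Submodule.span K (asMonomial '' S) := by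
  have himg : asMonomialSeq '' S = almostSym.val.toLinearMap '' (asMonomial '' S) := by
    rw [Set.image_image]
    rfl
  rw [himg, Submodule.span_image] at h
  obtain ⟨f', hf', he⟩ := h
  rwa [← Subtype.ext (show (f' : ℕ → Poly) = f from he)]

end StableLimitDAHA

theorem mainTheorem6 (i : ℕ) (hi : 1 ≤ i) :
    (∀ f : StableLimitDAHA.almostSym,
      StableLimitDAHA.IsSeqLimit
        (fun k => StableLimitDAHA.deformedCherednik i k ((f : ℕ → StableLimitDAHA.Poly) k))
        (StableLimitDAHA.limitCherednik i f : ℕ → StableLimitDAHA.Poly)) ∧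
    ∀ a : StableLimitDAHA.AsIndex,
      StableLimitDAHA.limitCherednik i (StableLimitDAHA.asMonomial a) -
          (StableLimitDAHA.sgn i a.comp *
              StableLimitDAHA.qpar ^ StableLimitDAHA.entry a.comp i *
              StableLimitDAHA.tpar ^ StableLimitDAHA.uStat (a.comp ++ a.part) i) •
            StableLimitDAHA.asMonomial a ∈
        Submodule.span StableLimitDAHA.K
          (StableLimitDAHA.asMonomial '' {b : StableLimitDAHA.AsIndex | b.Prec a}) := by
  open StableLimitDAHA in
  refine ⟨isSeqLimit_limitCherednik hi, fun a => mem_span_asMonomial ?_⟩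
  have ha : asMonomialSeq a ∈ symPast a.comp.length := by
    rw [asMonomialSeq_eq]
    exact orbitSum_mem _ _
  rw [AddSubgroupClass.coe_sub, Subalgebra.coe_smul]
  rcases le_or_gt i a.comp.length with hia | hia
  · obtain ⟨h, hh, g, hg, H⟩ := exists_deformedCherednik_eq hi hia ha
    rw [coe_limitCherednik (f := asMonomial a) (symPast.mem_almostSym hh)
      (isSeqLimit_add_pow_smul hh hg H)]
    have hent : entry (a.comp ++ a.part) i = entry a.comp i := by
      rw [entry, entry, List.getD_append _ _ _ _ (by omega)]
    have hsgn : sgn i (a.comp ++ a.part) = sgn i a.comp := by rw [sgn, sgn, hent]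
    have := sub_mem_span_prec hi a hia hh hg H
    rwa [hent, hsgn] at this
  · -- The monomial is symmetric in `x_i, x_{i+1}, …`, and only multiples of `t^k` occur.
    obtain ⟨g, hg, H⟩ := exists_deformedCherednik_eq_of_lt hi
      (symPast_mono (show a.comp.length ≤ i - 1 by omega) ha)
    have hlim : IsSeqLimit (fun k => deformedCherednik i k (asMonomialSeq a k)) 0 :=
      isSeqLimit_add_pow_smul (zero_mem _) hg fun k hk => by
        rw [H k hk, Pi.zero_apply, zero_add]
    have hsgn : sgn i a.comp = 0 := by
      rw [sgn, entry, List.getD_eq_default _ _ (by omega), if_neg (lt_irrefl 0)]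
    rw [coe_limitCherednik (f := asMonomial a) (zero_mem _) hlim, hsgn, zero_mul, zero_mul,
      zero_smul, sub_zero]
    exact zero_mem _
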